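/- **Model.** One observes $Z_n(t)=\int_0^t f(x)\,dx+n^{-1/2}B(t)$, $0\le t\le 1$, where $B$ is a standard Brownian motion and $f$ is unknown. For $\alpha>0$, $M>0$ and $k$ the greatest integer strictly less than $\alpha$, let $F(\alpha,M)$ be the set of functions $f$ on $[0,1]$ whose $k$-th derivative exists and satisfies $|f^{(k)}(x)-f^{(k)}(y)|\le M|x-y|^{\alpha-k}$ for all $x,y\in[0,1]$. For an estimator $\hat f_n$ and $c_n>0$ let $$R(\hat f_n,f;x_0,c_n)=\frac1{2c_n}E_f\int_{[x_0-c_n,\,x_0+c_n]\cap[0,1]}(\hat f_n(x)-f(x))^2\,dx .$$ **Wavelets.** Let $\phi$ (bounded, measurable, $\int\phi=1$) and $\psi$ be compactly supported father and mother wavelets such that, for some $j_0$, the functions $\phi_{j_0,k}$ ($1\le k\le 2^{j_0}$) and $\psi_{j,k}$ ($j\ge j_0$, $1\le k\le 2^j$) form an orthonormal basis of $L^2[0,1]$. Here $\phi_{j,k}(t)=2^{j/2}\phi(2^jt-k)$ and $\psi_{j,k}(t)=2^{j/2}\psi(2^jt-k)$, supported in $[0,1]$, except for the first $n_L$ and the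 last $n_R$ indices $k$, where they are replaced by boundary functions $2^{j/2}g^L_i(2^jt)$ and $2^{j/2}g^R_i(2^j(t-1))$ supported in $[0,1]$, built from fixed finite families of compactly supported functions (bounded and measurable in the father case). The wavelet $\psi$ is $r$-regular ($r\in\mathbb N$): it has $r$ continuous derivatives and $r$ vanishing moments, and the left and right boundary wavelets have the same property on $[0,\infty)$ and $(-\infty,0]$ respectively. **BlockJS estimator.** Let $\tilde y_{j_0,k}=\int_0^1\phi_{j_0,k}\,dZ_n$ and $y_{j,k}=\int_0^1\psi_{j,k}\,dZ_n$. Let $J=\lceil\log_2 n\rceil$, $L=\lfloor\log n\rfloor$, and let $\lambda_*=4.50524\ldots$ be the root greater than $1$ of $\lambda-\log\lambda-1=2$. At each level $j_0\le j<J$ divide $\{1,\dots,2^j\}$ into the consecutive blocks $\{k:(b-1)L+1\le k\le bL\}$, $b\geq 1$ (the last one may be shorter), let $S_{(jb)}^2$ be the sum of $y_{j,k}^2$ over the $b$-th block, and put $\hat\theta_{j,k}=\big(1-\lambda_*Ln^{-1}/S_{(jb)}^2\big)_+\,y_{j,k}$ for $k$ in the $b$-th block; put $\hat\theta_{j,k}=0$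 for $j\ge J$. The BlockJS estimator is $$\hat f_n=\sum_{k=1}^{2^{j_0}}\tilde y_{j_0,k}\,\phi_{j_0,k}+\sum_{j\ge j_0}\sum_{k=1}^{2^j}\hat\theta_{j,k}\,\psi_{j,k}.$$ It involves neither $x_0$ nor $c_n$ nor $\alpha$, $M$. **Corollary 4.** Let $\hat f_n$ be the BlockJS estimator, $0<x_0<1$, $c_n=n^{-\gamma}$ for some $\gamma>0$, and suppose that $\psi$ is $r$-regular with $r\ge\frac{1-\gamma}{2\gamma}$. Let $M>0$. Then for $0<\alpha<\frac{1-\gamma}{2\gamma}$, $$\limsup_{n\to\infty}\ n^{2\alpha/(1+2\alpha)}\sup_{f\in F(\alpha,M)}R(\hat f_n,f;x_0,c_n)<\infty,$$ and for $\alpha>0$ with $\frac{1-\gamma}{2\gamma}\le\alpha<r$, $$\limsup_{n\to\infty}\ \Big(\frac{n}{\log n}\Big)^{2\alpha/(1+2\alpha)}\sup_{f\in F(\alpha,M)}R(\hat f_n,f;x_0,c_n)<\infty.$$ -/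

import Mathlib

open MeasureTheory ProbabilityTheory Set Filter
open scoped NNReal ENNReal

noncomputable section

/-- The Hölder class `F(α, M)` of functions on `[0, 1]`: with `k` the greatest integer strictly
less than `α`, the derivative `f^(k)` exists on `[0, 1]` and
`|f^(k)(x) - f^(k)(y)| ≤ M |x - y|^(α - k)`. Such an `f^(k)` is automatically continuous, so that
`f` is `C^k`. Values of `f` off `[0, 1]` play no role. -/
def holderClass (α M : ℝ) : Set (ℝ → ℝ) :=
  {f | ContDiffOn ℝ ((⌈α⌉₊ - 1 : ℕ) : ℕ∞) f (Icc 0 1) ∧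
    ∀ x ∈ Icc (0 : ℝ) 1, ∀ y ∈ Icc (0 : ℝ) 1,
      |iteratedDerivWithin (⌈α⌉₊ - 1) f (Icc 0 1) x
        - iteratedDerivWithin (⌈α⌉₊ - 1) f (Icc 0 1) y|
        ≤ M * |x - y| ^ (α - ((⌈α⌉₊ - 1 : ℕ) : ℝ))}

/-- `g` is `r`-regular on `S`: it has `r` continuous derivatives (one-sided ones at an end point
of the interval `S`) and `r` vanishing moments. -/
structure IsRegularOn (r : ℕ) (S : Set ℝ) (g : ℝ → ℝ) : Prop where
  contDiffOn : ContDiffOn ℝ (r : ℕ∞) g S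
  moments : ∀ m < r, ∫ x in S, x ^ m * g x = 0

/-- The dilated and translated functions of level `j`, for `1 ≤ k ≤ 2 ^ j`, built from an interior
function `g`, left edge functions `gL 0, …, gL (nL - 1)` and right edge functions
`gR 0, …, gR (nR - 1)`: the interior ones are `2^(j/2) g(2^j t - k)`, the first `nL` are
`2^(j/2) gL i (2^j t)`, the last `nR` are `2^(j/2) gR i (2^j (t - 1))`. -/
def dilate (nL nR : ℕ) (g : ℝ → ℝ) (gL gR : ℕ → ℝ → ℝ) (j k : ℕ) (t : ℝ) : ℝ :=
  (2 : ℝ) ^ ((j : ℝ) / 2) *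
    (if k ≤ nL then gL (k - 1) (2 ^ j * t)
     else if k + nR ≤ 2 ^ j then g (2 ^ j * t - k)
     else gR (2 ^ j - k) (2 ^ j * (t - 1)))

/-- A compactly supported, `r`-regular, boundary corrected orthonormal wavelet basis of
`L²[0, 1]`, starting at the level `j0`. The father wavelet `φ` and the mother wavelet `ψ` give the
functions in the interior; `nL` functions at the left edge and `nR` functions at the right edge are
replaced by dilates of finitely many edge functions, those of the mother wavelet being `r`-regular
on their half-line as `ψ` is on the line. -/
structure IntervalWavelet (r : ℕ) where
  j0 : ℕ
  nL : ℕ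
  nR : ℕ
  φ : ℝ → ℝ
  ψ : ℝ → ℝ
  φL : ℕ → ℝ → ℝ
  φR : ℕ → ℝ → ℝ
  ψL : ℕ → ℝ → ℝ
  ψR : ℕ → ℝ → ℝ
  card_le : nL + nR ≤ 2 ^ j0
  /- compact supports; they make all functions of level at least `j0` live on `[0, 1]` -/
  support_φ : Function.support φ ⊆ Icc (-((nL : ℝ) + 1)) nR
  support_ψ : Function.support ψ ⊆ Icc (-((nL : ℝ) + 1)) nR
  support_φL : ∀ i < nL, Function.support (φL i) ⊆ Icc 0 (2 ^ j0)
  support_ψL : ∀ i < nL, Function.support (ψL i) ⊆ Icc 0 (2 ^ j0)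
  support_φR : ∀ i < nR, Function.support (φR i) ⊆ Icc (-(2 ^ j0)) 0
  support_ψR : ∀ i < nR, Function.support (ψR i) ⊆ Icc (-(2 ^ j0)) 0
  /- the scaling functions are bounded and measurable, and `∫ φ = 1` -/
  measurable_φ : Measurable φ
  measurable_φL : ∀ i < nL, Measurable (φL i)
  measurable_φR : ∀ i < nR, Measurable (φR i)
  bounded_φ : ∃ C, ∀ x, |φ x| ≤ C
  bounded_φL : ∀ i < nL, ∃ C, ∀ x, |φL i x| ≤ C
  bounded_φR : ∀ i < nR, ∃ C, ∀ x, |φR i x| ≤ C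
  integral_φ : ∫ x, φ x = 1
  /- `r`-regularity of the wavelets -/
  regular_ψ : IsRegularOn r univ ψ
  regular_ψL : ∀ i < nL, IsRegularOn r (Ici 0) (ψL i)
  regular_ψR : ∀ i < nR, IsRegularOn r (Iic 0) (ψR i)
  /- orthonormality in `L²[0, 1]` -/
  orthonormal_φ : ∀ k ∈ Finset.Icc 1 (2 ^ j0), ∀ l ∈ Finset.Icc 1 (2 ^ j0),
    ∫ t in Icc (0 : ℝ) 1, dilate nL nR φ φL φR j0 k t * dilate nL nR φ φL φR j0 l t
      = if k = l then 1 else 0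
  orthogonal_φψ : ∀ k ∈ Finset.Icc 1 (2 ^ j0), ∀ j ≥ j0, ∀ l ∈ Finset.Icc 1 (2 ^ j),
    ∫ t in Icc (0 : ℝ) 1, dilate nL nR φ φL φR j0 k t * dilate nL nR ψ ψL ψR j l t = 0
  orthonormal_ψ : ∀ i ≥ j0, ∀ k ∈ Finset.Icc 1 (2 ^ i), ∀ j ≥ j0, ∀ l ∈ Finset.Icc 1 (2 ^ j),
    ∫ t in Icc (0 : ℝ) 1, dilate nL nR ψ ψL ψR i k t * dilate nL nR ψ ψL ψR j l t
      = if i = j ∧ k = l then 1 else 0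
  /- completeness in `L²[0, 1]` -/
  complete : ∀ f : ℝ → ℝ, MemLp f 2 (volume.restrict (Icc 0 1)) →
    (∀ k ∈ Finset.Icc 1 (2 ^ j0),
      ∫ t in Icc (0 : ℝ) 1, f t * dilate nL nR φ φL φR j0 k t = 0) →
    (∀ j ≥ j0, ∀ k ∈ Finset.Icc 1 (2 ^ j),
      ∫ t in Icc (0 : ℝ) 1, f t * dilate nL nR ψ ψL ψR j k t = 0) →
    f =ᵐ[volume.restrict (Icc 0 1)] 0

/-- The father functions `φ_{j0, k}`, `1 ≤ k ≤ 2 ^ j0`, of the basis. -/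
def IntervalWavelet.father {r : ℕ} (W : IntervalWavelet r) (k : ℕ) : ℝ → ℝ :=
  dilate W.nL W.nR W.φ W.φL W.φR W.j0 k

/-- The wavelets `ψ_{j, k}`, `j ≥ j0`, `1 ≤ k ≤ 2 ^ j`, of the basis. -/
def IntervalWavelet.mother {r : ℕ} (W : IntervalWavelet r) (j k : ℕ) : ℝ → ℝ :=
  dilate W.nL W.nR W.ψ W.ψL W.ψR j k

/-- The observed Gaussian process `Z_n(t) = ∫₀ᵗ f(x) dx + n^(-1/2) B(t)`, used for `t ≤ 1` only. -/
def observation {Ω : Type*} (B : ℝ≥0 → Ω → ℝ) (n : ℕ) (f : ℝ → ℝ) (t : ℝ≥0) (ω : Ω) : ℝ :=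
  (∫ x in (0 : ℝ)..t, f x) + (√(n : ℝ))⁻¹ * B t ω

/-- `Y` is (a version of) the Wiener integral `∫₀¹ g dZ`: there are step functions
`∑ aᵢ 1_(sᵢ, tᵢ]` on `[0, 1]` converging to `g` in `L²[0, 1]` for which the elementary integrals
`∑ aᵢ (Z(tᵢ) - Z(sᵢ))` converge to `Y` in `L²(P)`. -/
def IsWienerIntegral {Ω : Type*} [MeasurableSpace Ω] (P : Measure Ω) (Z : ℝ≥0 → Ω → ℝ)
    (g : ℝ → ℝ) (Y : Ω → ℝ) : Prop :=
  AEMeasurable Y P ∧ ∀ ε : ℝ≥0∞, 0 < ε →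
    ∃ (m : ℕ) (a : Fin m → ℝ) (s t : Fin m → ℝ≥0), (∀ i, s i ≤ t i ∧ t i ≤ 1) ∧
      eLpNorm (fun x => g x - ∑ i, a i * (Ioc (s i : ℝ) (t i)).indicator (fun _ => 1) x) 2
        (volume.restrict (Icc 0 1)) < ε ∧
      eLpNorm (fun ω => Y ω - ∑ i, a i * (Z (t i) ω - Z (s i) ω)) 2 P < ε

/-- `yt n f k` and `y n f j k` are the empirical wavelet coefficients of the process observed at
noise level `n^(-1/2)` under `f`: the Wiener integrals of the basis functions against it. -/
structure IsEmpiricalCoeff {Ω : Type*} [MeasurableSpace Ω] (P : Measure Ω) (B : ℝ≥0 → Ω → ℝ)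
    {r : ℕ} (W : IntervalWavelet r) (yt : ℕ → (ℝ → ℝ) → ℕ → Ω → ℝ)
    (y : ℕ → (ℝ → ℝ) → ℕ → ℕ → Ω → ℝ) : Prop where
  father : ∀ n > 0, ∀ f, MemLp f 2 (volume.restrict (Icc (0 : ℝ) 1)) →
    ∀ k ∈ Finset.Icc 1 (2 ^ W.j0),
      IsWienerIntegral P (observation B n f) (W.father k) (yt n f k)
  mother : ∀ n > 0, ∀ f, MemLp f 2 (volume.restrict (Icc (0 : ℝ) 1)) →
    ∀ j ≥ W.j0, ∀ k ∈ Finset.Icc 1 (2 ^ j),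
      IsWienerIntegral P (observation B n f) (W.mother j k) (y n f j k)

/-- The block length `L = log n` (integer part). -/
def blockLength (n : ℕ) : ℕ := ⌊Real.log n⌋₊

/-- `S²` for the block of level `j` containing `k`; the `b`-th block is
`{k : (b - 1) L + 1 ≤ k ≤ b L}` within `1, …, 2 ^ j`. -/
def blockSumSq (n : ℕ) (y : ℕ → ℕ → ℝ) (j k : ℕ) : ℝ :=
  ∑ l ∈ Finset.Icc 1 (2 ^ j) with (l - 1) / blockLength n = (k - 1) / blockLength n, y j l ^ 2

/-- The blockwise James–Stein estimate of `θ_{j, k}`, with `2 ^ J ≥ n` at `J = ⌈log₂ n⌉`. -/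
def thetaHat (lam : ℝ) (n : ℕ) (y : ℕ → ℕ → ℝ) (j k : ℕ) : ℝ :=
  if j < Nat.clog 2 n then
    max (1 - lam * blockLength n * (n : ℝ)⁻¹ / blockSumSq n y j k) 0 * y j k
  else 0

/-- The BlockJS estimate of the function from the coefficients `yt`, `y`. The levels `j ≥ J`
contribute nothing and are left out of the sum. -/
def blockJS {r : ℕ} (W : IntervalWavelet r) (lam : ℝ) (n : ℕ) (yt : ℕ → ℝ) (y : ℕ → ℕ → ℝ)
    (x : ℝ) : ℝ :=
  (∑ k ∈ Finset.Icc 1 (2 ^ W.j0), yt k * W.father k x) +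
    ∑ j ∈ Finset.Ico W.j0 (Nat.clog 2 n), ∑ k ∈ Finset.Icc 1 (2 ^ j),
      thetaHat lam n y j k * W.mother j k x

/-- The local risk `(2c)⁻¹ E ∫_{x₀ - c}^{x₀ + c} (f̂(x) - f(x))² dx`, the integral being over the
part of the neighborhood in `[0, 1]`, where functions are defined. -/
def localRisk {Ω : Type*} [MeasurableSpace Ω] (P : Measure Ω) (fhat : Ω → ℝ → ℝ) (f : ℝ → ℝ)
    (x0 c : ℝ) : ℝ≥0∞ :=
  (∫⁻ ω, ∫⁻ x in Icc (x0 - c) (x0 + c) ∩ Icc 0 1, ENNReal.ofReal ((fhat ω x - f x) ^ 2) ∂volume ∂P)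
    / ENNReal.ofReal (2 * c)

end

/-!
The empirical wavelet coefficients of a block are Wiener integrals of an orthonormal family, hence
independent Gaussian variables with variance `1 / n` centred at the true coefficients
(`map_wienerIntegral_eq_pi`). This reduces the theorem to the Gaussian sequence model.

**Risk of the coefficients.** The James–Stein rule moves a block by at most the root of the
threshold `lam L / n`, so that the risk of a block of length `L` is always `O(L / n)`. If on the
other hand the squared coefficients of the level are at most `A`, each coordinate has risk `O(A)`
up to the contribution of pure noise that passes the threshold. For `lam - log lam - 1 = 2` the
Chernoff bound for `χ²`-variables makes that contribution about `n ^ (-2)`. Part of the threshold is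
spent on absorbing a small signal, which lowers `lam` to some `μ < lam` and the exponent by an
arbitrarily small amount; since the rate exponent `κ = 2 α / (1 + 2 α)` is less than one, there is
room for this (`exists_lt_chernoff_exponent`). Together, a coordinate has risk
`O(min (A, L / n))` and a full block `O(L min (A, 1 / n))`: the logarithm is lost only if
single coordinates rather than full blocks are looked at (`exists_risk_bounds`).

**Approximation.** Vanishing moments and Taylor's formula bound the coefficients at level `j` of a
Hölder function by a multiple of `2 ^ (-j (α + 1 / 2))`, uniformly over the Hölder class
(`IntervalWavelet.HasBound.abs_coeff_le`). Thus `A = O(2 ^ (-j (1 + 2 α)))`, and the levels that are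
left out contribute `O(n ^ (-α))` in the supremum norm (`IntervalWavelet.HasBound.ae_abs_sub_le`).

**Localization.** On a neighbourhood wavelets of different levels are not orthogonal. The levels are
combined by a Cauchy–Schwarz inequality with weights that decay geometrically on either side of the
critical level `2 ^ j ≈ T ^ (-1 / (1 + 2 α))`, at which variance `T` and squared bias balance; this
costs a constant factor only and gives the rate `T ^ κ` (`localRisk_le`,
`exists_localRisk_le_rate`).
Within one level only boundedly many wavelets overlap. Bounding the risk of a level coordinatewise
gives `T = L / n` for every neighbourhood. Bounding it by the risks of the blocks that meet the
neighbourhood gives `T = 1 / n`, except for a boundary effect of the boundedly many blocks that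
stick out, which adds `O(L / (n c))` per level. If `c = n ^ (-γ)` with `α < (1 - γ) / (2 γ)`, then
`γ + κ < 1`, and this is smaller than `n ^ (-κ)` by a power of `n`.
-/

open scoped Topology

noncomputable section

/-! ### Integrals of step functions against Brownian motion -/

/-- The step function `∑ aᵢ 1_(sᵢ, tᵢ]`. -/
def stepFun {ι : Type*} [Fintype ι] (a : ι → ℝ) (s t : ι → ℝ≥0) (x : ℝ) : ℝ :=
  ∑ i, a i * (Ioc (s i : ℝ) (t i)).indicator (fun _ => 1) x

/-- The elementary integral `∑ aᵢ (Z(tᵢ) - Z(sᵢ))` of `stepFun a s t` against `Z`. -/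
def stepIntegral {Ω ι : Type*} [Fintype ι] (Z : ℝ≥0 → Ω → ℝ) (a : ι → ℝ) (s t : ι → ℝ≥0)
    (ω : Ω) : ℝ :=
  ∑ i, a i * (Z (t i) ω - Z (s i) ω)

lemma memLp_stepFun {ι : Type*} [Fintype ι] (a : ι → ℝ) (s t : ι → ℝ≥0) (p : ℝ≥0∞) :
    MemLp (stepFun a s t) p (volume.restrict (Icc (0 : ℝ) 1)) := by
  unfold stepFun
  refine memLp_finsetSum _ fun i _ => ?_
  refine MemLp.const_mul ?_ _
  exact (memLp_const (1 : ℝ)).indicator measurableSet_Ioc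

lemma integral_indicator_Ioc_mul (s t s' t' : ℝ≥0) (hst : s ≤ t) (hst' : s' ≤ t') (ht : t ≤ 1) :
    ∫ x in Icc (0 : ℝ) 1, (Ioc (s : ℝ) t).indicator (fun _ => (1 : ℝ)) x
      * (Ioc (s' : ℝ) t').indicator (fun _ => (1 : ℝ)) x
      = (min t t' : ℝ) - min t s' - min s t' + min s s' := by
  have h1 : ∀ x : ℝ, (Ioc (s : ℝ) t).indicator (fun _ => (1 : ℝ)) x
      * (Ioc (s' : ℝ) t').indicator (fun _ => (1 : ℝ)) x
      = (Ioc (max (s : ℝ) s') (min t t')).indicator (fun _ => (1 : ℝ)) x := by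
    intro x
    rw [← Ioc_inter_Ioc, ← inter_indicator_mul]
    simp
  simp_rw [h1]
  rw [integral_indicator measurableSet_Ioc, Measure.restrict_restrict measurableSet_Ioc]
  have h2 : Ioc (max (s : ℝ) s') (min t t') ∩ Icc 0 1 = Ioc (max (s : ℝ) s') (min t t') := by
    rw [inter_eq_left]
    intro x hx
    have : (t : ℝ) ≤ 1 := by exact_mod_cast ht
    exact ⟨le_trans (le_trans s.2 (le_max_left _ _)) hx.1.le,
      le_trans hx.2 (le_trans (min_le_left _ _) this)⟩
  rw [h2]
  simp only [integral_const, MeasurableSet.univ, measureReal_restrict_apply, univ_inter,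
    Real.volume_real_Ioc, smul_eq_mul, mul_one]
  have h3 : (s : ℝ) ≤ t := by exact_mod_cast hst
  have h4 : (s' : ℝ) ≤ t' := by exact_mod_cast hst'
  push_cast
  rcases le_total (t : ℝ) t' with h | h <;> rcases le_total (s : ℝ) s' with h' | h' <;>
    rcases le_total (t : ℝ) s' with h'' | h'' <;> rcases le_total (s : ℝ) t' with h''' | h''' <;>
    simp [*] <;> linarith

section
variable {Ω : Type*} [MeasurableSpace Ω] {P : Measure Ω} {B : ℝ≥0 → Ω → ℝ}

lemma covariance_increments (hB : IsPreBrownianReal B P) (s t s' t' : ℝ≥0) :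
    cov[fun ω => B t ω - B s ω, fun ω => B t' ω - B s' ω; P]
      = (min t t' : ℝ) - min t s' - min s t' + min s s' := by
  have : IsProbabilityMeasure P := hB.isGaussianProcess.isProbabilityMeasure
  have hm : ∀ t, MemLp (B t) 2 P := fun t =>
    (hB.isGaussianProcess.hasGaussianLaw_eval t).memLp_two
  rw [covariance_fun_sub_fun_sub (hm _) (hm _) (hm _) (hm _)]
  simp_rw [hB.covariance_fun_eval]
  push_cast
  ring

/-- The isometry property of the Wiener integral, for step functions. -/
lemma hasLaw_stepIntegral (hB : IsPreBrownianReal B P) {ι : Type*} [Fintype ι] (a : ι → ℝ)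
    (s t : ι → ℝ≥0) (hst : ∀ i, s i ≤ t i ∧ t i ≤ 1) :
    HasLaw (stepIntegral B a s t)
      (gaussianReal 0 (∫ x in Icc (0 : ℝ) 1, stepFun a s t x ^ 2).toNNReal) P := by
  classical
  have hP : IsProbabilityMeasure P := hB.isGaussianProcess.isProbabilityMeasure
  have hm : ∀ t, MemLp (B t) 2 P := fun t =>
    (hB.isGaussianProcess.hasGaussianLaw_eval t).memLp_two
  have hG : HasGaussianLaw (stepIntegral B a s t) P := by
    let I : Finset ℝ≥0 := Finset.univ.image s ∪ Finset.univ.image t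
    have hs : ∀ i, s i ∈ I := fun i => by simp [I]
    have ht : ∀ i, t i ∈ I := fun i => by simp [I]
    let Φ : (I → ℝ) →L[ℝ] ℝ := ∑ i, a i •
      (ContinuousLinearMap.proj (R := ℝ) (φ := fun _ : I => ℝ) ⟨t i, ht i⟩
        - ContinuousLinearMap.proj (R := ℝ) (φ := fun _ : I => ℝ) ⟨s i, hs i⟩)
    have := (hB.isGaussianProcess.hasGaussianLaw I).map_fun Φ
    refine this.congr (Eventually.of_forall fun ω => ?_)
    simp [Φ, stepIntegral, sum_apply]
  have hmean : P[stepIntegral B a s t] = 0 := by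
    unfold stepIntegral
    rw [integral_finsetSum]
    · refine Finset.sum_eq_zero fun i _ => ?_
      rw [integral_const_mul, integral_sub (hB.integrable_eval _) (hB.integrable_eval _),
        hB.integral_eval, hB.integral_eval]
      simp
    · intro i _
      exact ((hB.integrable_eval _).sub (hB.integrable_eval _)).const_mul _
  have hvar : Var[stepIntegral B a s t; P] = ∫ x in Icc (0 : ℝ) 1, stepFun a s t x ^ 2 := by
    have h1 : stepIntegral B a s t
        = fun ω => ∑ i, (fun ω => a i * (B (t i) ω - B (s i) ω)) ω := rfl
    have hmi : ∀ i, MemLp (fun ω => B (t i) ω - B (s i) ω) 2 P := fun i => (hm _).sub (hm _)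
    rw [h1, variance_fun_sum (fun i => (hmi i).const_mul _)]
    have h2 : ∀ x, stepFun a s t x ^ 2 = ∑ i, ∑ j, a i * a j *
        ((Ioc (s i : ℝ) (t i)).indicator (fun _ => (1 : ℝ)) x
          * (Ioc (s j : ℝ) (t j)).indicator (fun _ => (1 : ℝ)) x) := by
      intro x
      rw [stepFun, sq, Finset.sum_mul_sum]
      refine Finset.sum_congr rfl fun i _ => Finset.sum_congr rfl fun j _ => ?_
      ring
    simp_rw [h2]
    have hint : ∀ i j, Integrable (fun x => (Ioc (s i : ℝ) (t i)).indicator (fun _ => (1 : ℝ)) x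
          * (Ioc (s j : ℝ) (t j)).indicator (fun _ => (1 : ℝ)) x)
          (volume.restrict (Icc (0 : ℝ) 1)) := by
      intro i j
      refine MemLp.integrable_mul (p := 2) (q := 2) ?_ ?_
      · exact (memLp_const (1 : ℝ)).indicator measurableSet_Ioc
      · exact (memLp_const (1 : ℝ)).indicator measurableSet_Ioc
    rw [integral_finsetSum _ (fun i _ => integrable_finsetSum _ fun j _ => (hint i j).const_mul _)]
    refine Finset.sum_congr rfl fun i _ => ?_
    rw [integral_finsetSum _ (fun j _ => (hint i j).const_mul _)]
    refine Finset.sum_congr rfl fun j _ => ?_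
    rw [covariance_const_mul_left, covariance_const_mul_right, covariance_increments hB,
      integral_const_mul, integral_indicator_Ioc_mul _ _ _ _ (hst i).1 (hst j).1 (hst i).2]
    ring
  refine ⟨hG.aemeasurable, ?_⟩
  rw [hG.map_eq_gaussianReal, hmean, hvar]

end

/-! ### The law of the Wiener integrals -/

lemma stepIntegral_observation {Ω ι : Type*} [Fintype ι] {B : ℝ≥0 → Ω → ℝ} (n : ℕ) (f : ℝ → ℝ)
    (hf : IntegrableOn f (Icc (0 : ℝ) 1)) (a : ι → ℝ) (s t : ι → ℝ≥0)
    (hst : ∀ i, s i ≤ t i ∧ t i ≤ 1) (ω : Ω) :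
    stepIntegral (observation B n f) a s t ω =
      (√(n : ℝ))⁻¹ * stepIntegral B a s t ω + ∫ x in Icc (0 : ℝ) 1, f x * stepFun a s t x := by
  have h1 : ∀ x, f x * stepFun a s t x
      = ∑ i, a i * (Ioc (s i : ℝ) (t i)).indicator f x := by
    intro x
    rw [stepFun, Finset.mul_sum]
    refine Finset.sum_congr rfl fun i _ => ?_
    by_cases hx : x ∈ Ioc (s i : ℝ) (t i) <;> simp [hx, mul_comm]
  simp_rw [h1]
  rw [integral_finsetSum _ fun i _ => (hf.indicator measurableSet_Ioc).const_mul _]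
  unfold stepIntegral
  rw [Finset.mul_sum, ← Finset.sum_add_distrib]
  refine Finset.sum_congr rfl fun i _ => ?_
  have h0 : (0 : ℝ) ≤ s i := (s i).2
  have h2 : (s i : ℝ) ≤ t i := by exact_mod_cast (hst i).1
  have h3 : (t i : ℝ) ≤ 1 := by exact_mod_cast (hst i).2
  have hint : ∀ u v : ℝ, 0 ≤ u → u ≤ v → v ≤ 1 → IntervalIntegrable f volume u v := by
    intro u v hu huv hv
    rw [intervalIntegrable_iff_integrableOn_Icc_of_le huv]
    exact hf.mono_set (Icc_subset_Icc hu hv)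
  rw [integral_const_mul, integral_indicator measurableSet_Ioc,
    Measure.restrict_restrict measurableSet_Ioc]
  have h4 : Ioc (s i : ℝ) (t i) ∩ Icc 0 1 = Ioc (s i : ℝ) (t i) := by
    rw [inter_eq_left]
    exact fun x hx => ⟨h0.trans hx.1.le, hx.2.trans h3⟩
  rw [h4, ← intervalIntegral.integral_of_le h2]
  have h5 := intervalIntegral.integral_add_adjacent_intervals
    (hint 0 (s i) le_rfl h0 (h2.trans h3)) (hint (s i) (t i) h0 h2 h3)
  unfold observation
  rw [← h5]
  ring

section
variable {Ω : Type*} [MeasurableSpace Ω] {P : Measure Ω} {B : ℝ≥0 → Ω → ℝ}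

lemma hasLaw_stepIntegral_observation (hB : IsPreBrownianReal B P) {ι : Type*} [Fintype ι] (n : ℕ)
    (f : ℝ → ℝ) (hf : IntegrableOn f (Icc (0 : ℝ) 1)) (a : ι → ℝ) (s t : ι → ℝ≥0)
    (hst : ∀ i, s i ≤ t i ∧ t i ≤ 1) :
    HasLaw (stepIntegral (observation B n f) a s t)
      (gaussianReal (∫ x in Icc (0 : ℝ) 1, f x * stepFun a s t x)
        ((∫ x in Icc (0 : ℝ) 1, stepFun a s t x ^ 2) / n).toNNReal) P := by
  have h := gaussianReal_add_const (gaussianReal_const_mul (hasLaw_stepIntegral hB a s t hst)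
    (√(n : ℝ))⁻¹) (∫ x in Icc (0 : ℝ) 1, f x * stepFun a s t x)
  have hV : (0 : ℝ) ≤ ∫ x in Icc (0 : ℝ) 1, stepFun a s t x ^ 2 :=
    integral_nonneg fun x => sq_nonneg _
  convert h using 1
  · ext ω
    rw [stepIntegral_observation n f hf a s t hst]
  · congr 1
    · simp
    · ext
      push_cast
      rw [Real.coe_toNNReal _ hV, Real.coe_toNNReal _ (by positivity)]
      rw [inv_pow, Real.sq_sqrt (by positivity)]
      ring

/-- One sequence of step functions serves both limits in the definition of a Wiener integral. -/
lemma IsWienerIntegral.exists_seq {Z : ℝ≥0 → Ω → ℝ} {g : ℝ → ℝ} {Y : Ω → ℝ}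
    (h : IsWienerIntegral P Z g Y) :
    ∃ (m : ℕ → ℕ) (a : ∀ N, Fin (m N) → ℝ) (s t : ∀ N, Fin (m N) → ℝ≥0),
      (∀ N i, s N i ≤ t N i ∧ t N i ≤ 1) ∧
      Tendsto (fun N => eLpNorm (g - stepFun (a N) (s N) (t N)) 2
        (volume.restrict (Icc (0 : ℝ) 1))) atTop (𝓝 0) ∧
      Tendsto (fun N => eLpNorm (Y - stepIntegral Z (a N) (s N) (t N)) 2 P) atTop (𝓝 0) := by
  have h' : ∀ N : ℕ, (0 : ℝ≥0∞) < ((N : ℝ≥0∞) + 1)⁻¹ := fun N => by simp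
  choose m a s t h1 h2 h3 using fun N : ℕ => h.2 _ (h' N)
  have hl : Tendsto (fun N : ℕ => ((N : ℝ≥0∞) + 1)⁻¹) atTop (𝓝 0) := by
    have := ENNReal.tendsto_inv_nat_nhds_zero.comp (tendsto_add_atTop_nat 1)
    refine this.congr fun N => ?_
    simp
  exact ⟨m, a, s, t, h1, tendsto_of_tendsto_of_tendsto_of_le_of_le tendsto_const_nhds hl
    (fun _ => zero_le) fun N => (h2 N).le, tendsto_of_tendsto_of_tendsto_of_le_of_le
    tendsto_const_nhds hl (fun _ => zero_le) fun N => (h3 N).le⟩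

lemma tendsto_eLpNorm_linearCombination {α ι κ : Type*} [MeasurableSpace α] [Fintype ι]
    {l : Filter κ} {μ : Measure α} {u : ι → κ → α → ℝ} {v : ι → α → ℝ} (τ : ι → ℝ)
    (hv : ∀ i, AEStronglyMeasurable (v i) μ) (hu : ∀ i N, AEStronglyMeasurable (u i N) μ)
    (h : ∀ i, Tendsto (fun N => eLpNorm (v i - u i N) 2 μ) l (𝓝 0)) :
    Tendsto (fun N => eLpNorm ((fun x => ∑ i, τ i * u i N x) - fun x => ∑ i, τ i * v i x) 2 μ)
      l (𝓝 0) := by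
  have hl : Tendsto (fun N => ∑ i, ‖τ i‖ₑ * eLpNorm (v i - u i N) 2 μ) l (𝓝 0) := by
    have h0 : (0 : ℝ≥0∞) = ∑ i : ι, 0 := by simp
    refine h0 ▸ tendsto_finsetSum _ fun i _ => ?_
    simpa using ENNReal.Tendsto.const_mul (h i) (Or.inr (enorm_ne_top (x := τ i)))
  refine tendsto_of_tendsto_of_tendsto_of_le_of_le tendsto_const_nhds hl (fun _ => zero_le)
    fun N => ?_
  have h1 : ((fun x => ∑ i, τ i * u i N x) - fun x => ∑ i, τ i * v i x)
      = ∑ i, (τ i) • (u i N - v i) := by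
    ext x
    simp [mul_sub, Finset.sum_apply]
  dsimp only
  rw [h1]
  refine (eLpNorm_sum_le (fun i _ => ((hu i N).sub (hv i)).const_smul (τ i)) (by norm_num)).trans ?_
  refine Finset.sum_le_sum fun i _ => ?_
  rw [eLpNorm_const_smul, eLpNorm_sub_comm]

lemma tendsto_integral_mul_of_tendsto_eLpNorm {α κ : Type*} [MeasurableSpace α] {l : Filter κ}
    {μ : Measure α} {u u' : κ → α → ℝ} {v v' : α → ℝ} (hu : ∀ N, MemLp (u N) 2 μ)
    (hu' : ∀ N, MemLp (u' N) 2 μ) (hv : MemLp v 2 μ) (hv' : MemLp v' 2 μ)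
    (h : Tendsto (fun N => eLpNorm (u N - v) 2 μ) l (𝓝 0))
    (h' : Tendsto (fun N => eLpNorm (u' N - v') 2 μ) l (𝓝 0)) :
    Tendsto (fun N => ∫ x, u N x * u' N x ∂μ) l (𝓝 (∫ x, v x * v' x ∂μ)) := by
  rw [← Lp.tendsto_Lp_iff_tendsto_eLpNorm'' u hu v hv] at h
  rw [← Lp.tendsto_Lp_iff_tendsto_eLpNorm'' u' hu' v' hv'] at h'
  have key : ∀ {a b : α → ℝ} (ha : MemLp a 2 μ) (hb : MemLp b 2 μ),
      inner ℝ (ha.toLp a) (hb.toLp b) = ∫ x, a x * b x ∂μ := by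
    intro a b ha hb
    rw [L2.inner_def]
    refine integral_congr_ae ?_
    filter_upwards [ha.coeFn_toLp, hb.coeFn_toLp] with x h1 h2
    rw [h1, h2]
    simp [mul_comm]
  have := h.inner (𝕜 := ℝ) h'
  simpa only [key] using this

/-- Convergence in `L²` preserves Gaussian laws when the parameters converge; the limit may be
degenerate. -/
lemma hasLaw_gaussianReal_of_tendsto [IsProbabilityMeasure P] {X : ℕ → Ω → ℝ} {Y : Ω → ℝ}
    {m : ℕ → ℝ} {v : ℕ → ℝ≥0} {m' : ℝ} {v' : ℝ≥0}
    (hX : ∀ N, HasLaw (X N) (gaussianReal (m N) (v N)) P)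
    (hY : AEMeasurable Y P) (h : Tendsto (fun N => eLpNorm (X N - Y) 2 P) atTop (𝓝 0))
    (hm : Tendsto m atTop (𝓝 m')) (hv : Tendsto v atTop (𝓝 v')) :
    HasLaw Y (gaussianReal m' v') P := by
  have h1 : TendstoInMeasure P X atTop Y := tendstoInMeasure_of_tendsto_eLpNorm (by norm_num)
    (fun N => (hX N).aemeasurable.aestronglyMeasurable) hY.aestronglyMeasurable h
  have h2 := (h1.tendstoInDistribution (fun N => (hX N).aemeasurable)).tendsto
  replace h2 := ProbabilityMeasure.tendsto_iff_tendsto_charFun.1 h2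
  refine ⟨hY, ?_⟩
  have : IsProbabilityMeasure (P.map Y) := Measure.isProbabilityMeasure_map hY
  refine Measure.ext_of_charFun (funext fun u => ?_)
  refine tendsto_nhds_unique (h2 u) ?_
  simp only [ProbabilityMeasure.coe_mk, (hX _).map_eq, charFun_gaussianReal]
  have hm2 : Tendsto (fun N => ((m N : ℝ) : ℂ)) atTop (𝓝 (m' : ℂ)) :=
    (Complex.continuous_ofReal.tendsto _).comp hm
  have hv2 : Tendsto (fun N => ((v N : ℝ) : ℂ)) atTop (𝓝 ((v' : ℝ) : ℂ)) :=
    (Complex.continuous_ofReal.tendsto _).comp ((NNReal.continuous_coe.tendsto _).comp hv)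
  refine (Complex.continuous_exp.tendsto _).comp ?_
  exact ((hm2.const_mul _).mul_const _).sub ((hv2.mul_const _).div_const _)

/-- Linear combinations of Wiener integrals against the observed process are Gaussian. The joint
law, which the definition of a single Wiener integral does not mention, is thereby determined. -/
lemma hasLaw_linearCombination_wienerIntegral (hB : IsPreBrownianReal B P) {ι : Type*} [Fintype ι]
    {n : ℕ} {f : ℝ → ℝ} (hf : MemLp f 2 (volume.restrict (Icc (0 : ℝ) 1))) {g : ι → ℝ → ℝ}
    (hg : ∀ i, MemLp (g i) 2 (volume.restrict (Icc (0 : ℝ) 1))) {Y : ι → Ω → ℝ}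
    (hY : ∀ i, IsWienerIntegral P (observation B n f) (g i) (Y i)) (τ : ι → ℝ) :
    HasLaw (fun ω => ∑ i, τ i * Y i ω)
      (gaussianReal (∫ x in Icc (0 : ℝ) 1, f x * ∑ i, τ i * g i x)
        ((∫ x in Icc (0 : ℝ) 1, (∑ i, τ i * g i x) * ∑ i, τ i * g i x) / n).toNNReal) P := by
  have hP : IsProbabilityMeasure P := hB.isGaussianProcess.isProbabilityMeasure
  choose m a s t hst hg' hY' using fun i => (hY i).exists_seq
  have hfi : IntegrableOn f (Icc (0 : ℝ) 1) := hf.integrable (by norm_num)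
  have hX : ∀ i N, AEStronglyMeasurable
      (stepIntegral (observation B n f) (a i N) (s i N) (t i N)) P := fun i N =>
    (hasLaw_stepIntegral_observation hB n f hfi _ _ _ (hst i N)).aemeasurable.aestronglyMeasurable
  have hh : ∀ i N, MemLp (stepFun (a i N) (s i N) (t i N)) 2 (volume.restrict (Icc (0 : ℝ) 1)) :=
    fun i N => memLp_stepFun _ _ _ _
  -- the combination of the approximating elementary integrals is again an elementary integral
  let A : ∀ N, (Σ i, Fin (m i N)) → ℝ := fun N p => τ p.1 * a p.1 N p.2
  let S : ∀ N, (Σ i, Fin (m i N)) → ℝ≥0 := fun N p => s p.1 N p.2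
  let T : ∀ N, (Σ i, Fin (m i N)) → ℝ≥0 := fun N p => t p.1 N p.2
  have hA1 : ∀ N, stepFun (A N) (S N) (T N)
      = fun x => ∑ i, τ i * stepFun (a i N) (s i N) (t i N) x := by
    intro N
    ext x
    simp [A, S, T, stepFun, Fintype.sum_sigma, Finset.mul_sum, mul_assoc]
  have hA2 : ∀ N, stepIntegral (observation B n f) (A N) (S N) (T N)
      = fun ω => ∑ i, τ i * stepIntegral (observation B n f) (a i N) (s i N) (t i N) ω := by
    intro N
    ext x
    simp only [A, S, T, stepIntegral, Fintype.sum_sigma, Finset.mul_sum, mul_assoc]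
  have hG : MemLp (fun x => ∑ i, τ i * g i x) 2 (volume.restrict (Icc (0 : ℝ) 1)) :=
    memLp_finsetSum _ fun i _ => (hg i).const_mul _
  have t1 := tendsto_eLpNorm_linearCombination τ (fun i => (hg i).1) (fun i N => (hh i N).1) hg'
  have t2 := tendsto_eLpNorm_linearCombination τ (fun i => (hY i).1.aestronglyMeasurable) hX hY'
  simp_rw [← hA1] at t1
  simp_rw [← hA2] at t2
  refine hasLaw_gaussianReal_of_tendsto (fun N => hasLaw_stepIntegral_observation hB n f hfi
    (A N) (S N) (T N) fun p => hst p.1 N p.2) ?_ t2 ?_ ?_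
  · exact Finset.aemeasurable_fun_sum _ fun i _ => (hY i).1.const_mul _
  · exact tendsto_integral_mul_of_tendsto_eLpNorm (fun _ => hf) (fun N => memLp_stepFun _ _ _ _)
      hf hG (by simp) t1
  · refine (continuous_real_toNNReal.tendsto _).comp (Tendsto.div_const ?_ _)
    simp_rw [sq]
    exact tendsto_integral_mul_of_tendsto_eLpNorm (fun N => memLp_stepFun _ _ _ _)
      (fun N => memLp_stepFun _ _ _ _) hG hG t1 t1

/-- The Wiener integrals of an orthonormal family against the observed process are independent
Gaussian variables of variance `1 / n` centred at the coefficients of `f`. -/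
theorem map_wienerIntegral_eq_pi (hB : IsPreBrownianReal B P) {ι : Type*} [Fintype ι]
    [DecidableEq ι] {n : ℕ} {f : ℝ → ℝ} (hf : MemLp f 2 (volume.restrict (Icc (0 : ℝ) 1)))
    {g : ι → ℝ → ℝ} (hg : ∀ i, MemLp (g i) 2 (volume.restrict (Icc (0 : ℝ) 1)))
    (hg' : ∀ i j, ∫ x in Icc (0 : ℝ) 1, g i x * g j x = if i = j then 1 else 0)
    {Y : ι → Ω → ℝ} (hY : ∀ i, IsWienerIntegral P (observation B n f) (g i) (Y i)) :
    P.map (fun ω i => Y i ω)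
      = Measure.pi fun i => gaussianReal (∫ x in Icc (0 : ℝ) 1, f x * g i x) (n : ℝ≥0)⁻¹ := by
  have hP : IsProbabilityMeasure P := hB.isGaussianProcess.isProbabilityMeasure
  have hYm : AEMeasurable (fun ω i => Y i ω) P := aemeasurable_pi_lambda _ fun i => (hY i).1
  have : IsProbabilityMeasure (P.map fun ω i => Y i ω) := Measure.isProbabilityMeasure_map hYm
  rw [← charFun_eq_pi_iff]
  intro τ
  have hlaw := hasLaw_linearCombination_wienerIntegral hB hf hg hY (fun i => τ i)
  have hint : ∀ i j, Integrable (fun x => g i x * g j x) (volume.restrict (Icc (0 : ℝ) 1)) :=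
    fun i j => (hg i).integrable_mul (hg j)
  have e1 : ∫ x in Icc (0 : ℝ) 1, f x * ∑ i, τ i * g i x
      = ∑ i, τ i * ∫ x in Icc (0 : ℝ) 1, f x * g i x := by
    simp_rw [Finset.mul_sum, ← integral_const_mul]
    rw [← integral_finsetSum]
    · exact integral_congr_ae (Eventually.of_forall fun x =>
        Finset.sum_congr rfl fun i _ => by ring)
    · exact fun i _ => (hf.integrable_mul (hg i)).const_mul _
  have e2 : ∫ x in Icc (0 : ℝ) 1, (∑ i, τ i * g i x) * ∑ i, τ i * g i x = ∑ i, τ i ^ 2 := by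
    have : ∀ x, (∑ i, τ i * g i x) * ∑ i, τ i * g i x
        = ∑ i, ∑ j, τ i * τ j * (g i x * g j x) := by
      intro x
      rw [Finset.sum_mul_sum]
      exact Finset.sum_congr rfl fun i _ => Finset.sum_congr rfl fun j _ => by ring
    simp_rw [this]
    rw [integral_finsetSum _ (fun i _ => integrable_finsetSum _ fun j _ => (hint i j).const_mul _)]
    refine Finset.sum_congr rfl fun i _ => ?_
    rw [integral_finsetSum _ (fun j _ => (hint i j).const_mul _)]
    simp_rw [integral_const_mul, hg']
    simp [sq]
  rw [e1, e2] at hlaw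
  have h3 : charFun ((P.map fun ω i => Y i ω).map (WithLp.toLp 2)) τ
      = charFun (P.map fun ω => ∑ i, τ i * Y i ω) 1 := by
    rw [charFun, charFun_apply_real, integral_map (by fun_prop) (by fun_prop),
      integral_map hYm (by fun_prop), integral_map hlaw.aemeasurable (by fun_prop)]
    simp [PiLp.inner_apply, mul_comm]
  rw [h3, hlaw.map_eq, charFun_gaussianReal]
  simp_rw [charFun_gaussianReal]
  rw [← Complex.exp_sum]
  congr 1
  rw [Real.coe_toNNReal _ (by positivity)]
  push_cast
  simp only [one_mul, Finset.sum_mul, Finset.sum_div, Finset.sum_sub_distrib, one_pow, mul_one]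
  congr 1
  exact Finset.sum_congr rfl fun i _ => by ring

end

/-! ### Gaussian sequences and shrinkage -/

lemma lintegral_sq_gaussianReal (m : ℝ) (v : ℝ≥0) :
    ∫⁻ x, ENNReal.ofReal ((x - m) ^ 2) ∂(gaussianReal m v) = v := by
  have h := evariance_eq_lintegral_ofReal (μ := gaussianReal m v) (X := id)
  simp only [id, integral_id_gaussianReal] at h
  rw [← h]
  have h2 := (memLp_id_gaussianReal (μ := m) (v := v) 2).ofReal_variance_eq
  rw [variance_id_gaussianReal] at h2
  simpa using h2.symm

/-- An exponential moment of a squared centred Gaussian variable. The exponent is parametrized such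
that the integrand turns the density into a multiple of the density of variance `t * v`. -/
lemma lintegral_exp_sq_gaussianReal (m : ℝ) {v : ℝ≥0} (hv : v ≠ 0) {t : ℝ} (ht : 0 < t) :
    ∫⁻ x, ENNReal.ofReal (Real.exp ((1 - 1 / t) / 2 * ((x - m) ^ 2 / v))) ∂(gaussianReal m v)
      = ENNReal.ofReal (√t) := by
  have hv' : (0 : ℝ) < v := by positivity
  let w : ℝ≥0 := t.toNNReal * v
  have hw : w ≠ 0 := by simp [w, hv, ht]
  rw [gaussianReal_of_var_ne_zero _ hv,
    lintegral_withDensity_eq_lintegral_mul _ (measurable_gaussianPDF m v) (by fun_prop)]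
  have h1 : ∀ x, (gaussianPDF m v * fun x => ENNReal.ofReal
      (Real.exp ((1 - 1 / t) / 2 * ((x - m) ^ 2 / v)))) x
      = ENNReal.ofReal (√t) * gaussianPDF m w x := by
    intro x
    simp only [Pi.mul_apply, gaussianPDF_def]
    rw [← ENNReal.ofReal_mul (gaussianPDFReal_nonneg _ _ _),
      ← ENNReal.ofReal_mul (Real.sqrt_nonneg _)]
    congr 1
    have hw' : (w : ℝ) = t * v := by simp [w, ht.le]
    simp only [gaussianPDFReal_def, hw']
    rw [mul_assoc, ← Real.exp_add, ← mul_assoc]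
    congr 1
    · rw [show 2 * Real.pi * (t * (v : ℝ)) = t * (2 * Real.pi * v) by ring, Real.sqrt_mul ht.le,
        mul_inv, ← mul_assoc, mul_inv_cancel₀ (by positivity), one_mul]
    · congr 1
      field_simp
      ring
  simp_rw [h1]
  rw [lintegral_const_mul _ (measurable_gaussianPDF m w), lintegral_gaussianPDF_eq_one _ hw,
    mul_one]

/-- The variables `y i ω`, `i ∈ b`, are jointly distributed as independent Gaussian variables with
means `θ i` and variance `1 / n`. -/
structure IsGaussianSequence {Ω : Type*} [MeasurableSpace Ω] (P : Measure Ω) (n : ℕ) (b : Finset ℕ)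
    (θ : ℕ → ℝ) (y : ℕ → Ω → ℝ) : Prop where
  aemeasurable : ∀ i ∈ b, AEMeasurable (y i) P
  map_eq : P.map (fun ω (i : b) => y i ω)
    = Measure.pi fun i : b => gaussianReal (θ i) (n : ℝ≥0)⁻¹

section
variable {Ω : Type*} [MeasurableSpace Ω] {P : Measure Ω} {n : ℕ} {b : Finset ℕ} {θ : ℕ → ℝ}
  {y : ℕ → Ω → ℝ}

lemma IsGaussianSequence.lintegral_sq (h : IsGaussianSequence P n b θ y) {k : ℕ}
    (hk : k ∈ b) :
    ∫⁻ ω, ENNReal.ofReal ((y k ω - θ k) ^ 2) ∂P = ENNReal.ofReal (1 / n) := by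
  have hm : AEMeasurable (fun ω (i : b) => y i ω) P :=
    aemeasurable_pi_lambda _ fun i => h.aemeasurable i i.2
  have h1 := lintegral_map' (μ := P) (g := fun ω (i : b) => y i ω)
    (f := fun x => ENNReal.ofReal ((x ⟨k, hk⟩ - θ k) ^ 2))
    (Measurable.aemeasurable (by fun_prop)) hm
  rw [← h1, h.map_eq, (measurePreserving_eval (fun i : b => gaussianReal (θ i) (n : ℝ≥0)⁻¹)
    ⟨k, hk⟩).lintegral_comp (f := fun u : ℝ => ENNReal.ofReal ((u - θ k) ^ 2)) (by fun_prop),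
    lintegral_sq_gaussianReal]
  rw [ENNReal.ofReal, ENNReal.coe_inj]
  ext
  simp

lemma IsGaussianSequence.lintegral_exp (h : IsGaussianSequence P n b θ y) (hn : 0 < n) {t : ℝ}
    (ht : 0 < t) :
    ∫⁻ ω, ENNReal.ofReal (Real.exp ((1 - 1 / t) / 2 * (n * ∑ i ∈ b, (y i ω - θ i) ^ 2))) ∂P
      = ENNReal.ofReal (√t ^ b.card) := by
  have hm : AEMeasurable (fun ω (i : b) => y i ω) P :=
    aemeasurable_pi_lambda _ fun i => h.aemeasurable i i.2
  let F : ∀ i : b, ℝ → ℝ≥0∞ := fun i u =>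
    ENNReal.ofReal (Real.exp ((1 - 1 / t) / 2 * ((u - θ i) ^ 2 / ((n : ℝ≥0)⁻¹ : ℝ≥0))))
  have hF : ∀ i, Measurable (F i) := fun i => by fun_prop
  have h1 := lintegral_map' (μ := P) (g := fun ω (i : b) => y i ω)
    (f := fun x => ∏ i, F i (x i)) (Measurable.aemeasurable (by fun_prop)) hm
  have h2 : ∀ ω, ENNReal.ofReal (Real.exp ((1 - 1 / t) / 2 * (n * ∑ i ∈ b, (y i ω - θ i) ^ 2)))
      = ∏ i : b, F i (y i ω) := by
    intro ω
    rw [← ENNReal.ofReal_prod_of_nonneg (fun _ _ => (Real.exp_pos _).le), ← Real.exp_sum]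
    congr 2
    rw [← Finset.sum_coe_sort b, Finset.mul_sum, Finset.mul_sum]
    refine Finset.sum_congr rfl fun i _ => ?_
    push_cast
    rw [div_inv_eq_mul]
    ring
  simp_rw [h2]
  rw [← h1, h.map_eq]
  have h3 := lintegral_prod_eq_prod_lintegral_of_indepFun
    (μ := Measure.pi fun i : b => gaussianReal (θ i) (n : ℝ≥0)⁻¹) Finset.univ
    (fun i x => F i (x i)) (iIndepFun_pi (fun i => (hF i).aemeasurable)) (fun i => by fun_prop)
  rw [h3]
  have hv : (n : ℝ≥0)⁻¹ ≠ 0 := by positivity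
  have h4 : ∀ i : b, ∫⁻ x, F i (x i) ∂(Measure.pi fun i : b => gaussianReal (θ i) (n : ℝ≥0)⁻¹)
      = ENNReal.ofReal (√t) := by
    intro i
    rw [(measurePreserving_eval (fun i : b => gaussianReal (θ i) (n : ℝ≥0)⁻¹) i).lintegral_comp
      (hF i)]
    exact lintegral_exp_sq_gaussianReal _ hv ht
  simp_rw [h4]
  simp [ENNReal.ofReal_pow]

/-- The Chernoff bound for the part above `μ ℓ`, with `1 < μ`, of the mean of a `χ²`-variable with
at most `ℓ` degrees of freedom. -/
lemma IsGaussianSequence.lintegral_truncated (h : IsGaussianSequence P n b θ y) (hn : 0 < n)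
    {μ ℓ : ℝ} (hμ : 1 < μ) (hℓ : 2 ≤ (μ - 1) * ℓ) (hb : (b.card : ℝ) ≤ ℓ) :
    ∫⁻ ω, ENNReal.ofReal (if μ * ℓ / n < ∑ i ∈ b, (y i ω - θ i) ^ 2
        then ∑ i ∈ b, (y i ω - θ i) ^ 2 else 0) ∂P
      ≤ ENNReal.ofReal (μ * ℓ / n * Real.exp (-((μ - 1 - Real.log μ) / 2 * ℓ))) := by
  have hn' : (0 : ℝ) < n := by exact_mod_cast hn
  have hℓ0 : 0 < ℓ := by
    by_contra hc
    nlinarith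
  have hμ0 : 0 < μ := by linarith
  -- the optimal exponent in the Chernoff bound
  set s := (1 - 1 / μ) / 2 with hs
  have hsμ : s * μ = (μ - 1) / 2 := by rw [hs]; field_simp
  calc ∫⁻ ω, ENNReal.ofReal (if μ * ℓ / n < ∑ i ∈ b, (y i ω - θ i) ^ 2
        then ∑ i ∈ b, (y i ω - θ i) ^ 2 else 0) ∂P
      ≤ ∫⁻ ω, ENNReal.ofReal (μ * ℓ / n * Real.exp (-(s * μ * ℓ)))
          * ENNReal.ofReal (Real.exp (s * (n * ∑ i ∈ b, (y i ω - θ i) ^ 2))) ∂P := by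
        refine lintegral_mono fun ω => ?_
        rw [← ENNReal.ofReal_mul (by positivity)]
        refine ENNReal.ofReal_le_ofReal ?_
        rw [mul_assoc, ← Real.exp_add]
        set Z := ∑ i ∈ b, (y i ω - θ i) ^ 2
        split_ifs with hZ
        · -- `u ≤ u₀ exp (s (u - u₀))` for `u ≥ u₀` as soon as `s u₀ ≥ 1`
          rw [div_lt_iff₀ hn'] at hZ
          have h1 : Z * n / (μ * ℓ) ≤ Real.exp (-(s * μ * ℓ) + s * (n * Z)) := by
            refine le_trans ?_ (Real.add_one_le_exp _)
            rw [div_le_iff₀ (by positivity)]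
            have : 1 ≤ s * μ * ℓ := by rw [hsμ]; linarith
            have h2 : 0 ≤ (Z * n - μ * ℓ) * (s * μ * ℓ - 1) :=
              mul_nonneg (by linarith) (by linarith)
            nlinarith
          calc Z = μ * ℓ / n * (Z * n / (μ * ℓ)) := by field_simp
            _ ≤ _ := by gcongr
        · positivity
    _ = ENNReal.ofReal (μ * ℓ / n * Real.exp (-(s * μ * ℓ))) * ENNReal.ofReal (√μ ^ b.card) := by
        rw [lintegral_const_mul', h.lintegral_exp hn hμ0]
        exact ENNReal.ofReal_ne_top
    _ ≤ _ := by
        rw [← ENNReal.ofReal_mul (by positivity)]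
        refine ENNReal.ofReal_le_ofReal ?_
        rw [mul_assoc]
        gcongr
        have h1 : √μ ^ b.card = Real.exp (b.card * (Real.log μ / 2)) := by
          rw [← Real.log_sqrt hμ0.le, mul_comm, Real.exp_mul, Real.exp_log (by positivity),
            Real.rpow_natCast]
        rw [h1, ← Real.exp_add]
        refine Real.exp_le_exp.2 ?_
        have h2 : (b.card : ℝ) * (Real.log μ / 2) ≤ ℓ * (Real.log μ / 2) :=
          mul_le_mul_of_nonneg_right hb (by have := Real.log_pos hμ; positivity)
        rw [hsμ]
        linarith
end

/-- The James–Stein factor `(1 - τ / S)₊`. -/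
def shrinkage (τ S : ℝ) : ℝ := max (1 - τ / S) 0

section
variable {ι : Type*} (b : Finset ι) (θ y : ι → ℝ) {τ : ℝ}

lemma shrinkage_nonneg (τ S : ℝ) : 0 ≤ shrinkage τ S := le_max_right _ _

lemma shrinkage_le_one (hτ : 0 ≤ τ) {S : ℝ} (hS : 0 ≤ S) : shrinkage τ S ≤ 1 :=
  max_le (by linarith [div_nonneg hτ hS]) zero_le_one

/-- Shrinkage moves the block of observations by at most `√τ` in Euclidean norm. -/
lemma one_sub_shrinkage_sq_mul_le (hτ : 0 ≤ τ) {S : ℝ} (hS : 0 ≤ S) :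
    (1 - shrinkage τ S) ^ 2 * S ≤ τ := by
  unfold shrinkage
  rcases hS.eq_or_lt with rfl | hS
  · simpa using hτ
  rcases le_total (1 - τ / S) 0 with h | h
  · rw [max_eq_right h]
    have : 1 ≤ τ / S := by linarith
    rw [le_div_iff₀ hS] at this
    linarith
  · rw [max_eq_left h]
    have h1 : τ / S ≤ 1 := by linarith
    calc (1 - (1 - τ / S)) ^ 2 * S = τ / S * τ := by field_simp; ring
      _ ≤ 1 * τ := by gcongr
      _ = τ := one_mul _

lemma sum_sq_shrinkage_sub_le (hτ : 0 ≤ τ) :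
    ∑ i ∈ b, (shrinkage τ (∑ l ∈ b, y l ^ 2) * y i - θ i) ^ 2
      ≤ 2 * τ + 2 * ∑ i ∈ b, (y i - θ i) ^ 2 := by
  set S := ∑ l ∈ b, y l ^ 2
  have hS : 0 ≤ S := Finset.sum_nonneg fun _ _ => sq_nonneg _
  have h1 : ∀ i ∈ b, (shrinkage τ S * y i - θ i) ^ 2
      ≤ 2 * ((1 - shrinkage τ S) ^ 2 * y i ^ 2) + 2 * (y i - θ i) ^ 2 := fun i _ => by
    nlinarith [sq_nonneg ((y i - θ i) + (1 - shrinkage τ S) * y i)]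
  refine (Finset.sum_le_sum h1).trans ?_
  rw [Finset.sum_add_distrib, ← Finset.mul_sum, ← Finset.mul_sum, ← Finset.mul_sum]
  have := one_sub_shrinkage_sq_mul_le hτ hS
  linarith

lemma sq_shrinkage_sub_le (hτ : 0 ≤ τ) (k : ι) :
    (shrinkage τ (∑ l ∈ b, y l ^ 2) * y k - θ k) ^ 2 ≤ (y k - θ k) ^ 2 + θ k ^ 2 := by
  set S := ∑ l ∈ b, y l ^ 2
  have hS : 0 ≤ S := Finset.sum_nonneg fun _ _ => sq_nonneg _
  have h0 := shrinkage_nonneg τ S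
  have h1 := shrinkage_le_one hτ hS
  set s := shrinkage τ S
  -- convexity of the square
  have : s * (y k - θ k) ^ 2 + (1 - s) * θ k ^ 2 - (s * y k - θ k) ^ 2
      = s * (1 - s) * (y k) ^ 2 := by ring
  nlinarith [mul_nonneg (mul_nonneg h0 (sub_nonneg.2 h1)) (sq_nonneg (y k)),
    mul_nonneg (sub_nonneg.2 h1) (sq_nonneg (y k - θ k)), mul_nonneg h0 (sq_nonneg (θ k))]

/-- If neither the signal nor the noise is large on the block, the block is killed; the loss is
then the squared coefficient. -/
lemma sq_shrinkage_sub_le_of_small {μ lam T : ℝ} (hμ : 0 < μ) (hμl : μ < lam) (hT : 0 ≤ T)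
    (hθ : ∑ l ∈ b, θ l ^ 2 ≤ (lam - μ) ^ 2 / (2 * (lam + μ)) * T) {k : ι} (hk : k ∈ b) :
    (shrinkage (lam * T) (∑ l ∈ b, y l ^ 2) * y k - θ k) ^ 2
      ≤ θ k ^ 2 + if μ * T < ∑ l ∈ b, (y l - θ l) ^ 2 then ∑ l ∈ b, (y l - θ l) ^ 2 else 0 := by
  have hlT : 0 ≤ lam * T := mul_nonneg (hμ.trans hμl).le hT
  split_ifs with hZ
  · have h1 := sq_shrinkage_sub_le b θ y hlT k
    have h2 : (y k - θ k) ^ 2 ≤ ∑ l ∈ b, (y l - θ l) ^ 2 :=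
      Finset.single_le_sum (f := fun l => (y l - θ l) ^ 2) (fun _ _ => sq_nonneg _) hk
    linarith
  · have hd : 0 < lam - μ := by linarith
    have hS : ∑ l ∈ b, y l ^ 2 ≤ lam * T := by
      have h1 : ∀ l ∈ b, y l ^ 2 ≤ (lam + μ) / (2 * μ) * (y l - θ l) ^ 2
          + (lam + μ) / (lam - μ) * θ l ^ 2 := by
        intro l _
        have h2 : (lam + μ) / (2 * μ) * (y l - θ l) ^ 2 + (lam + μ) / (lam - μ) * θ l ^ 2 - y l ^ 2
            = ((lam - μ) * (y l - θ l) - 2 * μ * θ l) ^ 2 / (2 * μ * (lam - μ)) := by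
          field_simp
          ring
        have h3 : 0 ≤ ((lam - μ) * (y l - θ l) - 2 * μ * θ l) ^ 2 / (2 * μ * (lam - μ)) := by
          positivity
        linarith
      refine (Finset.sum_le_sum h1).trans ?_
      rw [Finset.sum_add_distrib, ← Finset.mul_sum, ← Finset.mul_sum]
      push Not at hZ
      have hlam : 0 < lam := hμ.trans hμl
      calc _ ≤ (lam + μ) / (2 * μ) * (μ * T)
            + (lam + μ) / (lam - μ) * ((lam - μ) ^ 2 / (2 * (lam + μ)) * T) := by gcongr
        _ = lam * T := by field_simp; ring
    have h0 : shrinkage (lam * T) (∑ l ∈ b, y l ^ 2) * y k = 0 := by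
      rcases (Finset.sum_nonneg fun l (_ : l ∈ b) => sq_nonneg (y l)).eq_or_lt with h | h
      · have := (Finset.sum_eq_zero_iff_of_nonneg fun l _ => sq_nonneg (y l)).1 h.symm k hk
        simp [pow_eq_zero_iff] at this
        simp [this]
      · have : 1 ≤ lam * T / ∑ l ∈ b, y l ^ 2 := by rwa [le_div_iff₀ h, one_mul]
        rw [shrinkage, max_eq_right (by linarith), zero_mul]
    rw [h0]
    simp
end

/-! ### The risk of blockwise James–Stein estimation -/

/-- The block of level `j` containing the index `k`. -/
def block (n j k : ℕ) : Finset ℕ :=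
  {l ∈ Finset.Icc 1 (2 ^ j) | (l - 1) / blockLength n = (k - 1) / blockLength n}

lemma mem_block {n j k l : ℕ} : l ∈ block n j k ↔
    l ∈ Finset.Icc 1 (2 ^ j) ∧ (l - 1) / blockLength n = (k - 1) / blockLength n :=
  Finset.mem_filter

lemma self_mem_block {n j k : ℕ} (hk : k ∈ Finset.Icc 1 (2 ^ j)) : k ∈ block n j k :=
  mem_block.2 ⟨hk, rfl⟩

lemma block_eq_of_mem {n j k l : ℕ} (hl : l ∈ block n j k) : block n j l = block n j k := by
  ext i
  rw [mem_block, mem_block, (mem_block.1 hl).2]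

lemma card_block_le {n j k : ℕ} (hL : 0 < blockLength n) :
    (block n j k).card ≤ blockLength n := by
  set L := blockLength n with hLdef
  set c := (k - 1) / L with hc
  calc (block n j k).card ≤ (Finset.Ico (c * L + 1) (c * L + L + 1)).card := by
        refine Finset.card_le_card fun l hl => ?_
        obtain ⟨h1, h2⟩ := mem_block.1 hl
        rw [Finset.mem_Icc] at h1
        rw [← hLdef, ← hc, Nat.div_eq_iff hL] at h2
        rw [Finset.mem_Ico]
        omega
    _ = L := by simp

lemma thetaHat_eq {lam : ℝ} {n : ℕ} {y : ℕ → ℕ → ℝ} {j k : ℕ} (hj : j < Nat.clog 2 n) :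
    thetaHat lam n y j k
      = shrinkage (lam * (blockLength n / n)) (∑ l ∈ block n j k, y j l ^ 2) * y j k := by
  rw [thetaHat, if_pos hj, shrinkage, blockSumSq, block, div_eq_mul_inv (blockLength n : ℝ),
    mul_assoc]

section
variable {Ω : Type*} [MeasurableSpace Ω] {P : Measure Ω} {n j : ℕ} {θ : ℕ → ℕ → ℝ}
  {y : ℕ → ℕ → Ω → ℝ} {lam : ℝ}

lemma aemeasurable_thetaHat (hy : ∀ l ∈ Finset.Icc 1 (2 ^ j), AEMeasurable (y j l) P) {k : ℕ}
    (hk : k ∈ Finset.Icc 1 (2 ^ j)) :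
    AEMeasurable (fun ω => thetaHat lam n (fun j k => y j k ω) j k) P := by
  by_cases hj : j < Nat.clog 2 n
  · simp_rw [thetaHat_eq hj, shrinkage]
    have h1 : AEMeasurable (fun ω => ∑ l ∈ block n j k, y j l ω ^ 2) P :=
      Finset.aemeasurable_fun_sum _ fun l hl => (hy l (mem_block.1 hl).1).pow_const 2
    exact ((h1.const_div _).const_sub _ |>.max aemeasurable_const).mul (hy k hk)
  · simp_rw [thetaHat, if_neg hj]
    exact aemeasurable_const

/-- Whatever the signal, the risk of a block is at most twice the threshold plus twice the noise. -/
lemma sum_lintegral_block_le (hn : 0 < n) (hL : 0 < blockLength n) (hlam : 0 ≤ lam)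
    (hj : j < Nat.clog 2 n) {k : ℕ} (h : IsGaussianSequence P n (block n j k) (θ j) (y j))
    (hy : ∀ l ∈ Finset.Icc 1 (2 ^ j), AEMeasurable (y j l) P) [IsProbabilityMeasure P] :
    ∑ i ∈ block n j k, ∫⁻ ω, ENNReal.ofReal
        ((thetaHat lam n (fun j k => y j k ω) j i - θ j i) ^ 2) ∂P
      ≤ ENNReal.ofReal ((2 * lam + 2) * (blockLength n / n)) := by
  have hm : ∀ i ∈ block n j k, AEMeasurable (fun ω => ENNReal.ofReal
      ((thetaHat lam n (fun j k => y j k ω) j i - θ j i) ^ 2)) P := fun i hi =>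
    (((aemeasurable_thetaHat hy (mem_block.1 hi).1).sub_const _).pow_const 2).ennreal_ofReal
  have hm2 : ∀ i ∈ block n j k, AEMeasurable (fun ω => ENNReal.ofReal
      ((y j i ω - θ j i) ^ 2)) P := fun i hi =>
    (((h.aemeasurable i hi).sub_const _).pow_const 2).ennreal_ofReal
  set T : ℝ := blockLength n / n
  have hT : 0 ≤ T := by positivity
  rw [← lintegral_finsetSum' _ hm]
  calc _ ≤ ∫⁻ ω, (ENNReal.ofReal (2 * (lam * T))
        + 2 * ∑ i ∈ block n j k, ENNReal.ofReal ((y j i ω - θ j i) ^ 2)) ∂P := by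
        refine lintegral_mono fun ω => ?_
        dsimp only
        rw [← ENNReal.ofReal_sum_of_nonneg (fun _ _ => sq_nonneg _),
          ← ENNReal.ofReal_sum_of_nonneg (fun _ _ => sq_nonneg _),
          ← ENNReal.ofReal_ofNat, ← ENNReal.ofReal_mul (by norm_num),
          ← ENNReal.ofReal_add (by positivity)
            (mul_nonneg (by norm_num) (Finset.sum_nonneg fun _ _ => sq_nonneg _))]
        refine ENNReal.ofReal_le_ofReal ?_
        refine le_trans (le_of_eq ?_) (sum_sq_shrinkage_sub_le (block n j k) (θ j)
          (fun l => y j l ω) (τ := lam * T) (by positivity))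
        refine Finset.sum_congr rfl fun i hi => ?_
        rw [thetaHat_eq hj, block_eq_of_mem hi]
    _ = ENNReal.ofReal (2 * (lam * T)) + 2 * ∑ i ∈ block n j k, ENNReal.ofReal (1 / n) := by
        rw [lintegral_add_left measurable_const, lintegral_const_mul'' _
          (Finset.aemeasurable_fun_sum _ hm2), lintegral_finsetSum' _ hm2, lintegral_const,
          measure_univ, mul_one]
        congr 2
        exact Finset.sum_congr rfl fun i hi => h.lintegral_sq hi
    _ ≤ _ := by
        rw [Finset.sum_const, nsmul_eq_mul, ← ENNReal.ofReal_natCast, ← ENNReal.ofReal_ofNat,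
          ← ENNReal.ofReal_mul (by positivity), ← ENNReal.ofReal_mul (by norm_num),
          ← ENNReal.ofReal_add (by positivity) (by positivity)]
        refine ENNReal.ofReal_le_ofReal ?_
        have h1 : ((block n j k).card : ℝ) * (1 / n) ≤ T := by
          rw [mul_one_div]
          have : ((block n j k).card : ℝ) ≤ blockLength n := by exact_mod_cast card_block_le hL
          exact div_le_div_of_nonneg_right this (by positivity)
        linarith

/-- If the squared coefficients of a level are at most `A`, the risk of each of its coordinates is
at most a multiple of `A`, up to a Chernoff term for pure noise that passes the threshold. -/
lemma lintegral_coordinate_le (hn : 0 < n) {μ : ℝ} (hμ : 1 < μ) (hμl : μ < lam)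
    (hL : 2 ≤ (μ - 1) * blockLength n)
    (hj : j < Nat.clog 2 n) {k : ℕ} (hk : k ∈ Finset.Icc 1 (2 ^ j))
    (h : IsGaussianSequence P n (block n j k) (θ j) (y j)) {A : ℝ}
    (hA : ∀ l ∈ Finset.Icc 1 (2 ^ j), θ j l ^ 2 ≤ A) [IsProbabilityMeasure P] :
    ∫⁻ ω, ENNReal.ofReal ((thetaHat lam n (fun j k => y j k ω) j k - θ j k) ^ 2) ∂P
      ≤ ENNReal.ofReal ((1 + 2 * (lam + μ) / (lam - μ) ^ 2) * A + μ * blockLength n / n *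
          Real.exp (-((μ - 1 - Real.log μ) / 2 * blockLength n))) := by
  have hL0 : 0 < blockLength n := by
    rcases Nat.eq_zero_or_pos (blockLength n) with h0 | h0
    · rw [h0] at hL; norm_num at hL
    · exact h0
  have hn' : (0 : ℝ) < n := by exact_mod_cast hn
  have hA0 : 0 ≤ A := (sq_nonneg _).trans (hA k hk)
  have hb : ((block n j k).card : ℝ) ≤ blockLength n := by exact_mod_cast card_block_le hL0
  have hd : 0 < lam - μ := by linarith
  have hμ0 : 0 < μ := by linarith
  have hlam0 : 0 < lam := by linarith
  set T : ℝ := blockLength n / n with hTdef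
  have hT : 0 ≤ T := by positivity
  set η := (lam - μ) ^ 2 / (2 * (lam + μ)) with hη
  have hη0 : 0 < η := by positivity
  have hη1 : 2 * (lam + μ) / (lam - μ) ^ 2 = 1 / η := by rw [hη, one_div_div]
  rw [hη1]
  have hkb := self_mem_block (n := n) hk
  simp_rw [thetaHat_eq hj]
  by_cases hθ : ∑ l ∈ block n j k, θ j l ^ 2 ≤ η * T
  · calc _ ≤ ∫⁻ ω, (ENNReal.ofReal A + ENNReal.ofReal
          (if μ * T < ∑ l ∈ block n j k, (y j l ω - θ j l) ^ 2
            then ∑ l ∈ block n j k, (y j l ω - θ j l) ^ 2 else 0)) ∂P := by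
          refine lintegral_mono fun ω => ?_
          rw [← ENNReal.ofReal_add hA0 (by
            split_ifs
            · exact Finset.sum_nonneg fun _ _ => sq_nonneg _
            · exact le_rfl)]
          refine ENNReal.ofReal_le_ofReal ?_
          have := sq_shrinkage_sub_le_of_small (block n j k) (θ j) (fun l => y j l ω) hμ0 hμl hT
            hθ hkb
          linarith [hA k hk]
      _ ≤ ENNReal.ofReal A + ENNReal.ofReal (μ * blockLength n / n *
          Real.exp (-((μ - 1 - Real.log μ) / 2 * blockLength n))) := by
          rw [lintegral_add_left measurable_const, lintegral_const, measure_univ, mul_one]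
          gcongr
          have := h.lintegral_truncated hn hμ hL hb
          rw [mul_div_assoc, ← hTdef] at this ⊢
          exact this
      _ ≤ _ := by
          rw [← ENNReal.ofReal_add hA0 (by positivity)]
          refine ENNReal.ofReal_le_ofReal ?_
          have : 0 ≤ 1 / η * A := by positivity
          linarith
  · -- now `1 / n ≤ A / η`, and the noise of the coordinate is affordable
    push Not at hθ
    have h1 : 1 / (n : ℝ) ≤ 1 / η * A := by
      have h2 : ∑ l ∈ block n j k, θ j l ^ 2 ≤ blockLength n * A := by
        calc _ ≤ ∑ l ∈ block n j k, A :=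
              Finset.sum_le_sum fun l hl => hA l (mem_block.1 hl).1
          _ = (block n j k).card * A := by simp
          _ ≤ _ := by gcongr
      have h3 : η * T < blockLength n * A := hθ.trans_le h2
      have hL0' : (0 : ℝ) < blockLength n := by exact_mod_cast hL0
      have h4 : η * (1 / n) < A := by
        refine lt_of_mul_lt_mul_left ?_ hL0'.le
        calc _ = η * T := by rw [hTdef]; ring
          _ < _ := h3
      rw [one_div_mul_eq_div, le_div_iff₀ hη0]
      linarith
    calc _ ≤ ∫⁻ ω, (ENNReal.ofReal ((y j k ω - θ j k) ^ 2) + ENNReal.ofReal A) ∂P := by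
          refine lintegral_mono fun ω => ?_
          rw [← ENNReal.ofReal_add (sq_nonneg _) hA0]
          refine ENNReal.ofReal_le_ofReal ?_
          have := sq_shrinkage_sub_le (block n j k) (θ j) (fun l => y j l ω) (τ := lam * T)
            (by positivity) k
          linarith [hA k hk]
      _ = ENNReal.ofReal (1 / n) + ENNReal.ofReal A := by
          rw [lintegral_add_right _ measurable_const, lintegral_const, measure_univ, mul_one,
            h.lintegral_sq hkb]
      _ ≤ _ := by
          rw [← ENNReal.ofReal_add (by positivity) hA0]
          refine ENNReal.ofReal_le_ofReal ?_
          have : 0 ≤ μ * blockLength n / n *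
            Real.exp (-((μ - 1 - Real.log μ) / 2 * blockLength n)) := by positivity
          linarith

/-- The risk bounds for coordinates and for blocks. The term `e` accounts for pure noise that
passes the threshold. -/
theorem exists_risk_bounds {μ : ℝ} (hμ : 1 < μ) (hμl : μ < lam) :
    ∃ K : ℝ, 0 ≤ K ∧ ∀ {Ω : Type*} [MeasurableSpace Ω] {P : Measure Ω} [IsProbabilityMeasure P]
      {n j : ℕ} {θ : ℕ → ℕ → ℝ} {y : ℕ → ℕ → Ω → ℝ} {A e : ℝ},
      0 < n → 2 ≤ (μ - 1) * blockLength n → j < Nat.clog 2 n →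
      (∀ k ∈ Finset.Icc 1 (2 ^ j), IsGaussianSequence P n (block n j k) (θ j) (y j)) →
      (∀ l ∈ Finset.Icc 1 (2 ^ j), θ j l ^ 2 ≤ A) →
      μ * blockLength n / n * Real.exp (-((μ - 1 - Real.log μ) / 2 * blockLength n)) ≤ e →
      ∀ k ∈ Finset.Icc 1 (2 ^ j),
        ∫⁻ ω, ENNReal.ofReal ((thetaHat lam n (fun j k => y j k ω) j k - θ j k) ^ 2) ∂P
          ≤ ENNReal.ofReal (K * min A (blockLength n / n) + e) ∧
        ∑ i ∈ block n j k, ∫⁻ ω, ENNReal.ofReal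
            ((thetaHat lam n (fun j k => y j k ω) j i - θ j i) ^ 2) ∂P
          ≤ ENNReal.ofReal (blockLength n * (K * min A (1 / n) + e)) := by
  have hμ0 : 0 < μ := by linarith
  have hlam0 : 0 < lam := by linarith
  set K1 := 1 + 2 * (lam + μ) / (lam - μ) ^ 2
  set K2 := 2 * lam + 2
  have hK1 : 0 ≤ K1 := by positivity
  have hK2 : 0 ≤ K2 := by positivity
  refine ⟨max K1 K2, le_max_of_le_left hK1, ?_⟩
  intro Ω _ P _ n j θ y A e hn hL hj hG hA he k hk
  have hL0 : 0 < blockLength n := by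
    rcases Nat.eq_zero_or_pos (blockLength n) with h0 | h0
    · rw [h0] at hL; norm_num at hL
    · exact h0
  have hA0 : 0 ≤ A := (sq_nonneg _).trans (hA k hk)
  have he0 : 0 ≤ e := le_trans (by positivity) he
  have hy : ∀ l ∈ Finset.Icc 1 (2 ^ j), AEMeasurable (y j l) P := fun l hl =>
    (hG l hl).aemeasurable l (self_mem_block hl)
  have hB := sum_lintegral_block_le hn hL0 hlam0.le hj (hG k hk) hy
  have hC : ∀ i ∈ Finset.Icc 1 (2 ^ j), ∫⁻ ω, ENNReal.ofReal
      ((thetaHat lam n (fun j k => y j k ω) j i - θ j i) ^ 2) ∂P ≤ ENNReal.ofReal (K1 * A + e) :=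
    fun i hi => (lintegral_coordinate_le hn hμ hμl hL hj hi (hG i hi) hA).trans
      (ENNReal.ofReal_le_ofReal (by gcongr))
  have hmul : ∀ T : ℝ, 0 ≤ T → min (K1 * A) (K2 * T) ≤ max K1 K2 * min A T := by
    intro T hT
    rcases le_total A T with h | h
    · rw [min_eq_left h]
      exact (min_le_left _ _).trans (by gcongr; exact le_max_left _ _)
    · rw [min_eq_right h]
      exact (min_le_right _ _).trans (by gcongr; exact le_max_right _ _)
  constructor
  · have h1 := (Finset.single_le_sum (f := fun i => ∫⁻ ω, ENNReal.ofReal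
      ((thetaHat lam n (fun j k => y j k ω) j i - θ j i) ^ 2) ∂P) (fun _ _ => zero_le)
      (self_mem_block (n := n) hk)).trans hB
    refine (le_min (hC k hk) h1).trans ?_
    rw [← ENNReal.ofReal_mono.map_min]
    refine ENNReal.ofReal_le_ofReal ?_
    have h2 := hmul (blockLength n / n) (by positivity)
    refine le_trans ?_ (add_le_add_left h2 e)
    rw [← min_add_add_right]
    exact min_le_min le_rfl (by linarith)
  · have h1 : ∑ i ∈ block n j k, ∫⁻ ω, ENNReal.ofReal
            ((thetaHat lam n (fun j k => y j k ω) j i - θ j i) ^ 2) ∂P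
          ≤ ENNReal.ofReal (blockLength n * (K1 * A + e)) := by
      refine (Finset.sum_le_card_nsmul _ _ _ fun i hi => hC i (mem_block.1 hi).1).trans ?_
      rw [nsmul_eq_mul, ← ENNReal.ofReal_natCast, ← ENNReal.ofReal_mul (by positivity)]
      refine ENNReal.ofReal_le_ofReal ?_
      have : ((block n j k).card : ℝ) ≤ blockLength n := by exact_mod_cast card_block_le hL0
      gcongr
    refine (le_min h1 hB).trans ?_
    rw [← ENNReal.ofReal_mono.map_min]
    refine ENNReal.ofReal_le_ofReal ?_
    have h2 := hmul (1 / n) (by positivity)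
    refine le_trans ?_ (mul_le_mul_of_nonneg_left (add_le_add_left h2 e)
      (by positivity : (0 : ℝ) ≤ blockLength n))
    rw [← min_add_add_right, mul_min_of_nonneg _ _ (by positivity)]
    refine min_le_min le_rfl ?_
    calc K2 * (blockLength n / n) = blockLength n * (K2 * (1 / n)) := by ring
      _ ≤ _ := by gcongr; linarith
end

/-! ### Size, support and vanishing moments of the wavelets -/

/-- `g` is measurable, bounded by `C`, supported in `[-C, C]` and has `r` vanishing moments. -/
structure IsGenerator (r : ℕ) (C : ℝ) (g : ℝ → ℝ) : Prop where
  measurable : Measurable g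
  abs_le : ∀ u, |g u| ≤ C
  support : ∀ u, g u ≠ 0 → |u| ≤ C
  moments : ∀ p : Polynomial ℝ, p.natDegree < r → ∫ u, p.eval u * g u = 0

lemma IsGenerator.mono {r : ℕ} {C C' : ℝ} {g : ℝ → ℝ} (h : IsGenerator r C g) (hC : C ≤ C') :
    IsGenerator r C' g :=
  ⟨h.measurable, fun u => (h.abs_le u).trans hC, fun u hu => (h.support u hu).trans hC, h.moments⟩

lemma IsRegularOn.exists_isGenerator {r : ℕ} {S : Set ℝ} {g : ℝ → ℝ} (h : IsRegularOn r S g)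
    (hS : IsClosed S) {a b : ℝ} (hsupp : Function.support g ⊆ Icc a b)
    (hsupp' : Function.support g ⊆ S) : ∃ C, IsGenerator r C g := by
  have hcont : ContinuousOn g S := h.contDiffOn.continuousOn
  obtain ⟨D, hD⟩ := (isCompact_Icc (a := a) (b := b)).inter_left hS
    |>.exists_bound_of_continuousOn (hcont.mono inter_subset_left)
  have hmeas : Measurable g := by
    classical
    have h1 : g = S.piecewise g (fun _ => 0) := by
      ext u
      by_cases hu : u ∈ S
      · simp [hu]
      · have : u ∉ Function.support g := fun h => hu (hsupp' h)
        simpa [hu] using this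
    rw [h1]
    exact hcont.measurable_piecewise continuousOn_const hS.measurableSet
  have hle : ∀ u, |g u| ≤ |D| := by
    intro u
    by_cases hu : g u = 0
    · simp [hu]
    · exact (hD u ⟨hsupp' hu, hsupp hu⟩).trans (le_abs_self _)
  have hint : ∀ m : ℕ, Integrable (fun u => u ^ m * g u) := by
    intro m
    have h1 : IntegrableOn (fun u => u ^ m * g u) (Icc a b) := by
      have h2 : IntegrableOn (fun u : ℝ => u ^ m) (Icc a b) :=
        (continuous_pow m).continuousOn.integrableOn_Icc
      exact Integrable.mul_bdd (c := |D|) h2 hmeas.aestronglyMeasurable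
        (Eventually.of_forall fun u => hle u)
    refine (integrableOn_iff_integrable_of_support_subset ?_).1 h1
    exact (Function.support_mul_subset_right _ _).trans hsupp
  refine ⟨|D| + |a| + |b|, hmeas, fun u => (hle u).trans ?_, fun u hu => ?_, fun p hp => ?_⟩
  · linarith [abs_nonneg a, abs_nonneg b]
  · obtain ⟨h1, h2⟩ := hsupp hu
    rw [abs_le]
    constructor <;> linarith [abs_nonneg a, abs_nonneg b, abs_nonneg D, neg_abs_le a, le_abs_self b]
  · simp_rw [Polynomial.eval_eq_sum_range, Finset.sum_mul, mul_assoc]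
    rw [integral_finsetSum _ fun i _ => (hint i).const_mul _]
    refine Finset.sum_eq_zero fun i hi => ?_
    have hir : i < r := by
      rw [Finset.mem_range] at hi
      omega
    rw [integral_const_mul, ← setIntegral_eq_integral_of_forall_compl_eq_zero (s := S),
      h.moments i hir, mul_zero]
    intro u hu
    have : u ∉ Function.support g := fun h => hu (hsupp' h)
    simp only [Function.mem_support, not_not] at this
    simp [this]

lemma exists_forall_lt_of_monotone {Q : ℕ → ℝ → Prop} (N : ℕ)
    (hQ : ∀ i C C', C ≤ C' → Q i C → Q i C') (h : ∀ i < N, ∃ C, Q i C) :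
    ∃ C, ∀ i < N, Q i C := by
  choose! C hC using h
  refine ⟨∑ i ∈ Finset.range N, |C i|, fun i hi => hQ i _ _ ?_ (hC i hi)⟩
  exact (le_abs_self _).trans (Finset.single_le_sum (f := fun i => |C i|)
    (fun _ _ => abs_nonneg _) (Finset.mem_range.2 hi))

/-- The quantitative properties of a wavelet basis, with a common constant `C`. A wavelet of
level `j` and index `k` lives on a `C 2^(-j)`-neighbourhood of `k 2^(-j)`; this also holds for the
edge functions, as there are boundedly many of them on each level. -/
structure IntervalWavelet.HasBound {r : ℕ} (W : IntervalWavelet r) (C : ℝ) : Prop where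
  one_le : 1 ≤ C
  measurable_mother : ∀ j ≥ W.j0, ∀ k ∈ Finset.Icc 1 (2 ^ j), Measurable (W.mother j k)
  abs_mother_le : ∀ j ≥ W.j0, ∀ k ∈ Finset.Icc 1 (2 ^ j), ∀ t,
    |W.mother j k t| ≤ C * 2 ^ ((j : ℝ) / 2)
  support_mother : ∀ j ≥ W.j0, ∀ k ∈ Finset.Icc 1 (2 ^ j), ∀ t, W.mother j k t ≠ 0 →
    t ∈ Icc (0 : ℝ) 1 ∧ |2 ^ j * t - k| ≤ C
  moments_mother : ∀ j ≥ W.j0, ∀ k ∈ Finset.Icc 1 (2 ^ j), ∀ p : Polynomial ℝ, p.natDegree < r →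
    ∫ t in Icc (0 : ℝ) 1, p.eval t * W.mother j k t = 0
  measurable_father : ∀ k ∈ Finset.Icc 1 (2 ^ W.j0), Measurable (W.father k)
  abs_father_le : ∀ k ∈ Finset.Icc 1 (2 ^ W.j0), ∀ t, |W.father k t| ≤ C

/-- Interior and edge wavelets have the same form: each is a dilate of a generator, shifted by its
index up to a bounded error. -/
lemma IntervalWavelet.exists_mother_eq {r : ℕ} (W : IntervalWavelet r) :
    ∃ C : ℝ, 1 ≤ C ∧ ∀ j ≥ W.j0, ∀ k : ℕ, k ∈ Finset.Icc 1 (2 ^ j) → ∃ (g : ℝ → ℝ) (s : ℝ),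
      IsGenerator r C g ∧ |s - k| ≤ C ∧
      (∀ t, W.mother j k t = 2 ^ ((j : ℝ) / 2) * g (2 ^ j * t - s)) ∧
      ∀ t, W.mother j k t ≠ 0 → t ∈ Icc (0 : ℝ) 1 := by
  obtain ⟨C0, h0⟩ := W.regular_ψ.exists_isGenerator isClosed_univ W.support_ψ (subset_univ _)
  obtain ⟨C1, h1⟩ := exists_forall_lt_of_monotone (Q := fun i C => IsGenerator r C (W.ψL i)) W.nL
    (fun i C C' h h' => h'.mono h) fun i hi => (W.regular_ψL i hi).exists_isGenerator isClosed_Ici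
      (W.support_ψL i hi) fun u hu => (W.support_ψL i hi hu).1
  obtain ⟨C2, h2⟩ := exists_forall_lt_of_monotone (Q := fun i C => IsGenerator r C (W.ψR i)) W.nR
    (fun i C C' h h' => h'.mono h) fun i hi => (W.regular_ψR i hi).exists_isGenerator isClosed_Iic
      (W.support_ψR i hi) fun u hu => (W.support_ψR i hi hu).2
  have a0 := abs_nonneg C0
  have a1 := abs_nonneg C1
  have a2 := abs_nonneg C2
  have hnL : (0 : ℝ) ≤ W.nL := by positivity
  have hnR : (0 : ℝ) ≤ W.nR := by positivity
  set C : ℝ := 1 + |C0| + |C1| + |C2| + W.nL + W.nR with hC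
  refine ⟨C, by linarith, fun j hj k hk => ?_⟩
  rw [Finset.mem_Icc] at hk
  have hpos : (0 : ℝ) < 2 ^ j := by positivity
  have hjj : (2 : ℝ) ^ W.j0 ≤ 2 ^ j := pow_le_pow_right₀ (by norm_num) hj
  have key : ∀ {g : ℝ → ℝ} {s t : ℝ}, W.mother j k t = 2 ^ ((j : ℝ) / 2) * g (2 ^ j * t - s) →
      W.mother j k t ≠ 0 → g (2 ^ j * t - s) ≠ 0 := by
    intro g s t h1 h2 h3
    exact h2 (by rw [h1, h3, mul_zero])
  by_cases hkL : k ≤ W.nL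
  · have hi : k - 1 < W.nL := by omega
    have e : ∀ t, W.mother j k t = 2 ^ ((j : ℝ) / 2) * W.ψL (k - 1) (2 ^ j * t - 0) := fun t => by
      rw [IntervalWavelet.mother, dilate, if_pos hkL, sub_zero]
    refine ⟨W.ψL (k - 1), 0, (h1 _ hi).mono (by linarith [le_abs_self C1]), ?_, e, fun t ht => ?_⟩
    · have : (k : ℝ) ≤ W.nL := by exact_mod_cast hkL
      rw [zero_sub, abs_neg, Nat.abs_cast]
      linarith
    · obtain ⟨u1, u2⟩ := W.support_ψL _ hi (key (e t) ht)
      rw [sub_zero] at u1 u2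
      exact ⟨by nlinarith, by nlinarith⟩
  by_cases hkR : k + W.nR ≤ 2 ^ j
  · have e : ∀ t, W.mother j k t = 2 ^ ((j : ℝ) / 2) * W.ψ (2 ^ j * t - k) := fun t => by
      rw [IntervalWavelet.mother, dilate, if_neg hkL, if_pos hkR]
    refine ⟨W.ψ, k, h0.mono (by linarith [le_abs_self C0]), ?_, e, fun t ht => ?_⟩
    · rw [sub_self, abs_zero]
      linarith
    · obtain ⟨u1, u2⟩ := W.support_ψ (key (e t) ht)
      have h3 : (W.nL : ℝ) + 1 ≤ k := by
        have : W.nL + 1 ≤ k := by omega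
        exact_mod_cast this
      have h4 : (k : ℝ) + W.nR ≤ 2 ^ j := by exact_mod_cast hkR
      exact ⟨by nlinarith, by nlinarith⟩
  · have hi : 2 ^ j - k < W.nR := by omega
    have e : ∀ t, W.mother j k t = 2 ^ ((j : ℝ) / 2) * W.ψR (2 ^ j - k) (2 ^ j * t - 2 ^ j) :=
      fun t => by
        rw [IntervalWavelet.mother, dilate, if_neg hkL, if_neg hkR, mul_sub, mul_one]
    refine ⟨W.ψR (2 ^ j - k), 2 ^ j, (h2 _ hi).mono (by linarith [le_abs_self C2]), ?_, e,
      fun t ht => ?_⟩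
    · have h3 : (k : ℝ) ≤ 2 ^ j := by exact_mod_cast hk.2
      have h4 : (2 : ℝ) ^ j ≤ k + W.nR := by
        have : 2 ^ j ≤ k + W.nR := by omega
        exact_mod_cast this
      rw [abs_of_nonneg (by linarith)]
      linarith
    · obtain ⟨u1, u2⟩ := W.support_ψR _ hi (key (e t) ht)
      exact ⟨by nlinarith, by nlinarith⟩

lemma IntervalWavelet.exists_father_bound {r : ℕ} (W : IntervalWavelet r) :
    ∃ C : ℝ, ∀ k ∈ Finset.Icc 1 (2 ^ W.j0), Measurable (W.father k) ∧ ∀ t, |W.father k t| ≤ C := by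
  obtain ⟨C0, h0⟩ := W.bounded_φ
  obtain ⟨C1, h1⟩ := exists_forall_lt_of_monotone (Q := fun i C => ∀ x, |W.φL i x| ≤ C) W.nL
    (fun i C C' h h' x => (h' x).trans h) W.bounded_φL
  obtain ⟨C2, h2⟩ := exists_forall_lt_of_monotone (Q := fun i C => ∀ x, |W.φR i x| ≤ C) W.nR
    (fun i C C' h h' x => (h' x).trans h) W.bounded_φR
  refine ⟨2 ^ ((W.j0 : ℝ) / 2) * (|C0| + |C1| + |C2|), fun k hk => ?_⟩
  rw [Finset.mem_Icc] at hk
  have a0 := abs_nonneg C0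
  have a1 := abs_nonneg C1
  have a2 := abs_nonneg C2
  have hpos : (0 : ℝ) < 2 ^ ((W.j0 : ℝ) / 2) := by positivity
  unfold IntervalWavelet.father
  by_cases hkL : k ≤ W.nL
  · have hi : k - 1 < W.nL := by omega
    have e : dilate W.nL W.nR W.φ W.φL W.φR W.j0 k
        = fun t => 2 ^ ((W.j0 : ℝ) / 2) * W.φL (k - 1) (2 ^ W.j0 * t) := by
      ext t
      rw [dilate, if_pos hkL]
    rw [e]
    refine ⟨((W.measurable_φL _ hi).comp (by fun_prop)).const_mul _, fun t => ?_⟩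
    rw [abs_mul, abs_of_pos hpos]
    gcongr
    exact (h1 _ hi _).trans (by linarith [le_abs_self C1])
  by_cases hkR : k + W.nR ≤ 2 ^ W.j0
  · have e : dilate W.nL W.nR W.φ W.φL W.φR W.j0 k
        = fun t => 2 ^ ((W.j0 : ℝ) / 2) * W.φ (2 ^ W.j0 * t - k) := by
      ext t
      rw [dilate, if_neg hkL, if_pos hkR]
    rw [e]
    refine ⟨(W.measurable_φ.comp (by fun_prop)).const_mul _, fun t => ?_⟩
    rw [abs_mul, abs_of_pos hpos]
    gcongr
    exact (h0 _).trans (by linarith [le_abs_self C0])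
  · have hi : 2 ^ W.j0 - k < W.nR := by omega
    have e : dilate W.nL W.nR W.φ W.φL W.φR W.j0 k
        = fun t => 2 ^ ((W.j0 : ℝ) / 2) * W.φR (2 ^ W.j0 - k) (2 ^ W.j0 * (t - 1)) := by
      ext t
      rw [dilate, if_neg hkL, if_neg hkR]
    rw [e]
    refine ⟨((W.measurable_φR _ hi).comp (by fun_prop)).const_mul _, fun t => ?_⟩
    rw [abs_mul, abs_of_pos hpos]
    gcongr
    exact (h2 _ hi _).trans (by linarith [le_abs_self C2])

theorem IntervalWavelet.exists_hasBound {r : ℕ} (W : IntervalWavelet r) : ∃ C, W.HasBound C := by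
  obtain ⟨C1, hC1, hm⟩ := W.exists_mother_eq
  obtain ⟨C2, hf⟩ := W.exists_father_bound
  have hC : 2 * C1 ≤ 2 * C1 + |C2| := by linarith [abs_nonneg C2]
  refine ⟨2 * C1 + |C2|, by linarith, fun j hj k hk => ?_, fun j hj k hk t => ?_,
    fun j hj k hk t ht => ?_, fun j hj k hk p hp => ?_, fun k hk => (hf k hk).1,
    fun k hk t => ((hf k hk).2 t).trans (by linarith [le_abs_self C2])⟩
  · obtain ⟨g, s, hg, -, he, -⟩ := hm j hj k hk
    rw [show W.mother j k = fun t => 2 ^ ((j : ℝ) / 2) * g (2 ^ j * t - s) from funext he]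
    exact (hg.measurable.comp (by fun_prop)).const_mul _
  · obtain ⟨g, s, hg, -, he, -⟩ := hm j hj k hk
    rw [he, abs_mul, abs_of_pos (by positivity), mul_comm]
    gcongr
    exact (hg.abs_le _).trans (by linarith)
  · obtain ⟨g, s, hg, hs, he, hsupp⟩ := hm j hj k hk
    refine ⟨hsupp t ht, ?_⟩
    have h1 : g (2 ^ j * t - s) ≠ 0 := fun h => ht (by rw [he, h, mul_zero])
    have h2 := hg.support _ h1
    calc |2 ^ j * t - k| = |(2 ^ j * t - s) + (s - k)| := by ring_nf
      _ ≤ |2 ^ j * t - s| + |s - k| := abs_add_le _ _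
      _ ≤ _ := by linarith
  · obtain ⟨g, s, hg, -, he, hsupp⟩ := hm j hj k hk
    rw [setIntegral_eq_integral_of_forall_compl_eq_zero fun t ht => by
      have : W.mother j k t = 0 := by
        by_contra h
        exact ht (hsupp t h)
      rw [this, mul_zero]]
    -- substitute `u = 2 ^ j * t - s`
    let q : Polynomial ℝ := p.comp (Polynomial.C ((2 : ℝ) ^ j)⁻¹ * (Polynomial.X + Polynomial.C s))
    have hq : q.natDegree < r := by
      refine lt_of_le_of_lt ?_ hp
      refine Polynomial.natDegree_comp_le.trans ?_
      calc _ ≤ p.natDegree * 1 := by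
            gcongr
            refine (Polynomial.natDegree_C_mul_le _ _).trans ?_
            rw [Polynomial.natDegree_X_add_C]
        _ = _ := mul_one _
    have h1 : ∀ t, p.eval t * W.mother j k t
        = 2 ^ ((j : ℝ) / 2) * (fun u => q.eval (u - s) * g (u - s)) (2 ^ j * t) := by
      intro t
      have : q.eval (2 ^ j * t - s) = p.eval t := by
        simp [q, Polynomial.eval_comp]
      simp only [this, he]
      ring
    rw [integral_congr_ae (Eventually.of_forall h1), integral_const_mul,
      Measure.integral_comp_mul_left (fun u => q.eval (u - s) * g (u - s)),
      integral_sub_right_eq_self (fun u => q.eval u * g u), hg.moments q hq]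
    simp

/-! ### Hölder functions and the decay of their coefficients -/

/-- Taylor's formula for functions whose `k`-th derivative is Hölder continuous. -/
lemma exists_taylor_coeff {a : ℝ} (ha : a ∈ Icc (0 : ℝ) 1) {M β : ℝ} (hM : 0 ≤ M) (hβ : 0 < β)
    (k : ℕ) (f : ℝ → ℝ) (hf : ContDiffOn ℝ (k : ℕ∞) f (Icc 0 1))
    (hf' : ∀ x ∈ Icc (0 : ℝ) 1, |iteratedDerivWithin k f (Icc 0 1) x
      - iteratedDerivWithin k f (Icc 0 1) a| ≤ M * |x - a| ^ β) :
    ∃ c : ℕ → ℝ, ∀ x ∈ Icc (0 : ℝ) 1,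
      |f x - ∑ i ∈ Finset.range (k + 1), c i * (x - a) ^ i| ≤ M * |x - a| ^ (β + k) := by
  induction k generalizing f with
  | zero =>
    refine ⟨fun _ => f a, fun x hx => ?_⟩
    simpa using hf' x hx
  | succ k ih =>
    have hu : UniqueDiffOn ℝ (Icc (0 : ℝ) 1) := uniqueDiffOn_Icc_zero_one
    have h1 : ContDiffOn ℝ (((k : ℕ∞) : WithTop ℕ∞) + 1) f (Icc 0 1) := by
      convert hf using 1
      norm_cast
    rw [contDiffOn_succ_iff_derivWithin hu] at h1
    obtain ⟨hd, -, hc⟩ := h1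
    simp_rw [iteratedDerivWithin_succ'] at hf'
    obtain ⟨c, hc'⟩ := ih _ hc hf'
    refine ⟨fun i => if i = 0 then f a else c (i - 1) / i, fun x hx => ?_⟩
    let h : ℝ → ℝ := fun t => f t - ∑ i ∈ Finset.range (k + 1), c i / (i + 1) * (t - a) ^ (i + 1)
    have hsub : uIcc a x ⊆ Icc 0 1 := uIcc_subset_Icc ha hx
    have hder : ∀ t ∈ uIcc a x, HasDerivWithinAt h (derivWithin f (Icc 0 1) t
        - ∑ i ∈ Finset.range (k + 1), c i * (t - a) ^ i) (uIcc a x) t := by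
      intro t ht
      refine HasDerivWithinAt.sub ?_ ?_
      · exact ((hd t (hsub ht)).hasDerivWithinAt).mono hsub
      · refine HasDerivWithinAt.fun_sum fun i _ => ?_
        have h2 : HasDerivAt (fun t => c i / (i + 1) * (t - a) ^ (i + 1))
            (c i / (i + 1) * (((i + 1 : ℕ) : ℝ) * (t - a) ^ i * 1)) t :=
          (((hasDerivAt_id t).sub_const a).fun_pow (i + 1)).const_mul (c i / (i + 1))
        have h3 : (i : ℝ) + 1 ≠ 0 := by positivity
        have h4 : c i / (i + 1) * (((i + 1 : ℕ) : ℝ) * (t - a) ^ i * 1) = c i * (t - a) ^ i := by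
          push_cast
          field_simp
        exact (h4 ▸ h2).hasDerivWithinAt
    have hbound : ∀ t ∈ uIcc a x, ‖derivWithin f (Icc 0 1) t
        - ∑ i ∈ Finset.range (k + 1), c i * (t - a) ^ i‖ ≤ M * |x - a| ^ (β + k) := by
      intro t ht
      refine (hc' t (hsub ht)).trans ?_
      have h2 : |t - a| ≤ |x - a| := abs_sub_left_of_mem_uIcc ht
      gcongr
    have := (convex_uIcc a x).norm_image_sub_le_of_norm_hasDerivWithin_le hder hbound
      left_mem_uIcc right_mem_uIcc
    have h3 : h x - h a = f x - ∑ i ∈ Finset.range (k + 1 + 1),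
        (if i = 0 then f a else c (i - 1) / i) * (x - a) ^ i := by
      rw [Finset.sum_range_succ']
      simp [h]
      ring
    rw [h3, Real.norm_eq_abs, Real.norm_eq_abs, mul_assoc, ← Real.rpow_add_one' (abs_nonneg _)
      (by positivity)] at this
    push_cast
    rwa [← add_assoc]

/-- The degree is less than `α`, as needed for the vanishing moments. -/
lemma exists_polynomial_approx {α M : ℝ} (hα : 0 < α) (hM : 0 ≤ M) {f : ℝ → ℝ}
    (hf : f ∈ holderClass α M) {a : ℝ} (ha : a ∈ Icc (0 : ℝ) 1) :
    ∃ p : Polynomial ℝ, p.natDegree ≤ ⌈α⌉₊ - 1 ∧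
      ∀ x ∈ Icc (0 : ℝ) 1, |f x - p.eval x| ≤ M * |x - a| ^ α := by
  set k := ⌈α⌉₊ - 1 with hk
  have hk' : (k : ℝ) < α := by
    have : 0 < ⌈α⌉₊ := Nat.ceil_pos.2 hα
    exact Nat.lt_ceil.1 (by omega)
  obtain ⟨c, hc⟩ := exists_taylor_coeff ha hM (β := α - k) (by linarith) k f hf.1
    fun x hx => hf.2 x hx a ha
  refine ⟨∑ i ∈ Finset.range (k + 1), Polynomial.C (c i) * (Polynomial.X - Polynomial.C a) ^ i,
    ?_, fun x hx => ?_⟩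
  · refine Polynomial.natDegree_sum_le_of_forall_le _ _ fun i hi => ?_
    refine (Polynomial.natDegree_C_mul_le _ _).trans ?_
    refine (Polynomial.natDegree_pow_le_of_le i (Polynomial.natDegree_X_sub_C_le a)).trans ?_
    rw [Finset.mem_range] at hi
    omega
  · have := hc x hx
    rw [sub_add_cancel] at this
    simpa [Polynomial.eval_finsetSum] using this

lemma memLp_of_mem_holderClass {α M : ℝ} {f : ℝ → ℝ} (hf : f ∈ holderClass α M) (p : ℝ≥0∞) :
    MemLp f p (volume.restrict (Icc (0 : ℝ) 1)) := by
  have hc : ContinuousOn f (Icc 0 1) := hf.1.continuousOn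
  obtain ⟨D, hD⟩ := isCompact_Icc.exists_bound_of_continuousOn hc
  refine MemLp.of_bound (hc.aestronglyMeasurable measurableSet_Icc) D ?_
  exact (ae_restrict_iff' measurableSet_Icc).2 (Eventually.of_forall hD)

/-- Wavelet coefficients of Hölder functions decay, by the vanishing moments of the wavelets. -/
theorem IntervalWavelet.HasBound.abs_coeff_le {r : ℕ} {W : IntervalWavelet r} {C : ℝ}
    (hW : W.HasBound C) {α M : ℝ} (hα : 0 < α) (hαr : α < r) (hM : 0 ≤ M) {f : ℝ → ℝ}
    (hf : f ∈ holderClass α M) {j k : ℕ} (hj : W.j0 ≤ j) (hk : k ∈ Finset.Icc 1 (2 ^ j)) :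
    |∫ t in Icc (0 : ℝ) 1, f t * W.mother j k t|
      ≤ M * (2 * C) ^ α * C * (4 * C) * 2 ^ (-(j : ℝ) * (α + 1 / 2)) := by
  have hC : 0 < C := lt_of_lt_of_le one_pos hW.one_le
  by_cases hne : ∃ a, W.mother j k a ≠ 0
  swap
  · push Not at hne
    simp only [hne, mul_zero, integral_zero, abs_zero]
    positivity
  obtain ⟨a, ha⟩ := hne
  obtain ⟨ha1, ha2⟩ := hW.support_mother j hj k hk a ha
  obtain ⟨p, hp, hfp⟩ := exists_polynomial_approx hα hM hf ha1
  have hpr : p.natDegree < r := by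
    have h1 : ⌈α⌉₊ ≤ r := Nat.ceil_le.2 hαr.le
    have h2 : 0 < ⌈α⌉₊ := Nat.ceil_pos.2 hα
    omega
  set ψ := W.mother j k
  have hψm : AEStronglyMeasurable ψ (volume.restrict (Icc (0 : ℝ) 1)) :=
    (hW.measurable_mother j hj k hk).aestronglyMeasurable
  have hψb : ∀ᵐ t ∂(volume.restrict (Icc (0 : ℝ) 1)), ‖ψ t‖ ≤ C * 2 ^ ((j : ℝ) / 2) :=
    Eventually.of_forall fun t => hW.abs_mother_le j hj k hk t
  have hf1 : Integrable f (volume.restrict (Icc (0 : ℝ) 1)) :=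
    (memLp_of_mem_holderClass hf 1).integrable le_rfl
  have hp1 : Integrable (fun t => p.eval t) (volume.restrict (Icc (0 : ℝ) 1)) :=
    p.continuous.continuousOn.integrableOn_Icc
  have e1 : ∫ t in Icc (0 : ℝ) 1, f t * ψ t = ∫ t in Icc (0 : ℝ) 1, (f t - p.eval t) * ψ t := by
    simp_rw [sub_mul]
    rw [integral_sub (hf1.mul_bdd hψm hψb) (hp1.mul_bdd hψm hψb),
      hW.moments_mother j hj k hk p hpr, sub_zero]
  rw [e1]
  set δ : ℝ := 2 * C * (2 ^ j)⁻¹ with hδ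
  have hδ0 : 0 < δ := by positivity
  set D := M * δ ^ α * (C * 2 ^ ((j : ℝ) / 2)) with hD
  have hD0 : 0 ≤ D := by positivity
  have hbound : ∀ᵐ t ∂(volume.restrict (Icc (0 : ℝ) 1)),
      ‖(f t - p.eval t) * ψ t‖ ≤ (Icc (a - δ) (a + δ)).indicator (fun _ => D) t := by
    refine (ae_restrict_iff' measurableSet_Icc).2 (Eventually.of_forall fun t ht => ?_)
    by_cases h0 : ψ t = 0
    · rw [h0, mul_zero, norm_zero]
      exact indicator_nonneg (fun _ _ => hD0) t
    have h1 := (hW.support_mother j hj k hk t h0).2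
    have h2 : |t - a| ≤ δ := by
      have h3 : |2 ^ j * (t - a)| ≤ 2 * C := by
        calc |2 ^ j * (t - a)| = |(2 ^ j * t - k) - (2 ^ j * a - k)| := by ring_nf
          _ ≤ |2 ^ j * t - k| + |2 ^ j * a - k| := abs_sub _ _
          _ ≤ _ := by linarith
      rw [abs_mul, abs_of_pos (by positivity)] at h3
      rw [hδ, ← div_eq_mul_inv, le_div_iff₀ (by positivity)]
      linarith
    have h4 : t ∈ Icc (a - δ) (a + δ) := by
      rw [abs_le] at h2
      exact ⟨by linarith, by linarith⟩
    rw [indicator_of_mem h4, norm_mul, hD]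
    have h5 := hfp t ht
    have h6 := hW.abs_mother_le j hj k hk t
    rw [Real.norm_eq_abs, Real.norm_eq_abs]
    gcongr
    exact h5.trans (by gcongr)
  have hint : Integrable ((Icc (a - δ) (a + δ)).indicator (fun _ => D))
      (volume.restrict (Icc (0 : ℝ) 1)) := (integrable_const D).indicator measurableSet_Icc
  have h7 := norm_integral_le_of_norm_le hint hbound
  have h8 : ∫ t in Icc (0 : ℝ) 1, (Icc (a - δ) (a + δ)).indicator (fun _ => D) t
      ≤ 2 * δ * D := by
    rw [integral_indicator measurableSet_Icc, Measure.restrict_restrict measurableSet_Icc,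
      integral_const, smul_eq_mul, measureReal_restrict_apply_univ]
    gcongr
    calc volume.real (Icc (a - δ) (a + δ) ∩ Icc 0 1) ≤ volume.real (Icc (a - δ) (a + δ)) :=
          measureReal_mono inter_subset_left (by simp)
      _ = 2 * δ := by
          rw [Real.volume_real_Icc_of_le (by linarith)]
          ring
  rw [Real.norm_eq_abs] at h7
  refine (h7.trans h8).trans (le_of_eq ?_)
  have e2 : ((2 : ℝ) ^ j)⁻¹ = 2 ^ (-(j : ℝ)) := by
    rw [Real.rpow_neg (by norm_num), Real.rpow_natCast]
  have e3 : (2 : ℝ) ^ (-(j : ℝ) * (α + 1 / 2))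
      = 2 ^ (-(j : ℝ)) * (2 ^ (-(j : ℝ))) ^ α * 2 ^ ((j : ℝ) / 2) := by
    rw [← Real.rpow_mul (by norm_num), ← Real.rpow_add (by norm_num),
      ← Real.rpow_add (by norm_num)]
    congr 1
    ring
  rw [hD, hδ, Real.mul_rpow (by positivity) (by positivity), e2, e3]
  ring

/-! ### Overlap of the wavelets and convergence of the wavelet series -/

lemma card_le_of_forall_abs_sub_le {S : Finset ℕ} {a D : ℝ} (hD : 0 ≤ D)
    (h : ∀ k ∈ S, |a - k| ≤ D) : (S.card : ℝ) ≤ 2 * D + 1 := by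
  rcases S.eq_empty_or_nonempty with rfl | hS
  · simp; positivity
  have h1 : S ⊆ Finset.Icc (S.min' hS) (S.max' hS) := fun k hk =>
    Finset.mem_Icc.2 ⟨S.min'_le k hk, S.le_max' k hk⟩
  have h2 := Finset.card_le_card h1
  rw [Nat.card_Icc] at h2
  have h3 := abs_le.1 (h _ (S.min'_mem hS))
  have h4 := abs_le.1 (h _ (S.max'_mem hS))
  have h5 : (S.card : ℝ) ≤ S.max' hS + 1 - S.min' hS := by
    have : S.min' hS ≤ S.max' hS := S.min'_le _ (S.max'_mem hS)
    rw [← Nat.cast_add_one, ← Nat.cast_sub (by omega)]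
    exact_mod_cast h2
  linarith

section
variable {r : ℕ} {W : IntervalWavelet r} {C : ℝ}

lemma IntervalWavelet.HasBound.card_support_le (hW : W.HasBound C) {j : ℕ} (hj : W.j0 ≤ j) (x : ℝ) :
    (({k ∈ Finset.Icc 1 (2 ^ j) | W.mother j k x ≠ 0} : Finset ℕ).card : ℝ) ≤ 2 * C + 1 := by
  refine card_le_of_forall_abs_sub_le (a := 2 ^ j * x) (by linarith [hW.one_le]) fun k hk => ?_
  rw [Finset.mem_filter] at hk
  exact (hW.support_mother j hj k hk.1 x hk.2).2

/-- Only boundedly many wavelets of a level overlap, so they are almost orthogonal pointwise. -/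
lemma IntervalWavelet.HasBound.sq_sum_mother_le (hW : W.HasBound C) {j : ℕ} (hj : W.j0 ≤ j)
    (a : ℕ → ℝ) (x : ℝ) :
    (∑ k ∈ Finset.Icc 1 (2 ^ j), a k * W.mother j k x) ^ 2
      ≤ (2 * C + 1) * ∑ k ∈ Finset.Icc 1 (2 ^ j), a k ^ 2 * W.mother j k x ^ 2 := by
  have h1 : ∑ k ∈ Finset.Icc 1 (2 ^ j), a k * W.mother j k x
      = ∑ k ∈ Finset.Icc 1 (2 ^ j) with W.mother j k x ≠ 0, a k * W.mother j k x := by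
    rw [Finset.sum_filter_of_ne]
    intro k _ h h'
    exact h (by rw [h', mul_zero])
  rw [h1]
  refine sq_sum_le_card_mul_sum_sq.trans ?_
  gcongr
  · have := hW.one_le; positivity
  · exact hW.card_support_le hj x
  · simp_rw [mul_pow]
    exact Finset.sum_le_sum_of_subset_of_nonneg (Finset.filter_subset _ _)
      fun _ _ _ => by positivity

lemma IntervalWavelet.HasBound.sum_abs_mother_le (hW : W.HasBound C) {j : ℕ} (hj : W.j0 ≤ j)
    (x : ℝ) :
    ∑ k ∈ Finset.Icc 1 (2 ^ j), |W.mother j k x| ≤ (2 * C + 1) * (C * 2 ^ ((j : ℝ) / 2)) := by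
  have hC := hW.one_le
  have h1 : ∑ k ∈ Finset.Icc 1 (2 ^ j), |W.mother j k x|
      = ∑ k ∈ Finset.Icc 1 (2 ^ j) with W.mother j k x ≠ 0, |W.mother j k x| := by
    rw [Finset.sum_filter_of_ne]
    intro k _ h h'
    exact h (by rw [h', abs_zero])
  rw [h1]
  refine (Finset.sum_le_card_nsmul _ _ (C * 2 ^ ((j : ℝ) / 2)) fun k hk =>
    hW.abs_mother_le j hj k (Finset.mem_filter.1 hk).1 x).trans ?_
  rw [nsmul_eq_mul]
  gcongr
  exact hW.card_support_le hj x

lemma IntervalWavelet.HasBound.sum_sq_mother_le (hW : W.HasBound C) {j : ℕ} (hj : W.j0 ≤ j)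
    (x : ℝ) :
    ∑ k ∈ Finset.Icc 1 (2 ^ j), W.mother j k x ^ 2 ≤ (2 * C + 1) * C ^ 2 * 2 ^ j := by
  have hC := hW.one_le
  calc ∑ k ∈ Finset.Icc 1 (2 ^ j), W.mother j k x ^ 2
      ≤ ∑ k ∈ Finset.Icc 1 (2 ^ j), (C * 2 ^ ((j : ℝ) / 2)) * |W.mother j k x| := by
        refine Finset.sum_le_sum fun k hk => ?_
        rw [← sq_abs, sq]
        gcongr
        exact hW.abs_mother_le j hj k hk x
    _ ≤ (C * 2 ^ ((j : ℝ) / 2)) * ((2 * C + 1) * (C * 2 ^ ((j : ℝ) / 2))) := by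
        rw [← Finset.mul_sum]
        gcongr
        exact hW.sum_abs_mother_le hj x
    _ = (2 * C + 1) * C ^ 2 * (2 ^ ((j : ℝ) / 2) * 2 ^ ((j : ℝ) / 2)) := by ring
    _ = _ := by
        rw [← Real.rpow_add (by norm_num), add_halves, Real.rpow_natCast]

lemma IntervalWavelet.HasBound.memLp_mother (hW : W.HasBound C) {j k : ℕ} (hj : W.j0 ≤ j)
    (hk : k ∈ Finset.Icc 1 (2 ^ j)) (p : ℝ≥0∞) :
    MemLp (W.mother j k) p (volume.restrict (Icc (0 : ℝ) 1)) :=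
  MemLp.of_bound (hW.measurable_mother j hj k hk).aestronglyMeasurable (C * 2 ^ ((j : ℝ) / 2))
    (Eventually.of_forall fun t => hW.abs_mother_le j hj k hk t)

lemma IntervalWavelet.HasBound.memLp_father (hW : W.HasBound C) {k : ℕ}
    (hk : k ∈ Finset.Icc 1 (2 ^ W.j0)) (p : ℝ≥0∞) :
    MemLp (W.father k) p (volume.restrict (Icc (0 : ℝ) 1)) :=
  MemLp.of_bound (hW.measurable_father k hk).aestronglyMeasurable C
    (Eventually.of_forall fun t => hW.abs_father_le k hk t)

/-- The part of level `j` in the wavelet expansion with coefficients `θ`. -/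
def IntervalWavelet.level (W : IntervalWavelet r) (θ : ℕ → ℕ → ℝ) (j : ℕ) (x : ℝ) : ℝ :=
  ∑ k ∈ Finset.Icc 1 (2 ^ j), θ j k * W.mother j k x

lemma IntervalWavelet.HasBound.abs_level_le (hW : W.HasBound C) {j : ℕ} (hj : W.j0 ≤ j)
    {θ : ℕ → ℕ → ℝ} {D α : ℝ} (hD : 0 ≤ D)
    (hθ : ∀ k ∈ Finset.Icc 1 (2 ^ j), |θ j k| ≤ D * 2 ^ (-(j : ℝ) * (α + 1 / 2))) (x : ℝ) :
    |W.level θ j x| ≤ D * ((2 * C + 1) * C) * ((2 : ℝ) ^ (-α)) ^ j := by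
  have hC := hW.one_le
  calc |W.level θ j x| ≤ ∑ k ∈ Finset.Icc 1 (2 ^ j), |θ j k * W.mother j k x| :=
        Finset.abs_sum_le_sum_abs _ _
    _ ≤ ∑ k ∈ Finset.Icc 1 (2 ^ j), D * 2 ^ (-(j : ℝ) * (α + 1 / 2)) * |W.mother j k x| := by
        refine Finset.sum_le_sum fun k hk => ?_
        rw [abs_mul]
        gcongr
        exact hθ k hk
    _ ≤ D * 2 ^ (-(j : ℝ) * (α + 1 / 2)) * ((2 * C + 1) * (C * 2 ^ ((j : ℝ) / 2))) := by
        rw [← Finset.mul_sum]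
        gcongr
        exact hW.sum_abs_mother_le hj x
    _ = D * ((2 * C + 1) * C) * (2 ^ (-(j : ℝ) * (α + 1 / 2)) * 2 ^ ((j : ℝ) / 2)) := by ring
    _ = _ := by
        rw [← Real.rpow_add (by norm_num), ← Real.rpow_mul_natCast (by norm_num)]
        congr 2
        ring

lemma IntervalWavelet.HasBound.measurable_level (hW : W.HasBound C) {j : ℕ} (hj : W.j0 ≤ j)
    (θ : ℕ → ℕ → ℝ) : Measurable (W.level θ j) :=
  Finset.measurable_fun_sum _ fun k hk => (hW.measurable_mother j hj k hk).const_mul _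

/-- The wavelet series of a function with decaying coefficients represents the function, and it
converges geometrically in the supremum norm. -/
theorem IntervalWavelet.HasBound.ae_abs_sub_le (hW : W.HasBound C) {f : ℝ → ℝ} {D α : ℝ}
    (hα : 0 < α) (hD : 0 ≤ D) (hf : MemLp f 2 (volume.restrict (Icc (0 : ℝ) 1)))
    (hθ : ∀ j ≥ W.j0, ∀ k ∈ Finset.Icc 1 (2 ^ j), |∫ t in Icc (0 : ℝ) 1, f t * W.mother j k t|
      ≤ D * 2 ^ (-(j : ℝ) * (α + 1 / 2))) {J : ℕ} (hJ : W.j0 ≤ J) :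
    ∀ᵐ x ∂(volume.restrict (Icc (0 : ℝ) 1)),
      |f x - ((∑ k ∈ Finset.Icc 1 (2 ^ W.j0),
          (∫ t in Icc (0 : ℝ) 1, f t * W.father k t) * W.father k x)
        + ∑ j ∈ Finset.Ico W.j0 J,
          W.level (fun j k => ∫ t in Icc (0 : ℝ) 1, f t * W.mother j k t) j x)|
      ≤ D * ((2 * C + 1) * C) * (1 - (2 : ℝ) ^ (-α))⁻¹ * ((2 : ℝ) ^ (-α)) ^ J := by
  have hC := hW.one_le
  set ν := volume.restrict (Icc (0 : ℝ) 1)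
  set θ : ℕ → ℕ → ℝ := fun j k => ∫ t in Icc (0 : ℝ) 1, f t * W.mother j k t with hθdef
  set ξ : ℕ → ℝ := fun k => ∫ t in Icc (0 : ℝ) 1, f t * W.father k t with hξdef
  set q : ℝ := (2 : ℝ) ^ (-α) with hq
  have hq0 : 0 < q := by positivity
  have hq1 : q < 1 := Real.rpow_lt_one_of_one_lt_of_neg (by norm_num) (by linarith)
  set E : ℝ := D * ((2 * C + 1) * C) with hE
  have hE0 : 0 ≤ E := by positivity
  have hU : ∀ j ≥ W.j0, ∀ x, |W.level θ j x| ≤ E * q ^ j := fun j hj x =>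
    hW.abs_level_le hj hD (fun k hk => hθ j hj k hk) x
  have hUm : ∀ j ≥ W.j0, Measurable (W.level θ j) := fun j hj => hW.measurable_level hj θ
  have hgeo : ∀ i : ℕ, HasSum (fun j => E * q ^ (i + j)) (E * (1 - q)⁻¹ * q ^ i) := by
    intro i
    have := (hasSum_geometric_of_lt_one hq0.le hq1).mul_left (E * q ^ i)
    rw [show E * (1 - q)⁻¹ * q ^ i = E * q ^ i * (1 - q)⁻¹ by ring]
    simpa only [pow_add, mul_assoc] using this
  have hsum : ∀ x, Summable fun j => W.level θ (W.j0 + j) x := fun x =>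
    Summable.of_norm_bounded (hgeo W.j0).summable fun j => hU _ (Nat.le_add_right _ _) x
  set u : ℝ → ℝ := fun x => ∑' j, W.level θ (W.j0 + j) x with hu
  have hum : Measurable u := by
    refine measurable_of_tendsto_metrizable (f := fun N x => ∑ j ∈ Finset.range N,
      W.level θ (W.j0 + j) x) (fun N => Finset.measurable_fun_sum _ fun j _ =>
        hUm _ (Nat.le_add_right _ _)) ?_
    exact tendsto_pi_nhds.2 fun x => (hsum x).hasSum.tendsto_sum_nat
  have hub : ∀ x, ‖u x‖ ≤ E * (1 - q)⁻¹ * q ^ W.j0 := fun x =>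
    tsum_of_norm_bounded (hgeo W.j0) fun j => hU _ (Nat.le_add_right _ _) x
  have huL : MemLp u 2 ν := MemLp.of_bound hum.aestronglyMeasurable _ (Eventually.of_forall hub)
  set v : ℝ → ℝ := fun x => ∑ k ∈ Finset.Icc 1 (2 ^ W.j0), ξ k * W.father k x with hv
  have hvL : MemLp v 2 ν := memLp_finsetSum _ fun k hk => (hW.memLp_father hk 2).const_mul _
  -- the series may be integrated term by term against square integrable bounded functions
  have hterm : ∀ h : ℝ → ℝ, MemLp h 2 ν → ∫ x, u x * h x ∂ν
      = ∑' j, ∑ k ∈ Finset.Icc 1 (2 ^ (W.j0 + j)), θ (W.j0 + j) k *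
          ∫ x, W.mother (W.j0 + j) k x * h x ∂ν := by
    intro h hh
    have hh1 : Integrable h ν := hh.integrable (by norm_num)
    have hint : ∀ j, Integrable (fun x => W.level θ (W.j0 + j) x * h x) ν := fun j =>
      hh1.bdd_mul (hUm _ (Nat.le_add_right _ _)).aestronglyMeasurable
        (Eventually.of_forall (hU (W.j0 + j) (Nat.le_add_right _ _)))
    have h1 : ∀ x, u x * h x = ∑' j, W.level θ (W.j0 + j) x * h x := fun x => by
      rw [hu, tsum_mul_right]
    simp_rw [h1]
    rw [← integral_tsum_of_summable_integral_norm hint]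
    · refine tsum_congr fun j => ?_
      simp_rw [IntervalWavelet.level, Finset.sum_mul]
      rw [integral_finsetSum]
      · refine Finset.sum_congr rfl fun k _ => ?_
        rw [← integral_const_mul]
        simp_rw [mul_assoc]
      · intro k hk
        simp_rw [mul_assoc]
        exact ((hW.memLp_mother (Nat.le_add_right _ _) hk 2).integrable_mul hh).const_mul _
    · refine Summable.of_nonneg_of_le (fun j => integral_nonneg fun x => norm_nonneg _)
        (fun j => ?_) ((hgeo W.j0).summable.mul_right (∫ x, ‖h x‖ ∂ν))
      rw [← integral_const_mul]
      refine integral_mono (hint j).norm (hh1.norm.const_mul _) fun x => ?_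
      dsimp only
      rw [norm_mul]
      gcongr
      exact hU _ (Nat.le_add_right _ _) x
  have hvint : ∀ h : ℝ → ℝ, MemLp h 2 ν → ∫ x, v x * h x ∂ν
      = ∑ k ∈ Finset.Icc 1 (2 ^ W.j0), ξ k * ∫ x, W.father k x * h x ∂ν := by
    intro h hh
    simp_rw [hv, Finset.sum_mul]
    rw [integral_finsetSum]
    · refine Finset.sum_congr rfl fun k _ => ?_
      rw [← integral_const_mul]
      simp_rw [mul_assoc]
    · intro k hk
      simp_rw [mul_assoc]
      exact ((hW.memLp_father hk 2).integrable_mul hh).const_mul _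
  have hsplit : ∀ h : ℝ → ℝ, MemLp h 2 ν → ∫ x, (f x - (v x + u x)) * h x ∂ν
      = (∫ x, f x * h x ∂ν) - ((∫ x, v x * h x ∂ν) + ∫ x, u x * h x ∂ν) := by
    intro h hh
    have i1 : Integrable (fun x => f x * h x) ν := hf.integrable_mul hh
    have i2 : Integrable (fun x => v x * h x) ν := hvL.integrable_mul hh
    have i3 : Integrable (fun x => u x * h x) ν := huL.integrable_mul hh
    simp_rw [sub_mul, add_mul]
    have i4 : Integrable (fun x => v x * h x + u x * h x) ν := i2.add i3
    rw [integral_sub i1 i4, integral_add i2 i3]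
  have hzero := W.complete (fun x => f x - (v x + u x)) (hf.sub (hvL.add huL))
    (fun k hk => by
      have hk2 := hW.memLp_father hk 2
      change ∫ x, (f x - (v x + u x)) * W.father k x ∂ν = 0
      rw [hsplit _ hk2, hvint _ hk2, hterm _ hk2]
      have h1 : ∑ l ∈ Finset.Icc 1 (2 ^ W.j0), ξ l * ∫ x, W.father l x * W.father k x ∂ν = ξ k := by
        rw [Finset.sum_congr rfl fun l hl => by
          rw [show ∫ x, W.father l x * W.father k x ∂ν = if l = k then 1 else 0 from
            W.orthonormal_φ l hl k hk]]
        simp [Finset.sum_ite_eq', hk]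
      have h2 : ∀ j, ∑ l ∈ Finset.Icc 1 (2 ^ (W.j0 + j)), θ (W.j0 + j) l *
          ∫ x, W.mother (W.j0 + j) l x * W.father k x ∂ν = 0 := fun j =>
        Finset.sum_eq_zero fun l hl => by
          have : ∫ x, W.father k x * W.mother (W.j0 + j) l x ∂ν = 0 :=
            W.orthogonal_φψ k hk (W.j0 + j) (Nat.le_add_right _ _) l hl
          simp_rw [mul_comm (W.mother _ _ _)]
          rw [this, mul_zero]
      simp_rw [h1, h2, tsum_zero]
      rw [add_zero, sub_eq_zero])
    (fun i hi l hl => by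
      have hl2 := hW.memLp_mother hi hl 2
      change ∫ x, (f x - (v x + u x)) * W.mother i l x ∂ν = 0
      rw [hsplit _ hl2, hvint _ hl2, hterm _ hl2]
      have h1 : ∑ k ∈ Finset.Icc 1 (2 ^ W.j0), ξ k * ∫ x, W.father k x * W.mother i l x ∂ν = 0 :=
        Finset.sum_eq_zero fun k hk => by
          rw [show ∫ x, W.father k x * W.mother i l x ∂ν = 0 from
            W.orthogonal_φψ k hk i hi l hl, mul_zero]
      have h2 : ∀ j, ∑ k ∈ Finset.Icc 1 (2 ^ (W.j0 + j)), θ (W.j0 + j) k *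
          ∫ x, W.mother (W.j0 + j) k x * W.mother i l x ∂ν = if j = i - W.j0 then θ i l else 0 := by
        intro j
        rw [Finset.sum_congr rfl fun k hk => by
          rw [show ∫ x, W.mother (W.j0 + j) k x * W.mother i l x ∂ν
            = if W.j0 + j = i ∧ k = l then 1 else 0 from
              W.orthonormal_ψ (W.j0 + j) (Nat.le_add_right _ _) k hk i hi l hl]]
        split_ifs with hj
        · have hji : W.j0 + j = i := by omega
          rw [hji]
          simp [hl]
        · have hji : W.j0 + j ≠ i := by omega
          simp [hji]
      simp_rw [h1, h2, tsum_ite_eq]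
      rw [zero_add, sub_eq_zero])
  filter_upwards [hzero] with x hx
  have hx' : f x = v x + u x := by
    simp only [Pi.zero_apply] at hx
    linarith
  have h1 : u x = ∑ j ∈ Finset.Ico W.j0 J, W.level θ j x + ∑' j, W.level θ (J + j) x := by
    change ∑' j, W.level θ (W.j0 + j) x = _
    rw [← (hsum x).sum_add_tsum_nat_add (J - W.j0), Finset.sum_Ico_eq_sum_range]
    congr 1
    refine tsum_congr fun j => ?_
    congr 1
    omega
  rw [hx', h1, show v x + (∑ j ∈ Finset.Ico W.j0 J, W.level θ j x + ∑' j, W.level θ (J + j) x)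
    - (v x + ∑ j ∈ Finset.Ico W.j0 J, W.level θ j x) = ∑' j, W.level θ (J + j) x by ring]
  rw [← Real.norm_eq_abs]
  exact tsum_of_norm_bounded (hgeo J) fun j => hU (J + j) (by omega) x

end

/-! ### From coefficients to the local risk -/

/-- `f̂ - f` splits into the father part, the wavelet levels below `J` and a remainder; the levels
are combined by a weighted Cauchy–Schwarz inequality. -/
theorem localRisk_le {Ω : Type*} [MeasurableSpace Ω] {P : Measure Ω} [IsProbabilityMeasure P]
    {r : ℕ} {W : IntervalWavelet r} {C : ℝ} (hW : W.HasBound C) {lam : ℝ} {n : ℕ}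
    {yt : ℕ → Ω → ℝ} {y : ℕ → ℕ → Ω → ℝ} {f : ℝ → ℝ} {ξ : ℕ → ℝ} {θ : ℕ → ℕ → ℝ}
    {x0 c ε δ S K : ℝ} {w : ℕ → ℝ} (hc : 0 < c) (hε : 0 ≤ ε) (hK : 0 ≤ K)
    (hyt : ∀ k ∈ Finset.Icc 1 (2 ^ W.j0), AEMeasurable (yt k) P)
    (hy : ∀ j ≥ W.j0, ∀ k ∈ Finset.Icc 1 (2 ^ j), AEMeasurable (y j k) P)
    (hf : ∀ᵐ x ∂(volume.restrict (Icc (0 : ℝ) 1)),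
      |f x - ((∑ k ∈ Finset.Icc 1 (2 ^ W.j0), ξ k * W.father k x)
        + ∑ j ∈ Finset.Ico W.j0 (Nat.clog 2 n), W.level θ j x)| ≤ δ)
    (hδ : δ ^ 2 ≤ K * ε)
    (hξ : ∀ k ∈ Finset.Icc 1 (2 ^ W.j0), ∫⁻ ω, ENNReal.ofReal ((yt k ω - ξ k) ^ 2) ∂P
      ≤ ENNReal.ofReal ε)
    (hw : ∀ j, 0 < w j) (hwS : ∑ j ∈ Finset.Ico W.j0 (Nat.clog 2 n), w j ≤ S)
    (hlevel : ∀ j ∈ Finset.Ico W.j0 (Nat.clog 2 n), ∑ k ∈ Finset.Icc 1 (2 ^ j),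
      (∫⁻ ω, ENNReal.ofReal ((thetaHat lam n (fun j k => y j k ω) j k - θ j k) ^ 2) ∂P)
        * ∫⁻ x in Icc (x0 - c) (x0 + c) ∩ Icc 0 1, ENNReal.ofReal (W.mother j k x ^ 2)
      ≤ ENNReal.ofReal (2 * c * (K * ε * w j ^ 2))) :
    localRisk P (fun ω => blockJS W lam n (fun k => yt k ω) (fun j k => y j k ω)) f x0 c
      ≤ ENNReal.ofReal
        ((3 * 2 ^ W.j0 * C ^ 2 * 2 ^ W.j0 + 3 * S * (2 * C + 1) * (K * S) + 3 * K) * ε) := by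
  have hC := hW.one_le
  have hS : 0 ≤ S := (Finset.sum_nonneg fun j _ => (hw j).le).trans hwS
  set J := Nat.clog 2 n
  set I : Set ℝ := Icc (x0 - c) (x0 + c) ∩ Icc 0 1 with hI
  set N : ℝ := 2 ^ W.j0 with hN
  set a : ℕ → ℕ → Ω → ℝ := fun j k ω => thetaHat lam n (fun j k => y j k ω) j k - θ j k with ha
  have hvol : volume I ≤ ENNReal.ofReal (2 * c) := by
    refine (measure_mono inter_subset_left).trans ?_
    rw [Real.volume_Icc]
    exact ENNReal.ofReal_le_ofReal (by linarith)
  have hfI : ∀ᵐ x ∂(volume.restrict I), |f x - ((∑ k ∈ Finset.Icc 1 (2 ^ W.j0), ξ k * W.father k x)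
        + ∑ j ∈ Finset.Ico W.j0 J, W.level θ j x)| ≤ δ :=
    ae_mono (Measure.restrict_mono inter_subset_right le_rfl) hf
  have hpath : ∀ ω, ∀ᵐ x ∂(volume.restrict I), ENNReal.ofReal
      ((blockJS W lam n (fun k => yt k ω) (fun j k => y j k ω) x - f x) ^ 2)
      ≤ ENNReal.ofReal (3 * N * C ^ 2) *
          (∑ k ∈ Finset.Icc 1 (2 ^ W.j0), ENNReal.ofReal ((yt k ω - ξ k) ^ 2))
        + (∑ j ∈ Finset.Ico W.j0 J, ENNReal.ofReal (3 * S * (2 * C + 1) / w j) *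
          ∑ k ∈ Finset.Icc 1 (2 ^ j), ENNReal.ofReal (a j k ω ^ 2)
            * ENNReal.ofReal (W.mother j k x ^ 2))
        + ENNReal.ofReal (3 * K * ε) := by
    intro ω
    filter_upwards [hfI] with x hx
    set u1 := ∑ k ∈ Finset.Icc 1 (2 ^ W.j0), (yt k ω - ξ k) * W.father k x with hu1
    set u2 := ∑ j ∈ Finset.Ico W.j0 J, W.level (fun j k => a j k ω) j x with hu2
    set u3 := f x - ((∑ k ∈ Finset.Icc 1 (2 ^ W.j0), ξ k * W.father k x)
        + ∑ j ∈ Finset.Ico W.j0 J, W.level θ j x) with hu3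
    have hdec : blockJS W lam n (fun k => yt k ω) (fun j k => y j k ω) x - f x
        = u1 + u2 - u3 := by
      rw [hu1, hu2, hu3, blockJS]
      simp only [IntervalWavelet.level, ha, sub_mul, Finset.sum_sub_distrib]
      ring
    have h1 : u1 ^ 2 ≤ N * C ^ 2 * ∑ k ∈ Finset.Icc 1 (2 ^ W.j0), (yt k ω - ξ k) ^ 2 := by
      refine (sq_sum_le_card_mul_sum_sq).trans ?_
      rw [Nat.card_Icc, Nat.add_sub_cancel, mul_assoc]
      push_cast
      gcongr
      rw [Finset.mul_sum]
      refine Finset.sum_le_sum fun k hk => ?_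
      rw [mul_pow, mul_comm, ← sq_abs (W.father k x)]
      gcongr
      exact hW.abs_father_le k hk x
    have h2 : u2 ^ 2 ≤ S * ∑ j ∈ Finset.Ico W.j0 J, (2 * C + 1) / w j *
        ∑ k ∈ Finset.Icc 1 (2 ^ j), a j k ω ^ 2 * W.mother j k x ^ 2 := by
      rcases (Finset.Ico W.j0 J).eq_empty_or_nonempty with he | hne
      · simp [hu2, he]
      have hpos : 0 < ∑ j ∈ Finset.Ico W.j0 J, w j := Finset.sum_pos (fun j _ => hw j) hne
      have h3 := Finset.sq_sum_div_le_sum_sq_div (Finset.Ico W.j0 J)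
        (fun j => W.level (fun j k => a j k ω) j x) (g := w) (fun j _ => hw j)
      rw [div_le_iff₀ hpos, mul_comm] at h3
      refine h3.trans ?_
      have h4 : ∀ j ∈ Finset.Ico W.j0 J, W.level (fun j k => a j k ω) j x ^ 2 / w j
          ≤ (2 * C + 1) / w j * ∑ k ∈ Finset.Icc 1 (2 ^ j), a j k ω ^ 2 * W.mother j k x ^ 2 := by
        intro j hj
        rw [div_mul_eq_mul_div]
        exact div_le_div_of_nonneg_right
          (hW.sq_sum_mother_le (Finset.mem_Ico.1 hj).1 (fun k => a j k ω) x) (hw j).le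
      refine mul_le_mul hwS (Finset.sum_le_sum h4) ?_ hS
      exact Finset.sum_nonneg fun j _ => div_nonneg (sq_nonneg _) (hw j).le
    have h3 : u3 ^ 2 ≤ K * ε := by
      refine le_trans ?_ hδ
      rw [← sq_abs]
      gcongr
    have h4 : (u1 + u2 - u3) ^ 2 ≤
        3 * N * C ^ 2 * (∑ k ∈ Finset.Icc 1 (2 ^ W.j0), (yt k ω - ξ k) ^ 2)
        + (∑ j ∈ Finset.Ico W.j0 J, 3 * S * (2 * C + 1) / w j *
          ∑ k ∈ Finset.Icc 1 (2 ^ j), a j k ω ^ 2 * W.mother j k x ^ 2) + 3 * K * ε := by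
      have h5 : ∑ j ∈ Finset.Ico W.j0 J, 3 * S * (2 * C + 1) / w j *
          ∑ k ∈ Finset.Icc 1 (2 ^ j), a j k ω ^ 2 * W.mother j k x ^ 2
          = 3 * (S * ∑ j ∈ Finset.Ico W.j0 J, (2 * C + 1) / w j *
            ∑ k ∈ Finset.Icc 1 (2 ^ j), a j k ω ^ 2 * W.mother j k x ^ 2) := by
        rw [Finset.mul_sum, Finset.mul_sum]
        exact Finset.sum_congr rfl fun j _ => by ring
      rw [h5]
      nlinarith [sq_nonneg (u1 - u2), sq_nonneg (u1 + u3), sq_nonneg (u2 + u3)]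
    have hnn : ∀ j, 0 ≤ ∑ k ∈ Finset.Icc 1 (2 ^ j), a j k ω ^ 2 * W.mother j k x ^ 2 :=
      fun j => Finset.sum_nonneg fun k _ => by positivity
    have hco : ∀ j, 0 ≤ 3 * S * (2 * C + 1) / w j := fun j =>
      div_nonneg (by positivity) (hw j).le
    rw [hdec]
    refine (ENNReal.ofReal_le_ofReal h4).trans (le_of_eq ?_)
    rw [ENNReal.ofReal_add (add_nonneg (mul_nonneg (by positivity)
        (Finset.sum_nonneg fun _ _ => sq_nonneg _))
        (Finset.sum_nonneg fun j _ => mul_nonneg (hco j) (hnn j))) (by positivity),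
      ENNReal.ofReal_add (mul_nonneg (by positivity) (Finset.sum_nonneg fun _ _ => sq_nonneg _))
        (Finset.sum_nonneg fun j _ => mul_nonneg (hco j) (hnn j)),
      ENNReal.ofReal_mul (by positivity),
      ENNReal.ofReal_sum_of_nonneg (fun _ _ => sq_nonneg _),
      ENNReal.ofReal_sum_of_nonneg (fun j _ => mul_nonneg (hco j) (hnn j))]
    congr 2
    refine Finset.sum_congr rfl fun j _ => ?_
    rw [ENNReal.ofReal_mul (hco j), ENNReal.ofReal_sum_of_nonneg fun k _ => by positivity]
    congr 1
    exact Finset.sum_congr rfl fun k _ => ENNReal.ofReal_mul (sq_nonneg _)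
  -- integrate over the neighbourhood
  have hx : ∀ ω, ∫⁻ x in I, ENNReal.ofReal
      ((blockJS W lam n (fun k => yt k ω) (fun j k => y j k ω) x - f x) ^ 2)
      ≤ ENNReal.ofReal (3 * N * C ^ 2) *
          (∑ k ∈ Finset.Icc 1 (2 ^ W.j0), ENNReal.ofReal ((yt k ω - ξ k) ^ 2))
          * ENNReal.ofReal (2 * c)
        + (∑ j ∈ Finset.Ico W.j0 J, ENNReal.ofReal (3 * S * (2 * C + 1) / w j) *
          ∑ k ∈ Finset.Icc 1 (2 ^ j), ENNReal.ofReal (a j k ω ^ 2)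
            * ∫⁻ x in I, ENNReal.ofReal (W.mother j k x ^ 2))
        + ENNReal.ofReal (3 * K * ε) * ENNReal.ofReal (2 * c) := by
    intro ω
    refine (lintegral_mono_ae (hpath ω)).trans ?_
    have hm : ∀ j ∈ Finset.Ico W.j0 J, ∀ k ∈ Finset.Icc 1 (2 ^ j),
        Measurable fun x => ENNReal.ofReal (W.mother j k x ^ 2) := fun j hj k hk =>
      ((hW.measurable_mother j (Finset.mem_Ico.1 hj).1 k hk).pow_const 2).ennreal_ofReal
    have hm2 : ∀ j ∈ Finset.Ico W.j0 J, Measurable fun x => ∑ k ∈ Finset.Icc 1 (2 ^ j),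
        ENNReal.ofReal (a j k ω ^ 2) * ENNReal.ofReal (W.mother j k x ^ 2) := fun j hj =>
      Finset.measurable_fun_sum _ fun k hk => (hm j hj k hk).const_mul _
    rw [lintegral_add_right _ measurable_const, lintegral_add_left measurable_const,
      lintegral_const, lintegral_const, Measure.restrict_apply_univ,
      lintegral_finsetSum _ fun j hj => (hm2 j hj).const_mul _]
    gcongr with j hj
    rw [lintegral_const_mul _ (hm2 j hj),
      lintegral_finsetSum _ fun k hk => (hm j hj k hk).const_mul _]
    gcongr with k hk
    rw [lintegral_const_mul _ (hm j hj k hk)]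
  -- integrate over the sample space
  have hb : ∀ k ∈ Finset.Icc 1 (2 ^ W.j0), AEMeasurable
      (fun ω => ENNReal.ofReal ((yt k ω - ξ k) ^ 2)) P := fun k hk =>
    (((hyt k hk).sub_const _).pow_const 2).ennreal_ofReal
  have ham : ∀ j ∈ Finset.Ico W.j0 J, ∀ k ∈ Finset.Icc 1 (2 ^ j),
      AEMeasurable (fun ω => ENNReal.ofReal (a j k ω ^ 2)) P := fun j hj k hk =>
    (((aemeasurable_thetaHat (fun l hl => hy j (Finset.mem_Ico.1 hj).1 l hl) hk).sub_const
      _).pow_const 2).ennreal_ofReal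
  have ham2 : ∀ j ∈ Finset.Ico W.j0 J, AEMeasurable (fun ω => ∑ k ∈ Finset.Icc 1 (2 ^ j),
      ENNReal.ofReal (a j k ω ^ 2) * ∫⁻ x in I, ENNReal.ofReal (W.mother j k x ^ 2)) P :=
    fun j hj => Finset.aemeasurable_fun_sum _ fun k hk => (ham j hj k hk).mul_const _
  have hω : ∫⁻ ω, ∫⁻ x in I, ENNReal.ofReal
      ((blockJS W lam n (fun k => yt k ω) (fun j k => y j k ω) x - f x) ^ 2) ∂volume ∂P
      ≤ ENNReal.ofReal (2 * c) * ENNReal.ofReal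
        ((3 * N * C ^ 2 * N + 3 * S * (2 * C + 1) * (K * S) + 3 * K) * ε) := by
    refine (lintegral_mono hx).trans ?_
    rw [lintegral_add_right _ measurable_const, lintegral_add_left',
      lintegral_mul_const'' _ ((Finset.aemeasurable_fun_sum _ hb).const_mul _),
      lintegral_const_mul'' _ (Finset.aemeasurable_fun_sum _ hb), lintegral_finsetSum' _ hb,
      lintegral_const, measure_univ, mul_one,
      lintegral_finsetSum' _ fun j hj => (ham2 j hj).const_mul _]
    swap
    · exact ((Finset.aemeasurable_fun_sum _ hb).const_mul _).mul_const _
    have e1 : ∑ k ∈ Finset.Icc 1 (2 ^ W.j0), ∫⁻ ω, ENNReal.ofReal ((yt k ω - ξ k) ^ 2) ∂P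
        ≤ ENNReal.ofReal (N * ε) := by
      refine (Finset.sum_le_card_nsmul _ _ _ hξ).trans (le_of_eq ?_)
      rw [Nat.card_Icc, Nat.add_sub_cancel, nsmul_eq_mul, ENNReal.ofReal_mul (by positivity), hN,
        ENNReal.ofReal_pow (by norm_num)]
      simp
    have e2 : ∑ j ∈ Finset.Ico W.j0 J, ∫⁻ ω, ENNReal.ofReal (3 * S * (2 * C + 1) / w j) *
          ∑ k ∈ Finset.Icc 1 (2 ^ j), ENNReal.ofReal (a j k ω ^ 2)
            * ∫⁻ x in I, ENNReal.ofReal (W.mother j k x ^ 2) ∂volume ∂P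
        ≤ ENNReal.ofReal (3 * S * (2 * C + 1) * (2 * c * (K * ε) * S)) := by
      calc _ ≤ ∑ j ∈ Finset.Ico W.j0 J, ENNReal.ofReal
            (3 * S * (2 * C + 1) * (2 * c * (K * ε)) * w j) := by
            refine Finset.sum_le_sum fun j hj => ?_
            rw [lintegral_const_mul'' _ (ham2 j hj),
              lintegral_finsetSum' _ fun k hk => (ham j hj k hk).mul_const _]
            have e3 : ∀ k ∈ Finset.Icc 1 (2 ^ j), ∫⁻ ω, ENNReal.ofReal (a j k ω ^ 2)
                * (∫⁻ x in I, ENNReal.ofReal (W.mother j k x ^ 2)) ∂P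
                = (∫⁻ ω, ENNReal.ofReal (a j k ω ^ 2) ∂P)
                * (∫⁻ x in I, ENNReal.ofReal (W.mother j k x ^ 2)) := fun k hk =>
              lintegral_mul_const'' _ (ham j hj k hk)
            rw [Finset.sum_congr rfl e3]
            refine (mul_le_mul_right (hlevel j hj) _).trans ?_
            rw [← ENNReal.ofReal_mul (div_nonneg (by positivity) (hw j).le)]
            refine ENNReal.ofReal_le_ofReal (le_of_eq ?_)
            have := (hw j).ne'
            field_simp
        _ ≤ _ := by
            rw [← ENNReal.ofReal_sum_of_nonneg fun j _ => mul_nonneg (by positivity) (hw j).le,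
              ← Finset.mul_sum]
            refine ENNReal.ofReal_le_ofReal ?_
            have := mul_le_mul_of_nonneg_left hwS
              (by positivity : 0 ≤ 3 * S * (2 * C + 1) * (2 * c * (K * ε)))
            linarith
    calc _ ≤ ENNReal.ofReal (3 * N * C ^ 2) * ENNReal.ofReal (N * ε) * ENNReal.ofReal (2 * c)
          + ENNReal.ofReal (3 * S * (2 * C + 1) * (2 * c * (K * ε) * S))
          + ENNReal.ofReal (3 * K * ε) * ENNReal.ofReal (2 * c) := by gcongr
      _ = _ := by
          rw [← ENNReal.ofReal_mul (by positivity), ← ENNReal.ofReal_mul (by positivity),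
            ← ENNReal.ofReal_mul (by positivity), ← ENNReal.ofReal_mul (by positivity),
            ← ENNReal.ofReal_add (by positivity) (by positivity),
            ← ENNReal.ofReal_add (by positivity) (by positivity)]
          congr 1
          ring
  unfold localRisk
  refine ENNReal.div_le_of_le_mul ?_
  rw [mul_comm]
  exact hω

/-! ### Summation over levels -/

/-- Powers of two below `q` form a geometric series that is dominated by its last term. -/
lemma sum_rpow_le_of_le {a : ℝ} (ha : 0 < a) {q : ℝ} (s : Finset ℕ)
    (hs : ∀ j ∈ s, (2 : ℝ) ^ j ≤ q) :
    ∑ j ∈ s, ((2 : ℝ) ^ j / q) ^ a ≤ (1 - (2 : ℝ) ^ (-a))⁻¹ := by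
  set x : ℝ := 2 ^ (-a) with hx
  have hx0 : 0 < x := by positivity
  have hx1 : x < 1 := Real.rpow_lt_one_of_one_lt_of_neg (by norm_num) (by linarith)
  rcases s.eq_empty_or_nonempty with rfl | hne
  · simpa using hx1.le
  set m := s.max' hne with hm
  have hmq : (2 : ℝ) ^ m ≤ q := hs m (s.max'_mem hne)
  have hq : 0 < q := lt_of_lt_of_le (by positivity) hmq
  have h1 : ∀ j ∈ s, ((2 : ℝ) ^ j / q) ^ a ≤ x ^ (m - j) := by
    intro j hj
    have hjm : j ≤ m := s.le_max' j hj
    calc ((2 : ℝ) ^ j / q) ^ a ≤ ((2 : ℝ) ^ j / 2 ^ m) ^ a := by gcongr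
      _ = (((2 : ℝ) ^ (m - j))⁻¹) ^ a := by
          congr 1
          rw [div_eq_iff (by positivity), ← Nat.sub_add_cancel hjm, pow_add, Nat.sub_add_cancel hjm]
          field_simp
      _ = x ^ (m - j) := by
          rw [hx, ← Real.rpow_mul_natCast (by norm_num), ← Real.rpow_natCast, ← Real.rpow_neg
            (by norm_num), ← Real.rpow_mul (by norm_num)]
          congr 1
          ring
  calc _ ≤ ∑ j ∈ s, x ^ (m - j) := Finset.sum_le_sum h1
    _ ≤ ∑ j ∈ Finset.range (m + 1), x ^ (m - j) := by
        refine Finset.sum_le_sum_of_subset_of_nonneg (fun j hj => ?_) fun _ _ _ => by positivity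
        exact Finset.mem_range.2 (Nat.lt_succ_of_le (s.le_max' j hj))
    _ = ∑ j ∈ Finset.range (m + 1), x ^ j := by
        rw [← Finset.sum_range_reflect]
        refine Finset.sum_congr rfl fun j hj => ?_
        rw [Finset.mem_range] at hj
        congr 1
        omega
    _ ≤ _ := by
        rw [← tsum_geometric_of_lt_one hx0.le hx1]
        exact (summable_geometric_of_lt_one hx0.le hx1).sum_le_tsum _ fun _ _ => by positivity

/-- Inverse powers of two beyond `q` form a geometric series that is dominated by its first term. -/
lemma sum_rpow_neg_le_of_le {b : ℝ} (hb : 0 < b) {q : ℝ} (hq : 0 < q) (s : Finset ℕ)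
    (hs : ∀ j ∈ s, q ≤ (2 : ℝ) ^ j) :
    ∑ j ∈ s, ((2 : ℝ) ^ j / q) ^ (-b) ≤ (1 - (2 : ℝ) ^ (-b))⁻¹ := by
  set x : ℝ := 2 ^ (-b) with hx
  have hx0 : 0 < x := by positivity
  have hx1 : x < 1 := Real.rpow_lt_one_of_one_lt_of_neg (by norm_num) (by linarith)
  rcases s.eq_empty_or_nonempty with rfl | hne
  · simpa using hx1.le
  set m := s.min' hne with hm
  have hmq : q ≤ (2 : ℝ) ^ m := hs m (s.min'_mem hne)
  have h1 : ∀ j ∈ s, ((2 : ℝ) ^ j / q) ^ (-b) ≤ x ^ (j - m) := by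
    intro j hj
    have hjm : m ≤ j := s.min'_le j hj
    calc ((2 : ℝ) ^ j / q) ^ (-b) ≤ ((2 : ℝ) ^ (j - m)) ^ (-b) := by
          refine Real.rpow_le_rpow_of_nonpos (by positivity) ?_ (by linarith)
          rw [le_div_iff₀ hq]
          calc (2 : ℝ) ^ (j - m) * q ≤ 2 ^ (j - m) * 2 ^ m := by gcongr
            _ = 2 ^ j := by rw [← pow_add, Nat.sub_add_cancel hjm]
      _ = x ^ (j - m) := by
          rw [hx, ← Real.rpow_mul_natCast (by norm_num), ← Real.rpow_natCast,
            ← Real.rpow_mul (by norm_num)]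
          congr 1
          ring
  calc _ ≤ ∑ j ∈ s, x ^ (j - m) := Finset.sum_le_sum h1
    _ = ∑ i ∈ s.image (fun j => j - m), x ^ i := by
        rw [Finset.sum_image]
        intro i hi j hj hij
        have h2 := s.min'_le i hi
        have h3 := s.min'_le j hj
        simp only at hij
        omega
    _ ≤ _ := by
        rw [← tsum_geometric_of_lt_one hx0.le hx1]
        exact (summable_geometric_of_lt_one hx0.le hx1).sum_le_tsum _ fun _ _ => by positivity

/-- The weight of level `j` in the Cauchy–Schwarz inequality, for the critical scale `q`. The first
term decays geometrically away from the critical level `2 ^ j ≈ q`; the second one takes care of the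
noise that passes the threshold, and `η` of the blocks that stick out of the neighbourhood. -/
def levelWeight (α : ℝ) (n : ℕ) (q η : ℝ) (j : ℕ) : ℝ :=
  min (((2 : ℝ) ^ j / q) ^ (1 / 2 : ℝ)) (((2 : ℝ) ^ j / q) ^ (-α))
    + ((2 : ℝ) ^ j / n) ^ (1 / 2 : ℝ) + η

lemma levelWeight_pos {α : ℝ} {n : ℕ} {q η : ℝ} (hq : 0 < q) (hη : 0 ≤ η) (j : ℕ) :
    0 < levelWeight α n q η j := by
  unfold levelWeight
  positivity

lemma exists_sum_levelWeight_le {α : ℝ} (hα : 0 < α) :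
    ∃ S, 0 ≤ S ∧ ∀ (n j0 : ℕ) (q η : ℝ), 0 < q → 0 ≤ η → Nat.clog 2 n * η ≤ 1 →
      ∑ j ∈ Finset.Ico j0 (Nat.clog 2 n), levelWeight α n q η j ≤ S := by
  have hlt : ∀ a : ℝ, 0 < a → 0 < (1 - (2 : ℝ) ^ (-a))⁻¹ := fun a ha =>
    inv_pos.2 (sub_pos.2 (Real.rpow_lt_one_of_one_lt_of_neg (by norm_num) (by linarith)))
  have h1 := hlt (1 / 2) (by norm_num)
  have h2 := hlt α hα
  refine ⟨(1 - (2 : ℝ) ^ (-(1 / 2 : ℝ)))⁻¹ + (1 - (2 : ℝ) ^ (-α))⁻¹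
    + (1 - (2 : ℝ) ^ (-(1 / 2 : ℝ)))⁻¹ + 1, by positivity, ?_⟩
  intro n j0 q η hq hη hJ
  set s := Finset.Ico j0 (Nat.clog 2 n)
  simp only [levelWeight, Finset.sum_add_distrib]
  refine add_le_add (add_le_add ?_ ?_) ?_
  · rw [← Finset.sum_filter_add_sum_filter_not s (fun j => (2 : ℝ) ^ j ≤ q)]
    refine add_le_add ?_ ?_
    · exact (Finset.sum_le_sum fun j _ => min_le_left _ _).trans
        (sum_rpow_le_of_le (by norm_num) _ fun j hj => (Finset.mem_filter.1 hj).2)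
    · exact (Finset.sum_le_sum fun j _ => min_le_right _ _).trans
        (sum_rpow_neg_le_of_le hα hq _ fun j hj => (not_le.1 (Finset.mem_filter.1 hj).2).le)
  · refine sum_rpow_le_of_le (by norm_num) _ fun j hj => ?_
    have : 2 ^ j < n := Nat.pow_lt_of_lt_clog (Finset.mem_Ico.1 hj).2
    exact_mod_cast this.le
  · rw [Finset.sum_const, nsmul_eq_mul]
    refine le_trans ?_ hJ
    gcongr
    simp [s]

/-- At the critical scale `T ^ (-1 / (1 + 2 α))` the variance bound `T` and the squared bias bound
balance. -/
lemma two_pow_mul_min_eq {α T : ℝ} (hα : 0 < α) (hT : 0 < T) (j : ℕ) :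
    (2 : ℝ) ^ j * min (((2 : ℝ) ^ j) ^ (-(1 + 2 * α))) T
      = T ^ (2 * α / (1 + 2 * α))
        * (min (((2 : ℝ) ^ j / T ^ (-(1 / (1 + 2 * α)))) ^ (1 / 2 : ℝ))
          (((2 : ℝ) ^ j / T ^ (-(1 / (1 + 2 * α)))) ^ (-α))) ^ 2 := by
  set X : ℝ := 2 ^ j
  have hX : 0 < X := by positivity
  have hd : 1 + 2 * α ≠ 0 := by positivity
  set ρ := X / T ^ (-(1 / (1 + 2 * α))) with hρ
  have hρ0 : 0 < ρ := by positivity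
  have hρ' : ρ = X * T ^ (1 / (1 + 2 * α)) := by
    rw [hρ, Real.rpow_neg hT.le, div_inv_eq_mul]
  have hsq : ∀ a b : ℝ, 0 ≤ a → 0 ≤ b → (min a b) ^ 2 = min (a ^ 2) (b ^ 2) := by
    intro a b ha hb
    rcases le_total a b with h | h
    · rw [min_eq_left h, min_eq_left (by gcongr)]
    · rw [min_eq_right h, min_eq_right (by gcongr)]
  rw [hsq _ _ (by positivity) (by positivity), mul_min_of_nonneg _ _ hX.le,
    mul_min_of_nonneg _ _ (by positivity), min_comm]
  congr 1
  · rw [← Real.rpow_mul_natCast hρ0.le]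
    norm_num
    rw [hρ', mul_left_comm, ← Real.rpow_add hT]
    congr 1
    rw [← add_div, add_comm, div_self hd, Real.rpow_one]
  · rw [← Real.rpow_mul_natCast hρ0.le, hρ', Real.mul_rpow hX.le (by positivity),
      ← Real.rpow_mul hT.le, mul_left_comm, ← Real.rpow_add hT, ← Real.rpow_one_add' hX.le]
    · have e : 2 * α / (1 + 2 * α) + 1 / (1 + 2 * α) * (-α * (2 : ℕ)) = 0 := by
        field_simp
        push_cast
        ring
      rw [e, Real.rpow_zero, mul_one]
      congr 1
      push_cast
      ring
    · intro h
      have : 1 + -(1 + 2 * α) = -(2 * α) := by ring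
      rw [this] at h
      linarith

lemma le_levelWeight_sq {α T : ℝ} (hα : 0 < α) (hT : 0 < T) {n : ℕ} (hn : 0 < n)
    (hTn : 1 / (n : ℝ) ≤ T) {η : ℝ} (hη : 0 ≤ η) (j : ℕ) :
    (2 : ℝ) ^ j * (min (((2 : ℝ) ^ j) ^ (-(1 + 2 * α))) T
        + 1 / n * (1 / n) ^ (2 * α / (1 + 2 * α))) + T ^ (2 * α / (1 + 2 * α)) * η ^ 2
      ≤ T ^ (2 * α / (1 + 2 * α)) * levelWeight α n (T ^ (-(1 / (1 + 2 * α)))) η j ^ 2 := by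
  have hn' : (0 : ℝ) < n := by exact_mod_cast hn
  rw [mul_add, two_pow_mul_min_eq hα hT, levelWeight]
  set u := min (((2 : ℝ) ^ j / T ^ (-(1 / (1 + 2 * α)))) ^ (1 / 2 : ℝ))
          (((2 : ℝ) ^ j / T ^ (-(1 / (1 + 2 * α)))) ^ (-α)) with hu
  have hu0 : 0 ≤ u := by positivity
  set v := ((2 : ℝ) ^ j / n) ^ (1 / 2 : ℝ) with hv
  have hv0 : 0 ≤ v := by positivity
  have hv2 : v ^ 2 = 2 ^ j / n := by
    rw [hv, ← Real.rpow_mul_natCast (by positivity)]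
    norm_num
  have h1 : (2 : ℝ) ^ j * (1 / n * (1 / n) ^ (2 * α / (1 + 2 * α)))
      ≤ T ^ (2 * α / (1 + 2 * α)) * v ^ 2 := by
    rw [hv2]
    calc _ = (1 / n : ℝ) ^ (2 * α / (1 + 2 * α)) * (2 ^ j / n) := by ring
      _ ≤ _ := by gcongr
  have h2 : 0 ≤ T ^ (2 * α / (1 + 2 * α)) := by positivity
  have h3 : u ^ 2 + v ^ 2 + η ^ 2 ≤ (u + v + η) ^ 2 := by
    nlinarith [mul_nonneg hu0 hv0, mul_nonneg hu0 hη, mul_nonneg hv0 hη]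
  nlinarith [mul_le_mul_of_nonneg_left h3 h2]

/-- What the local risk at sample size `n` depends on: `yt`, `y` are the empirical and `ξ`, `θ` the
true coefficients of `f`. Besides measurability, these are bounds, with a common constant `K`, for
the risk of the father coefficients, for the remainder of the wavelet series at the level where the
estimator stops, and for the risks of single wavelet coefficients and of whole blocks. The last
summands in these risks account for pure noise that passes the threshold. -/
structure CoeffControl {Ω : Type*} [MeasurableSpace Ω] (P : Measure Ω) {r : ℕ}
    (W : IntervalWavelet r) (lam α K : ℝ) (n : ℕ) (f : ℝ → ℝ) (yt : ℕ → Ω → ℝ)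
    (y : ℕ → ℕ → Ω → ℝ) (ξ : ℕ → ℝ) (θ : ℕ → ℕ → ℝ) : Prop where
  aemeasurable_father : ∀ k ∈ Finset.Icc 1 (2 ^ W.j0), AEMeasurable (yt k) P
  aemeasurable_mother : ∀ j ≥ W.j0, ∀ k ∈ Finset.Icc 1 (2 ^ j), AEMeasurable (y j k) P
  father : ∀ k ∈ Finset.Icc 1 (2 ^ W.j0),
    ∫⁻ ω, ENNReal.ofReal ((yt k ω - ξ k) ^ 2) ∂P ≤ ENNReal.ofReal (1 / n)
  remainder : ∀ᵐ x ∂(volume.restrict (Icc (0 : ℝ) 1)),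
    |f x - ((∑ k ∈ Finset.Icc 1 (2 ^ W.j0), ξ k * W.father k x)
      + ∑ j ∈ Finset.Ico W.j0 (Nat.clog 2 n), W.level θ j x)| ≤ K * (n : ℝ) ^ (-α)
  coordinate : ∀ j ∈ Finset.Ico W.j0 (Nat.clog 2 n), ∀ k ∈ Finset.Icc 1 (2 ^ j),
    ∫⁻ ω, ENNReal.ofReal ((thetaHat lam n (fun j k => y j k ω) j k - θ j k) ^ 2) ∂P
      ≤ ENNReal.ofReal (K * (min (((2 : ℝ) ^ j) ^ (-(1 + 2 * α))) (blockLength n / n)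
        + 1 / n * (1 / n) ^ (2 * α / (1 + 2 * α))))
  sum_block : ∀ j ∈ Finset.Ico W.j0 (Nat.clog 2 n), ∀ k ∈ Finset.Icc 1 (2 ^ j),
    ∑ i ∈ block n j k,
      ∫⁻ ω, ENNReal.ofReal ((thetaHat lam n (fun j k => y j k ω) j i - θ j i) ^ 2) ∂P
      ≤ ENNReal.ofReal (blockLength n * (K * (min (((2 : ℝ) ^ j) ^ (-(1 + 2 * α))) (1 / n)
        + 1 / n * (1 / n) ^ (2 * α / (1 + 2 * α)))))

/-- If every level obeys the bound with variance `T` per coordinate, the local risk is of order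
`T ^ (2 α / (1 + 2 α))`. The perturbation `η` may be as large as the inverse number of levels. -/
theorem exists_localRisk_le_rate {r : ℕ} {W : IntervalWavelet r} {C : ℝ} (hW : W.HasBound C)
    {α K K' : ℝ} (hα : 0 < α) (hK' : 0 ≤ K') :
    ∃ A : ℝ, ∀ {Ω : Type*} [MeasurableSpace Ω] {P : Measure Ω} [IsProbabilityMeasure P]
      {lam x0 c T η : ℝ} {n : ℕ} {f : ℝ → ℝ} {yt : ℕ → Ω → ℝ} {y : ℕ → ℕ → Ω → ℝ}
      {ξ : ℕ → ℝ} {θ : ℕ → ℕ → ℝ}, 0 < n → 0 < c → 1 / (n : ℝ) ≤ T → 0 ≤ η →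
      Nat.clog 2 n * η ≤ 1 → CoeffControl P W lam α K n f yt y ξ θ →
      (∀ j ∈ Finset.Ico W.j0 (Nat.clog 2 n), ∑ k ∈ Finset.Icc 1 (2 ^ j),
        (∫⁻ ω, ENNReal.ofReal ((thetaHat lam n (fun j k => y j k ω) j k - θ j k) ^ 2) ∂P)
          * ∫⁻ x in Icc (x0 - c) (x0 + c) ∩ Icc 0 1, ENNReal.ofReal (W.mother j k x ^ 2)
        ≤ ENNReal.ofReal (2 * c * (K' *
          ((2 : ℝ) ^ j * (min (((2 : ℝ) ^ j) ^ (-(1 + 2 * α))) T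
            + 1 / n * (1 / n) ^ (2 * α / (1 + 2 * α))) + T ^ (2 * α / (1 + 2 * α)) * η ^ 2)))) →
      localRisk P (fun ω => blockJS W lam n (fun k => yt k ω) (fun j k => y j k ω)) f x0 c
        ≤ ENNReal.ofReal (A * T ^ (2 * α / (1 + 2 * α))) := by
  obtain ⟨S, hS, hsum⟩ := exists_sum_levelWeight_le hα
  set K1 := K' + K ^ 2 with hK1
  have hK10 : 0 ≤ K1 := by positivity
  refine ⟨3 * 2 ^ W.j0 * C ^ 2 * 2 ^ W.j0 + 3 * S * (2 * C + 1) * (K1 * S) + 3 * K1, ?_⟩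
  intro Ω _ P _ lam x0 c T η n f yt y ξ θ hn hc hTn hη hJ hctl hlevel
  have hn' : (0 : ℝ) < n := by exact_mod_cast hn
  have hn1 : (1 : ℝ) ≤ n := by exact_mod_cast hn
  have hT : 0 < T := lt_of_lt_of_le (by positivity) hTn
  set κ := 2 * α / (1 + 2 * α) with hκ
  have hκ0 : 0 < κ := by positivity
  have hκ1 : κ ≤ 1 := by rw [hκ, div_le_one (by positivity)]; linarith
  have hκα : κ ≤ 2 * α := by
    rw [hκ, div_le_iff₀ (by positivity)]
    nlinarith
  have hinv : (1 / n : ℝ) ^ κ ≤ T ^ κ := by gcongr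
  have hq : 0 < T ^ (-(1 / (1 + 2 * α))) := by positivity
  refine localRisk_le hW (w := levelWeight α n (T ^ (-(1 / (1 + 2 * α)))) η)
    (δ := K * (n : ℝ) ^ (-α)) (ξ := ξ) (θ := θ) hc (by positivity) hK10 hctl.aemeasurable_father
    hctl.aemeasurable_mother hctl.remainder ?_ (fun k hk => (hctl.father k hk).trans ?_)
    (levelWeight_pos hq hη) (hsum n W.j0 _ η hq hη hJ) fun j hj => (hlevel j hj).trans ?_
  · have h1 : ((n : ℝ) ^ (-α)) ^ 2 ≤ T ^ κ := by
      refine le_trans ?_ hinv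
      rw [one_div, Real.inv_rpow hn'.le, ← Real.rpow_neg hn'.le, ← Real.rpow_mul_natCast hn'.le]
      refine Real.rpow_le_rpow_of_exponent_le hn1 ?_
      push_cast
      linarith
    rw [mul_pow]
    gcongr
    linarith
  · refine ENNReal.ofReal_le_ofReal (le_trans ?_ hinv)
    have : (1 / n : ℝ) ^ (1 : ℝ) ≤ (1 / n : ℝ) ^ κ :=
      Real.rpow_le_rpow_of_exponent_ge (by positivity) (by
        rw [div_le_one hn']
        exact hn1) hκ1
    rwa [Real.rpow_one] at this
  · refine ENNReal.ofReal_le_ofReal ?_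
    have h1 := le_levelWeight_sq hα hT hn hTn hη j
    rw [mul_assoc K1]
    have h2 : K' ≤ K1 := by
      rw [hK1]
      linarith [sq_nonneg K]
    gcongr

/-! ### Uniform control over the Hölder class -/

lemma blockLength_le_log {n : ℕ} (hn : 0 < n) : (blockLength n : ℝ) ≤ Real.log n :=
  Nat.floor_le (Real.log_nonneg (by exact_mod_cast hn))

lemma log_lt_blockLength_add_one (n : ℕ) : Real.log n < blockLength n + 1 :=
  Nat.lt_floor_add_one _

lemma tendsto_blockLength : Tendsto (fun n => (blockLength n : ℝ)) atTop atTop := by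
  have h : Tendsto (fun n : ℕ => Real.log n - 1) atTop atTop :=
    tendsto_atTop_add_const_right _ _ (Real.tendsto_log_atTop.comp tendsto_natCast_atTop_atTop)
  exact tendsto_atTop_mono (fun n => by linarith [log_lt_blockLength_add_one n]) h

lemma eventually_const_mul_log_rpow_le {s : ℝ} (hs : 0 < s) (D p : ℝ) :
    ∀ᶠ n : ℕ in atTop, D * Real.log n ^ p ≤ (n : ℝ) ^ s := by
  have h1 := ((isLittleO_log_rpow_rpow_atTop p hs).const_mul_left D).comp_tendsto
    tendsto_natCast_atTop_atTop
  filter_upwards [h1.def one_pos] with n hn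
  simp only [Function.comp, one_mul, Real.norm_eq_abs] at hn
  rw [abs_of_nonneg (by positivity : (0 : ℝ) ≤ (n : ℝ) ^ s)] at hn
  exact (le_abs_self _).trans hn

/-- The threshold constant `lam` may be lowered to some `μ` while the Chernoff exponent, which is
`1` at `lam`, stays above a given `κ < 1`. -/
lemma exists_lt_chernoff_exponent {lam κ : ℝ} (hlam_one : 1 < lam)
    (hlam : lam - Real.log lam - 1 = 2) (hκ : κ < 1) :
    ∃ μ, 1 < μ ∧ μ < lam ∧ κ < (μ - 1 - Real.log μ) / 2 := by
  have hcont : ContinuousAt (fun μ : ℝ => (μ - 1 - Real.log μ) / 2) lam := by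
    have : lam ≠ 0 := by linarith
    fun_prop (disch := assumption)
  have h1 : ∀ᶠ μ in 𝓝 lam, κ < (μ - 1 - Real.log μ) / 2 :=
    hcont.eventually (lt_mem_nhds (by linarith))
  have h2 : ∀ᶠ μ in 𝓝[<] lam, μ ∈ Ioo 1 lam := Ioo_mem_nhdsLT hlam_one
  obtain ⟨μ, h3, h4⟩ := ((h1.filter_mono nhdsWithin_le_nhds).and h2).exists
  exact ⟨μ, h4.1, h4.2, h3⟩

/-- Pure noise passes the threshold so rarely that its contribution stays below `n ^ (-1 - κ)`. -/
lemma eventually_truncated_le {μ κ : ℝ} (hμ : 0 < μ) (hκ0 : 0 ≤ κ)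
    (hκ : κ < (μ - 1 - Real.log μ) / 2) :
    ∀ᶠ n : ℕ in atTop, μ * blockLength n / n *
      Real.exp (-((μ - 1 - Real.log μ) / 2 * blockLength n)) ≤ 1 / n * (1 / n : ℝ) ^ κ := by
  set ρ := (μ - 1 - Real.log μ) / 2
  -- the block length falls short of `log n` by up to one, whence the factor `exp ρ`
  filter_upwards [eventually_const_mul_log_rpow_le (sub_pos.2 hκ) (μ * Real.exp ρ) 1,
    eventually_gt_atTop 0] with n hn hn0
  have hn' : (0 : ℝ) < n := by exact_mod_cast hn0
  have hρ : 0 < ρ := lt_of_le_of_lt hκ0 hκ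
  have h1 : Real.exp (-(ρ * blockLength n)) ≤ Real.exp ρ * (n : ℝ) ^ (-ρ) := by
    rw [Real.rpow_def_of_pos hn', ← Real.exp_add]
    refine Real.exp_le_exp.2 ?_
    nlinarith [log_lt_blockLength_add_one n]
  rw [Real.rpow_one] at hn
  calc μ * blockLength n / n * Real.exp (-(ρ * blockLength n))
      ≤ μ * Real.log n / n * (Real.exp ρ * (n : ℝ) ^ (-ρ)) := by
        gcongr
        exact blockLength_le_log hn0
    _ = 1 / n * ((μ * Real.exp ρ * Real.log n) * (n : ℝ) ^ (-ρ)) := by ring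
    _ ≤ 1 / n * ((n : ℝ) ^ (ρ - κ) * (n : ℝ) ^ (-ρ)) := by gcongr
    _ = _ := by
        rw [← Real.rpow_add hn', one_div (n : ℝ), Real.inv_rpow hn'.le, ← Real.rpow_neg hn'.le]
        congr 2
        ring

lemma isGaussianSequence_of_isWienerIntegral {Ω : Type*} [MeasurableSpace Ω] {P : Measure Ω}
    {B : ℝ≥0 → Ω → ℝ} (hB : IsPreBrownianReal B P) {n : ℕ} {f : ℝ → ℝ}
    (hf : MemLp f 2 (volume.restrict (Icc (0 : ℝ) 1))) {g : ℕ → ℝ → ℝ} {Y : ℕ → Ω → ℝ}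
    {b : Finset ℕ} (hg : ∀ i ∈ b, MemLp (g i) 2 (volume.restrict (Icc (0 : ℝ) 1)))
    (hg' : ∀ i ∈ b, ∀ j ∈ b, ∫ x in Icc (0 : ℝ) 1, g i x * g j x = if i = j then 1 else 0)
    (hY : ∀ i ∈ b, IsWienerIntegral P (observation B n f) (g i) (Y i)) :
    IsGaussianSequence P n b (fun i => ∫ x in Icc (0 : ℝ) 1, f x * g i x) Y := by
  refine ⟨fun i hi => (hY i hi).1, ?_⟩
  refine map_wienerIntegral_eq_pi hB hf (g := fun i : b => g i) (fun i => hg i i.2)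
    (fun i j => ?_) (Y := fun i : b => Y i) (fun i => hY i i.2)
  rw [hg' i i.2 j j.2]
  simp only [Subtype.ext_iff]

/-- The coefficients of Hölder functions are controlled uniformly over the Hölder class. -/
theorem exists_coeffControl {Ω : Type*} [MeasurableSpace Ω] {P : Measure Ω}
    {B : ℝ≥0 → Ω → ℝ} (hB : IsPreBrownianReal B P) {r : ℕ} {W : IntervalWavelet r} {C : ℝ}
    (hW : W.HasBound C) {lam : ℝ} (hlam_one : 1 < lam) (hlam : lam - Real.log lam - 1 = 2)
    {yt : ℕ → (ℝ → ℝ) → ℕ → Ω → ℝ} {y : ℕ → (ℝ → ℝ) → ℕ → ℕ → Ω → ℝ}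
    (hy : IsEmpiricalCoeff P B W yt y) {M : ℝ} (hM : 0 ≤ M) {α : ℝ} (hα : 0 < α) (hαr : α < r) :
    ∃ K : ℝ, 0 ≤ K ∧ ∀ᶠ n : ℕ in atTop, ∀ f ∈ holderClass α M,
      CoeffControl P W lam α K n f (yt n f) (y n f)
        (fun k => ∫ t in Icc (0 : ℝ) 1, f t * W.father k t)
        (fun j k => ∫ t in Icc (0 : ℝ) 1, f t * W.mother j k t) := by
  have hP : IsProbabilityMeasure P := hB.isGaussianProcess.isProbabilityMeasure
  have hC := hW.one_le
  set κ := 2 * α / (1 + 2 * α) with hκ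
  have hκ0 : 0 < κ := by positivity
  have hκ1 : κ < 1 := by rw [hκ, div_lt_one (by positivity)]; linarith
  obtain ⟨μ, hμ, hμl, hμκ⟩ := exists_lt_chernoff_exponent hlam_one hlam hκ1
  obtain ⟨K0, hK0, hrisk⟩ := exists_risk_bounds (lam := lam) hμ hμl
  set D : ℝ := M * (2 * C) ^ α * C * (4 * C) with hD
  have hD0 : 0 ≤ D := by positivity
  set q : ℝ := 2 ^ (-α) with hq
  have hq0 : 0 < q := by positivity
  have hq1 : q < 1 := Real.rpow_lt_one_of_one_lt_of_neg (by norm_num) (by linarith)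
  set Kr : ℝ := D * ((2 * C + 1) * C) * (1 - q)⁻¹ with hKr
  have hKr0 : 0 ≤ Kr := by
    have : 0 ≤ (1 - q)⁻¹ := inv_nonneg.2 (by linarith)
    positivity
  set K1 := K0 * max (D ^ 2) 1 with hK1
  have hK10 : 0 ≤ K1 := by positivity
  refine ⟨K1 + 1 + Kr, by positivity, ?_⟩
  filter_upwards [eventually_gt_atTop 0, eventually_ge_atTop (2 ^ W.j0),
    eventually_truncated_le (zero_lt_one.trans hμ) hκ0.le hμκ,
    tendsto_blockLength.eventually_ge_atTop (2 / (μ - 1))] with n hn hnj htr hL f hf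
  have hn' : (0 : ℝ) < n := by exact_mod_cast hn
  have hfL := memLp_of_mem_holderClass hf 2
  have hL' : 2 ≤ (μ - 1) * blockLength n := by
    rw [div_le_iff₀ (by linarith)] at hL
    linarith
  have hcoeff : ∀ j ≥ W.j0, ∀ k ∈ Finset.Icc 1 (2 ^ j),
      |∫ t in Icc (0 : ℝ) 1, f t * W.mother j k t| ≤ D * 2 ^ (-(j : ℝ) * (α + 1 / 2)) :=
    fun j hj k hk => hW.abs_coeff_le hα hαr hM hf hj hk
  have hsq : ∀ j ≥ W.j0, ∀ k ∈ Finset.Icc 1 (2 ^ j),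
      (∫ t in Icc (0 : ℝ) 1, f t * W.mother j k t) ^ 2
        ≤ D ^ 2 * ((2 : ℝ) ^ j) ^ (-(1 + 2 * α)) := by
    intro j hj k hk
    rw [← sq_abs]
    calc _ ≤ (D * 2 ^ (-(j : ℝ) * (α + 1 / 2))) ^ 2 := by
          gcongr
          exact hcoeff j hj k hk
      _ = _ := by
          rw [mul_pow, ← Real.rpow_mul_natCast (by norm_num), ← Real.rpow_natCast 2 j,
            ← Real.rpow_mul (by norm_num)]
          congr 2
          push_cast
          ring
  have hG : ∀ j ≥ W.j0, ∀ k ∈ Finset.Icc 1 (2 ^ j), IsGaussianSequence P n (block n j k)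
      (fun k => ∫ t in Icc (0 : ℝ) 1, f t * W.mother j k t) (y n f j) := by
    intro j hj k _
    have hmem : ∀ i ∈ block n j k, i ∈ Finset.Icc 1 (2 ^ j) := fun i hi => (mem_block.1 hi).1
    refine isGaussianSequence_of_isWienerIntegral hB hfL
      (fun i hi => hW.memLp_mother hj (hmem i hi) 2) (fun i hi l hl => ?_)
      (fun i hi => hy.mother n hn f hfL j hj i (hmem i hi))
    have := W.orthonormal_ψ j hj i (hmem i hi) j hj l (hmem l hl)
    simpa only [IntervalWavelet.mother, true_and] using this
  have hmin : ∀ (j : ℕ) (T : ℝ), 0 ≤ T →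
      K0 * min (D ^ 2 * ((2 : ℝ) ^ j) ^ (-(1 + 2 * α))) T + 1 / n * (1 / n : ℝ) ^ κ
        ≤ (K1 + 1 + Kr) * (min (((2 : ℝ) ^ j) ^ (-(1 + 2 * α))) T + 1 / n * (1 / n : ℝ) ^ κ) := by
    intro j T hT
    set b := ((2 : ℝ) ^ j) ^ (-(1 + 2 * α)) with hb
    have hb0 : 0 < b := by positivity
    set e := 1 / n * (1 / n : ℝ) ^ κ with he
    have he0 : 0 ≤ e := by positivity
    have hm0 : 0 ≤ min b T := le_min hb0.le hT
    have h1 : min (D ^ 2 * b) T ≤ max (D ^ 2) 1 * min b T := by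
      rw [mul_min_of_nonneg _ _ (by positivity)]
      refine min_le_min ?_ ?_
      · gcongr
        exact le_max_left _ _
      · exact le_mul_of_one_le_left hT (le_max_right _ _)
    have h2 := mul_le_mul_of_nonneg_left h1 hK0
    rw [← mul_assoc, ← hK1] at h2
    nlinarith [mul_nonneg hK10 he0, mul_nonneg hKr0 he0, mul_nonneg hKr0 hm0]
  refine ⟨fun k hk => (hy.father n hn f hfL k hk).1,
    fun j hj k hk => (hy.mother n hn f hfL j hj k hk).1, fun k hk => ?_, ?_,
    fun j hj k hk => ?_, fun j hj k hk => ?_⟩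
  · have h1 : IsGaussianSequence P n {k}
        (fun k => ∫ t in Icc (0 : ℝ) 1, f t * W.father k t) (yt n f) := by
      refine isGaussianSequence_of_isWienerIntegral hB hfL (fun i hi => ?_) (fun i hi l hl => ?_)
        fun i hi => ?_
      · rw [Finset.mem_singleton.1 hi]
        exact hW.memLp_father hk 2
      · rw [Finset.mem_singleton.1 hi, Finset.mem_singleton.1 hl]
        exact W.orthonormal_φ k hk k hk
      · rw [Finset.mem_singleton.1 hi]
        exact hy.father n hn f hfL k hk
    exact (h1.lintegral_sq (Finset.mem_singleton_self k)).le
  · have hJ : W.j0 ≤ Nat.clog 2 n := by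
      have := hnj.trans (Nat.le_pow_clog (by norm_num : 1 < 2) n)
      exact (Nat.pow_le_pow_iff_right (by norm_num)).1 this
    filter_upwards [hW.ae_abs_sub_le hα hD0 hfL hcoeff hJ] with x hx
    refine hx.trans ?_
    have h1 : q ^ (Nat.clog 2 n) ≤ (n : ℝ) ^ (-α) := by
      have h2 : (n : ℝ) ≤ 2 ^ (Nat.clog 2 n) := by
        exact_mod_cast Nat.le_pow_clog (by norm_num : 1 < 2) n
      calc q ^ (Nat.clog 2 n) = ((2 : ℝ) ^ (Nat.clog 2 n)) ^ (-α) := by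
            rw [hq, ← Real.rpow_mul_natCast (by norm_num), ← Real.rpow_natCast,
              ← Real.rpow_mul (by norm_num), mul_comm]
        _ ≤ _ := Real.rpow_le_rpow_of_nonpos hn' h2 (by linarith)
    rw [← hKr]
    have h3 : 0 ≤ q ^ (Nat.clog 2 n) := by positivity
    have h4 : 0 ≤ (n : ℝ) ^ (-α) := by positivity
    nlinarith [mul_le_mul_of_nonneg_left h1 hKr0, mul_nonneg hK10 h4]
  · rw [Finset.mem_Ico] at hj
    refine (hrisk (θ := fun j k => ∫ t in Icc (0 : ℝ) 1, f t * W.mother j k t) (y := y n f) hn hL'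
      hj.2 (hG j hj.1) (hsq j hj.1) htr k hk).1.trans ?_
    exact ENNReal.ofReal_le_ofReal (hmin j _ (by positivity))
  · rw [Finset.mem_Ico] at hj
    refine (hrisk (θ := fun j k => ∫ t in Icc (0 : ℝ) 1, f t * W.mother j k t) (y := y n f) hn hL'
      hj.2 (hG j hj.1) (hsq j hj.1) htr k hk).2.trans ?_
    refine ENNReal.ofReal_le_ofReal ?_
    gcongr
    exact hmin j _ (by positivity)

/-! ### Localizing the risk of a level -/

section
variable {Ω : Type*} [MeasurableSpace Ω] {P : Measure Ω} {r : ℕ} {W : IntervalWavelet r}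
  {C lam α K x0 c : ℝ} {n : ℕ} {f : ℝ → ℝ} {yt : ℕ → Ω → ℝ} {y : ℕ → ℕ → Ω → ℝ} {ξ : ℕ → ℝ}
  {θ : ℕ → ℕ → ℝ}

/-- The risk of a level from the risks of its single coordinates: valid for arbitrarily short
neighbourhoods, at the price of the variance bound `L / n`. -/
lemma CoeffControl.level_le_of_coordinate (h : CoeffControl P W lam α K n f yt y ξ θ)
    (hW : W.HasBound C) (hK : 0 ≤ K) {j : ℕ}
    (hj : j ∈ Finset.Ico W.j0 (Nat.clog 2 n)) :
    ∑ k ∈ Finset.Icc 1 (2 ^ j),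
        (∫⁻ ω, ENNReal.ofReal ((thetaHat lam n (fun j k => y j k ω) j k - θ j k) ^ 2) ∂P)
          * ∫⁻ x in Icc (x0 - c) (x0 + c) ∩ Icc 0 1, ENNReal.ofReal (W.mother j k x ^ 2)
      ≤ ENNReal.ofReal (2 * c * (K * ((2 * C + 1) * C ^ 2) *
        ((2 : ℝ) ^ j * (min (((2 : ℝ) ^ j) ^ (-(1 + 2 * α))) (blockLength n / n)
          + 1 / n * (1 / n) ^ (2 * α / (1 + 2 * α)))))) := by
  have hC := hW.one_le
  set I : Set ℝ := Icc (x0 - c) (x0 + c) ∩ Icc 0 1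
  set b := min (((2 : ℝ) ^ j) ^ (-(1 + 2 * α))) (blockLength n / n)
          + 1 / n * (1 / n : ℝ) ^ (2 * α / (1 + 2 * α)) with hb
  have hb0 : 0 ≤ b := by positivity
  have hj0 := (Finset.mem_Ico.1 hj).1
  calc _ ≤ ∑ k ∈ Finset.Icc 1 (2 ^ j), ENNReal.ofReal (K * b)
          * ∫⁻ x in I, ENNReal.ofReal (W.mother j k x ^ 2) := by
        refine Finset.sum_le_sum fun k hk => ?_
        exact mul_le_mul_left (h.coordinate j hj k hk) _
    _ = ENNReal.ofReal (K * b) * ∫⁻ x in I, ENNReal.ofReal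
          (∑ k ∈ Finset.Icc 1 (2 ^ j), W.mother j k x ^ 2) := by
        rw [← Finset.mul_sum, ← lintegral_finsetSum]
        · congr 2
          ext x
          rw [ENNReal.ofReal_sum_of_nonneg fun _ _ => sq_nonneg _]
        · exact fun k hk => ((hW.measurable_mother j hj0 k hk).pow_const 2).ennreal_ofReal
    _ ≤ ENNReal.ofReal (K * b) * ∫⁻ x in I, ENNReal.ofReal ((2 * C + 1) * C ^ 2 * 2 ^ j) := by
        gcongr with x
        exact hW.sum_sq_mother_le hj0 x
    _ ≤ ENNReal.ofReal (K * b) * (ENNReal.ofReal ((2 * C + 1) * C ^ 2 * 2 ^ j)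
          * ENNReal.ofReal (2 * c)) := by
        rw [setLIntegral_const]
        gcongr
        refine (measure_mono inter_subset_left).trans ?_
        rw [Real.volume_Icc]
        exact ENNReal.ofReal_le_ofReal (by linarith)
    _ = _ := by
        rw [← ENNReal.ofReal_mul (by positivity), ← ENNReal.ofReal_mul (by positivity)]
        congr 1
        ring

/-- A sum over indices is bounded by the number of blocks that they meet, times a bound for the sum
over a block. -/
lemma sum_le_card_image_mul_block {g : ℕ → ℝ≥0∞} {j : ℕ} {S : Finset ℕ}
    (hS : S ⊆ Finset.Icc 1 (2 ^ j)) {G : ℝ≥0∞}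
    (hg : ∀ k ∈ Finset.Icc 1 (2 ^ j), ∑ i ∈ block n j k, g i ≤ G) :
    ∑ k ∈ S, g k ≤ (S.image fun k => (k - 1) / blockLength n).card * G := by
  rw [← Finset.sum_fiberwise_of_maps_to (fun k hk =>
    Finset.mem_image_of_mem (fun k => (k - 1) / blockLength n) hk), ← nsmul_eq_mul]
  refine Finset.sum_le_card_nsmul _ _ _ fun m hm => ?_
  obtain ⟨k, hk, rfl⟩ := Finset.mem_image.1 hm
  refine le_trans (Finset.sum_le_sum_of_subset fun i hi => ?_) (hg k (hS hk))
  rw [Finset.mem_filter] at hi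
  exact mem_block.2 ⟨hS hi.1, hi.2⟩

/-- The blocks that meet an interval of indices of radius `D` contain at most `2 D + 2 L` indices
when counted with their full length `L`. -/
lemma card_image_block_le {S : Finset ℕ} {a D : ℝ} (hD : 0 ≤ D) (hL : 0 < blockLength n)
    (hS1 : ∀ k ∈ S, 1 ≤ k) (hS : ∀ k ∈ S, |a - k| ≤ D) :
    ((S.image fun k => (k - 1) / blockLength n).card : ℝ) * blockLength n
      ≤ 2 * D + 2 * blockLength n := by
  set L := blockLength n
  have hL' : (0 : ℝ) < L := by exact_mod_cast hL
  -- in units of `L`, the block of number `m` is centred at `m + 1 / 2`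
  have h := card_le_of_forall_abs_sub_le (S := S.image fun k => (k - 1) / L)
    (a := (a - 1) / L - 1 / 2) (D := D / L + 1 / 2) (by positivity) ?_
  · calc _ ≤ (2 * (D / L + 1 / 2) + 1) * L := by gcongr
      _ = _ := by field_simp; ring
  intro m hm
  obtain ⟨k, hk, rfl⟩ := Finset.mem_image.1 hm
  have h1 := abs_le.1 (hS k hk)
  have hk1 := hS1 k hk
  have h2 : (((k - 1) / L : ℕ) : ℝ) * L ≤ k - 1 := by
    have := Nat.div_mul_le_self (k - 1) L
    have h3 : (((k - 1) / L * L : ℕ) : ℝ) ≤ ((k - 1 : ℕ) : ℝ) := by exact_mod_cast this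
    rwa [Nat.cast_mul, Nat.cast_sub hk1, Nat.cast_one] at h3
  have h3 : (k : ℝ) - 1 ≤ (((k - 1) / L : ℕ) : ℝ) * L + L := by
    have := (Nat.lt_div_mul_add hL (a := k - 1)).le
    have h4 : ((k - 1 : ℕ) : ℝ) ≤ (((k - 1) / L * L + L : ℕ) : ℝ) := by exact_mod_cast this
    rwa [Nat.cast_sub hk1, Nat.cast_one, Nat.cast_add, Nat.cast_mul] at h4
  set m : ℝ := (((k - 1) / L : ℕ) : ℝ)
  have e : (a - 1) / L - 1 / 2 - m = ((a - k) + ((k - 1) - m * L - L / 2)) / L := by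
    field_simp
    ring
  rw [e, abs_div, abs_of_pos hL', div_le_iff₀ hL']
  rw [abs_le]
  have e2 : (D / L + 1 / 2) * L = D + L / 2 := by field_simp
  rw [e2]
  constructor <;> linarith

/-- The risk of a level from the risks of the blocks that meet the neighbourhood: the variance bound
is `1 / n`, but the blocks that stick out contribute an additional `L / (c n)`. -/
lemma CoeffControl.level_le_of_block (h : CoeffControl P W lam α K n f yt y ξ θ)
    (hW : W.HasBound C) (hK : 0 ≤ K) (hc : 0 < c) (hn : 0 < n) (hL : 0 < blockLength n)
    (hα : 0 < α) {j : ℕ} (hj : j ∈ Finset.Ico W.j0 (Nat.clog 2 n)) :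
    ∑ k ∈ Finset.Icc 1 (2 ^ j),
        (∫⁻ ω, ENNReal.ofReal ((thetaHat lam n (fun j k => y j k ω) j k - θ j k) ^ 2) ∂P)
          * ∫⁻ x in Icc (x0 - c) (x0 + c) ∩ Icc 0 1, ENNReal.ofReal (W.mother j k x ^ 2)
      ≤ ENNReal.ofReal (2 * c * (K * (C + 1) *
        ((2 : ℝ) ^ j * (min (((2 : ℝ) ^ j) ^ (-(1 + 2 * α))) (1 / n)
          + 1 / n * (1 / n) ^ (2 * α / (1 + 2 * α))) + 2 * blockLength n / (c * n)))) := by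
  have hC := hW.one_le
  have hn' : (0 : ℝ) < n := by exact_mod_cast hn
  have hn1 : (1 : ℝ) ≤ n := by exact_mod_cast hn
  have hL1 : (1 : ℝ) ≤ blockLength n := by exact_mod_cast hL
  set I : Set ℝ := Icc (x0 - c) (x0 + c) ∩ Icc 0 1 with hI
  set b := min (((2 : ℝ) ^ j) ^ (-(1 + 2 * α))) (1 / n)
          + 1 / n * (1 / n : ℝ) ^ (2 * α / (1 + 2 * α)) with hb
  have hb0 : 0 ≤ b := by positivity
  have hb2 : b ≤ 2 / n := by
    have h1 : (1 / n : ℝ) ^ (2 * α / (1 + 2 * α)) ≤ 1 :=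
      Real.rpow_le_one (by positivity) ((div_le_one hn').2 hn1) (by positivity)
    have h2 : 1 / n * (1 / n : ℝ) ^ (2 * α / (1 + 2 * α)) ≤ 1 / n * 1 := by gcongr
    have h3 : min (((2 : ℝ) ^ j) ^ (-(1 + 2 * α))) (1 / n) ≤ 1 / (n : ℝ) := min_le_right _ _
    calc b ≤ 1 / n + 1 / n * 1 := add_le_add h3 h2
      _ = _ := by ring
  have hj0 := (Finset.mem_Ico.1 hj).1
  set D : ℝ := 2 ^ j * c + C with hD
  have hD0 : 0 ≤ D := by positivity
  set g : ℕ → ℝ≥0∞ := fun k => ∫⁻ ω, ENNReal.ofReal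
    ((thetaHat lam n (fun j k => y j k ω) j k - θ j k) ^ 2) ∂P
  let S : Finset ℕ := {k ∈ Finset.Icc 1 (2 ^ j) | |2 ^ j * x0 - k| ≤ D}
  have hS : S ⊆ Finset.Icc 1 (2 ^ j) := Finset.filter_subset _ _
  -- the norm of a wavelet on the neighbourhood is at most one, and zero if the wavelet is remote
  have hone : ∀ k ∈ Finset.Icc 1 (2 ^ j), ∫⁻ x in I, ENNReal.ofReal (W.mother j k x ^ 2) ≤ 1 := by
    intro k hk
    have h1 : ∫ t in Icc (0 : ℝ) 1, W.mother j k t * W.mother j k t = 1 := by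
      have := W.orthonormal_ψ j hj0 k hk j hj0 k hk
      simpa only [IntervalWavelet.mother, and_self, if_true] using this
    calc _ ≤ ∫⁻ x in Icc (0 : ℝ) 1, ENNReal.ofReal (W.mother j k x ^ 2) :=
          lintegral_mono_set inter_subset_right
      _ = 1 := by
          rw [← ofReal_integral_eq_lintegral_ofReal (hW.memLp_mother hj0 hk 2).integrable_sq
            (Eventually.of_forall fun _ => sq_nonneg _)]
          simp_rw [sq]
          rw [h1, ENNReal.ofReal_one]
  have hzero : ∀ k ∈ Finset.Icc 1 (2 ^ j), k ∉ S →
      ∫⁻ x in I, ENNReal.ofReal (W.mother j k x ^ 2) = 0 := by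
    intro k hk hkS
    refine (setLIntegral_congr_fun (g := fun _ => 0)
      (measurableSet_Icc.inter measurableSet_Icc) fun x hx => ?_).trans (by simp)
    have h0 : W.mother j k x = 0 := by
      by_contra hne
      refine hkS (Finset.mem_filter.2 ⟨hk, ?_⟩)
      have h1 := (hW.support_mother j hj0 k hk x hne).2
      have h2 : |x0 - x| ≤ c := by
        rw [abs_le]
        constructor <;> linarith [hx.1.1, hx.1.2]
      calc |2 ^ j * x0 - k| = |2 ^ j * (x0 - x) + (2 ^ j * x - k)| := by ring_nf
        _ ≤ |2 ^ j * (x0 - x)| + |2 ^ j * x - k| := abs_add_le _ _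
        _ ≤ _ := by
          rw [abs_mul, abs_of_pos (by positivity : (0 : ℝ) < 2 ^ j), hD]
          gcongr
    simp [h0]
  calc _ ≤ ∑ k ∈ S, g k := by
        rw [← Finset.sum_subset hS]
        · refine Finset.sum_le_sum fun k hk => ?_
          exact (mul_le_mul_right (hone k (hS hk)) _).trans (mul_one _).le
        · intro k hk hkS
          rw [hzero k hk hkS, mul_zero]
    _ ≤ (S.image fun k => (k - 1) / blockLength n).card
          * ENNReal.ofReal (blockLength n * (K * b)) :=
        sum_le_card_image_mul_block hS fun k hk => h.sum_block j hj k hk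
    _ ≤ _ := by
        rw [← ENNReal.ofReal_natCast, ← ENNReal.ofReal_mul (by positivity)]
        refine ENNReal.ofReal_le_ofReal ?_
        have h1 := card_image_block_le (a := 2 ^ j * x0) hD0 hL
          (fun k hk => (Finset.mem_Icc.1 (hS hk)).1) fun k hk => (Finset.mem_filter.1 hk).2
        calc _ = ((S.image fun k => (k - 1) / blockLength n).card : ℝ) * blockLength n
                * (K * b) := by ring
          _ ≤ (2 * D + 2 * blockLength n) * (K * b) := by gcongr
          _ ≤ (2 * c * (C + 1) * 2 ^ j + 2 * (C + 1) * blockLength n) * (K * b) := by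
              refine mul_le_mul_of_nonneg_right ?_ (by positivity)
              have h2 : 0 ≤ c * C * 2 ^ j := by positivity
              have h3 : C ≤ C * blockLength n := le_mul_of_one_le_right (by linarith) hL1
              rw [hD]
              nlinarith
          _ = 2 * c * (K * (C + 1)) * (2 ^ j * b) + 2 * (C + 1) * blockLength n * K * b := by ring
          _ ≤ 2 * c * (K * (C + 1)) * (2 ^ j * b) + 2 * (C + 1) * blockLength n * K * (2 / n) := by
              gcongr
          _ = _ := by
              field_simp
end

/-! ### The rates -/

lemma clog_le_three_mul_log {n : ℕ} (hn : 3 ≤ n) : (Nat.clog 2 n : ℝ) ≤ 3 * Real.log n := by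
  have h1 : (2 : ℝ) ^ (Nat.clog 2 n - 1) ≤ n := by
    exact_mod_cast (Nat.pow_pred_clog_lt_self (by norm_num : 1 < 2) (by omega)).le
  have h2 : ((Nat.clog 2 n - 1 : ℕ) : ℝ) * Real.log 2 ≤ Real.log n := by
    rw [← Real.log_pow]
    exact Real.log_le_log (by positivity) h1
  have h3 : 1 ≤ Nat.clog 2 n := Nat.clog_pos (by norm_num) (by omega)
  rw [Nat.cast_sub h3, Nat.cast_one] at h2
  have h4 : 1 ≤ Real.log n := by
    rw [Real.le_log_iff_exp_le (by positivity)]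
    have : (3 : ℝ) ≤ n := by exact_mod_cast hn
    linarith [Real.exp_one_lt_d9]
  nlinarith [Real.log_two_gt_d9, Real.log_two_lt_d9]

/-- When `γ` is small relative to `α`, the blocks that stick out of the neighbourhood of radius
`n ^ (-γ)` are negligible, even after summation over all levels. -/
lemma eventually_clog_mul_sqrt_le {γ κ : ℝ} (h : γ + κ < 1) :
    ∀ᶠ n : ℕ in atTop, Nat.clog 2 n *
      √(2 * blockLength n / ((n : ℝ) ^ (-γ) * n) * (n : ℝ) ^ κ) ≤ 1 := by
  filter_upwards [eventually_const_mul_log_rpow_le (sub_pos.2 h) 18 (3 : ℕ),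
    eventually_ge_atTop 3] with n h1 hn
  have hn' : (0 : ℝ) < n := by positivity
  have hlog : 0 ≤ Real.log n := Real.log_natCast_nonneg n
  rw [Real.rpow_natCast] at h1
  have e : (n : ℝ) ^ (1 - (γ + κ)) = (n : ℝ) ^ (-γ) * n / (n : ℝ) ^ κ := by
    rw [← Real.rpow_add_one hn'.ne', ← Real.rpow_sub hn']
    ring_nf
  rw [← Real.sqrt_sq (Nat.cast_nonneg (Nat.clog 2 n)), ← Real.sqrt_mul (sq_nonneg _),
    Real.sqrt_le_one]
  calc (Nat.clog 2 n : ℝ) ^ 2 * (2 * blockLength n / ((n : ℝ) ^ (-γ) * n) * (n : ℝ) ^ κ)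
      ≤ (3 * Real.log n) ^ 2 * (2 * Real.log n / ((n : ℝ) ^ (-γ) * n) * (n : ℝ) ^ κ) := by
        gcongr
        · exact clog_le_three_mul_log hn
        · exact blockLength_le_log (by omega)
    _ = 18 * Real.log n ^ 3 / (n : ℝ) ^ (1 - (γ + κ)) := by
        rw [e]
        field_simp
        ring
    _ ≤ 1 := (div_le_one (by positivity)).2 h1

lemma limsup_mul_iSup_lt_top {s : Set (ℝ → ℝ)} {a : ℕ → ℝ≥0∞} {R : ℕ → (ℝ → ℝ) → ℝ≥0∞}
    {A : ℝ≥0∞} (hA : A < ⊤) (h : ∀ᶠ n in atTop, ∀ f ∈ s, a n * R n f ≤ A) :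
    limsup (fun n => a n * ⨆ f ∈ s, R n f) atTop < ⊤ := by
  refine lt_of_le_of_lt (limsup_le_of_le (by isBoundedDefault) ?_) hA
  filter_upwards [h] with n hn
  simp_rw [ENNReal.mul_iSup]
  exact iSup₂_le hn

theorem corollary4 {Ω : Type*} [MeasurableSpace Ω] (P : Measure Ω)
    (B : ℝ≥0 → Ω → ℝ) (hB : IsBrownianReal B P)
    (r : ℕ) (W : IntervalWavelet r)
    (lam : ℝ) (hlam_one : 1 < lam) (hlam : lam - Real.log lam - 1 = 2)
    (yt : ℕ → (ℝ → ℝ) → ℕ → Ω → ℝ) (y : ℕ → (ℝ → ℝ) → ℕ → ℕ → Ω → ℝ)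
    (hy : IsEmpiricalCoeff P B W yt y)
    (x0 : ℝ) (hx0 : 0 < x0) (hx0_lt : x0 < 1)
    (γ : ℝ) (hγ : 0 < γ) (hr : (1 - γ) / (2 * γ) ≤ r)
    (M : ℝ) (hM : 0 < M) (α : ℝ) (hα : 0 < α) :
    (α < (1 - γ) / (2 * γ) →
      limsup (fun n : ℕ => ENNReal.ofReal ((n : ℝ) ^ (2 * α / (1 + 2 * α))) *
        ⨆ f ∈ holderClass α M,
          localRisk P (fun ω => blockJS W lam n (fun k => yt n f k ω) (fun j k => y n f j k ω))
            f x0 ((n : ℝ) ^ (-γ))) atTop < ⊤) ∧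
    ((1 - γ) / (2 * γ) ≤ α → α < r →
      limsup (fun n : ℕ => ENNReal.ofReal (((n : ℝ) / Real.log n) ^ (2 * α / (1 + 2 * α))) *
        ⨆ f ∈ holderClass α M,
          localRisk P (fun ω => blockJS W lam n (fun k => yt n f k ω) (fun j k => y n f j k ω))
            f x0 ((n : ℝ) ^ (-γ))) atTop < ⊤) := by
  have hB' := hB.toIsPreBrownianReal
  have hP : IsProbabilityMeasure P := hB'.isGaussianProcess.isProbabilityMeasure
  obtain ⟨C, hW⟩ := W.exists_hasBound
  have hC := hW.one_le
  set κ := 2 * α / (1 + 2 * α) with hκ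
  have hκ0 : 0 < κ := by positivity
  refine ⟨fun hαγ => ?_, fun _ hαr => ?_⟩
  · obtain ⟨K, hK, hctl⟩ := exists_coeffControl hB' hW hlam_one hlam hy hM.le hα (hαγ.trans_le hr)
    obtain ⟨A, hA⟩ := exists_localRisk_le_rate hW (K := K) hα
      (by positivity : 0 ≤ K * (C + 1))
    have hγκ : γ + κ < 1 := by
      rw [lt_div_iff₀ (by positivity)] at hαγ
      rw [← lt_sub_iff_add_lt', hκ, div_lt_iff₀ (by positivity)]
      linarith
    refine limsup_mul_iSup_lt_top (A := ENNReal.ofReal A) ENNReal.ofReal_lt_top ?_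
    filter_upwards [hctl, eventually_gt_atTop 0, eventually_clog_mul_sqrt_le hγκ,
      tendsto_blockLength.eventually_gt_atTop 0] with n hn hn0 hJ hL f hf
    have hn' : (0 : ℝ) < n := by exact_mod_cast hn0
    have hc : 0 < (n : ℝ) ^ (-γ) := by positivity
    have hL' : 0 < blockLength n := by exact_mod_cast hL
    have hone : (n : ℝ) ^ κ * (1 / n : ℝ) ^ κ = 1 := by
      rw [← Real.mul_rpow hn'.le (by positivity), mul_one_div_cancel hn'.ne', Real.one_rpow]
    -- the perturbation is chosen such that `T ^ κ * η ^ 2` is the contribution `2 L / (c n)` of the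
    -- blocks that stick out
    have h := hA (T := 1 / n) hn0 hc le_rfl (Real.sqrt_nonneg _) hJ (hn f hf) fun j hj => by
      refine ((hn f hf).level_le_of_block (x0 := x0) hW hK hc hn0 hL' hα hj).trans_eq ?_
      rw [Real.sq_sqrt (by positivity)]
      have e : (1 / n : ℝ) ^ κ * (2 * blockLength n / ((n : ℝ) ^ (-γ) * n) * (n : ℝ) ^ κ)
          = 2 * blockLength n / ((n : ℝ) ^ (-γ) * n) := by
        linear_combination (2 * blockLength n / ((n : ℝ) ^ (-γ) * n)) * hone
      rw [e]
    calc _ ≤ ENNReal.ofReal ((n : ℝ) ^ κ) * ENNReal.ofReal (A * (1 / n : ℝ) ^ κ) := by gcongr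
      _ = ENNReal.ofReal A := by
          rw [← ENNReal.ofReal_mul (by positivity)]
          congr 1
          linear_combination A * hone
  · obtain ⟨K, hK, hctl⟩ := exists_coeffControl hB' hW hlam_one hlam hy hM.le hα hαr
    obtain ⟨A, hA⟩ := exists_localRisk_le_rate hW (K := K) hα
      (by positivity : 0 ≤ K * ((2 * C + 1) * C ^ 2))
    refine limsup_mul_iSup_lt_top (A := ENNReal.ofReal |A|) ENNReal.ofReal_lt_top ?_
    filter_upwards [hctl, eventually_gt_atTop 0,
      tendsto_blockLength.eventually_ge_atTop 1] with n hn hn0 hL f hf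
    have hn' : (0 : ℝ) < n := by exact_mod_cast hn0
    have hc : 0 < (n : ℝ) ^ (-γ) := by positivity
    have hlog : blockLength n ≤ Real.log n := blockLength_le_log hn0
    have hlog0 : 0 < Real.log n := by linarith
    have h := hA (T := blockLength n / n) (η := 0) hn0 hc (by gcongr) le_rfl (by simp) (hn f hf)
      fun j hj => by
        refine ((hn f hf).level_le_of_coordinate (x0 := x0) hW hK hj).trans_eq ?_
        simp
    calc _ ≤ ENNReal.ofReal ((n / Real.log n : ℝ) ^ κ)
          * ENNReal.ofReal (A * (blockLength n / n : ℝ) ^ κ) := by gcongr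
      _ ≤ ENNReal.ofReal |A| := by
          rw [← ENNReal.ofReal_mul (by positivity)]
          refine ENNReal.ofReal_le_ofReal ?_
          calc (n / Real.log n : ℝ) ^ κ * (A * (blockLength n / n : ℝ) ^ κ)
              = A * (blockLength n / Real.log n : ℝ) ^ κ := by
                rw [mul_left_comm, ← Real.mul_rpow (by positivity) (by positivity)]
                congr 2
                field_simp
            _ ≤ |A| * 1 := by
                gcongr
                · exact le_abs_self A
                · exact Real.rpow_le_one (by positivity) ((div_le_one hlog0).2 hlog) hκ0.le
            _ = |A| := mul_one _

end
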